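/- **Setting.** Let $\Lambda=\mathbb Z^3$, $\Lambda^\vee=\mathrm{Hom}(\Lambda,\mathbb Z)$, $V=\mathbb Q^3$, $V_{\mathbb R}=\mathbb R^3$, $V_{\mathbb C}=\mathbb C^3$, and let $\Lambda_{prim}\subset\Lambda$ be the set of primitive vectors ($a\in k\Lambda$, $k\in\mathbb Z$, implies $k=\pm1$). For $a\in\Lambda_{prim}$ let $H(a)=\{\alpha\in V^*\mid\alpha(a)=0\}$, where a basis $(\alpha,\beta)$ of $H(a)$ is oriented if $\det(\alpha,\beta,\delta)>0$ whenever $\delta(a)>0$, and let $U_a^+$ be the set of $x\in V_{\mathbb C}$ with $\mathrm{Im}(\alpha(x)\overline{\beta(x)})>0$ for some oriented basis $(\alpha,\beta)$ of $H(a)$. Let $X=X_3=(\mathbb C\times(V_{\mathbb C}\smallsetminus\mathbb C\cdot V_{\mathbb R}))/\mathbb C^\times$ (scalar multiplication of $(w,x)$), with the open covering $V_a=\{(w,x)\mid x\in U_a^+\}/\mathbb C^\times$, $a\in\Lambda_{prim}$. The group $G=\mathrm{ISL}_3(\mathbb Z)=\mathrm{SL}_3(\mathbb Z)\ltimes\mathbb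 Z^3$ acts on $X$ by $(g,\mu)\cdot(w,x)=(w-\mu(x),gx)$, $g\in\mathrm{SL}_3(\mathbb Z)$, $\mu\in\Lambda^\vee$, and on $\Lambda_{prim}$ by $(g,\mu)a=ga$. **Cochains.** A 1-cochain with values in a sheaf of multiplicative groups consists of sections $s_{a,b}$ on $V_a\cap V_b$ and $s_a(g;\cdot)$ on $V_a$ ($a,b\in\Lambda_{prim}$, $g\in G$). Its total differential $Ds$ has the components $$(Ds)_{a,b,c}(y)=\frac{s_{a,b}(y)s_{b,c}(y)}{s_{a,c}(y)},\quad (Ds)_{a,b}(g;y)=\frac{s_{a,b}(y)\,s_a(g;y)}{s_{g^{-1}a,g^{-1}b}(g^{-1}y)\,s_b(g;y)},\quad (Ds)_a(g_1,g_2;y)=\frac{s_a(g_1;y)\,s_{g_1^{-1}a}(g_2;g_1^{-1}y)}{s_a(g_1g_2;y)}$$ on $V_a\cap V_b\cap V_c$, $V_a\cap V_b$ and $V_a$. An equivariant holomorphic gerbe on $X$ (with trivial line bundles over the members of the covering) is a 2-cocycle $\phi=(\phi_{a,b,c},\phi_{a,b}(g;\cdot),\phi_a(g_1,g_2;\cdot))$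 of nowhere vanishing holomorphic functions for this double complex (group cochains of $G$ with values in Čech cochains of $(V_a)$), with $\phi_{a,b,c}$ skew-symmetric. An equivariant hermitian structure on it is a 1-cochain $h=(h_{a,b},h_a)$ of positive smooth functions with $h_{a,b}h_{b,a}=1$ and $Dh=|\phi|^{-2}$ (component by component). **The gamma gerbe.** For linearly independent $a,b\in\Lambda_{prim}$ let $\gamma=\gamma_{a,b}\in\Lambda^\vee$ be the primitive form with $\det(a,b,\cdot)=s\gamma$, $s>0$, let $C_{+-}=\{\delta\in\Lambda^\vee\mid\delta(a)>0,\ \delta(b)\le0\}$, $C_{-+}=\{\delta\in\Lambda^\vee\mid\delta(a)\le0,\ \delta(b)>0\}$, and on $V_a\cap V_b$ put $$\Gamma_{a,b}(w,x)=\frac{\prod_{\delta\in C_{+-}/\mathbb Z\gamma}\left(1-e^{-2\pi i(\delta(x)-w)/\gamma(x)}\right)}{\prod_{\delta\in C_{-+}/\mathbb Z\gamma}\left(1-e^{2\pi i(\delta(x)-w)/\gamma(x)}\right)},\qquad \Gamma_{a,a}=1$$ ($V_a\cap V_{-a}$ is empty). Fix a framing: for each $a\in\Lambda_{prim}$ an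 oriented basis $(\alpha_1,\alpha_2,\alpha_3)$ of $\Lambda^\vee$ with $\alpha_1(a)=1$, $\alpha_2(a)=\alpha_3(a)=0$. For $\mu\in\Lambda^\vee$ put on $V_a$ $$\Delta_a(\mu;w,x)=\prod_{j=0}^{\mu(a)-1}\theta_0\!\left(\frac{w+j\alpha_1(x)}{\alpha_3(x)},\frac{\alpha_2(x)}{\alpha_3(x)}\right),\qquad \theta_0(z,\tau)=\prod_{j=0}^\infty(1-e^{2\pi i((j+1)\tau-z)})(1-e^{2\pi i(j\tau+z)}),$$ and $\Delta_a((g,\mu);w,x)=\Delta_a(\mu\circ g^{-1};w,x)$. Here and below $\prod_{j=0}^{m-1}$ means $\prod_{-N\le j<m}/\prod_{-N\le j<0}$ for large $N$. The gamma gerbe is the equivariant holomorphic gerbe with cocycle $\phi=Ds$, where $s=(\Gamma_{a,b},\Delta_a)$ is regarded as a 1-cochain of meromorphic functions. **The hermitian cochain.** Let $$h_2(z,\tau)=\exp\left(-2\pi\frac{(\mathrm{Im}\,z)^2}{\mathrm{Im}\,\tau}+2\pi\,\mathrm{Im}(z-\tau/6)\right),\qquad h_3(z,\tau,\sigma)=\exp\left(-\tfrac{2\pi}3B_{2,3}(\mathrm{Im}\,z,\mathrm{Im}\,\tau,\mathrm{Im}\,\sigma)\right),$$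 $$B_{2,3}(\zeta,t,s)=\frac{\zeta^3}{ts}-\frac32\left(\frac1t+\frac1s\right)\zeta^2+\left(\frac t{2s}+\frac s{2t}+\frac32\right)\zeta-\frac{t+s}4 .$$ For $a\ne b$ in $\Lambda_{prim}$ choose $\alpha,\beta\in\Lambda^\vee$ with $\alpha(b)=\beta(a)=0$, $\alpha(a)>0$, $\beta(b)>0$, let $F=\{\delta\in\Lambda^\vee\mid 0\le\delta(a)<\alpha(a),\ 0\le\delta(b)<\beta(b)\}$ and put on $V_a\cap V_b$ $$h_{a,b}(w,x)=\prod_{\delta\in F/\mathbb Z\gamma}h_3\!\left(\frac{w+\delta(x)}{\gamma(x)},\frac{\alpha(x)}{\gamma(x)},\frac{\beta(x)}{\gamma(x)}\right),\qquad h_{a,a}=1 .$$ With the basis that the framing assigns to $a$, put on $V_a$ $$h_a(\mu;w,x)=\prod_{j=0}^{\mu(a)-1}h_2\!\left(\frac{w+j\alpha_1(x)}{\alpha_3(x)},\frac{\alpha_2(x)}{\alpha_3(x)}\right),\qquad h_a((g,\mu);w,x)=h_a(\mu\circ g^{-1};w,x).$$ **Theorem.** For every framing: 1. the gamma gerbe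 exists, that is, there is a cocycle $\phi$ of nowhere vanishing holomorphic functions as above that is equal to $Ds$ as a cochain of meromorphic functions; 2. $h_{a,b}$ does not depend on the choice of $\alpha,\beta$; 3. $h=(h_{a,b},h_a)$ is a 1-cochain of positive smooth functions with $h_{a,b}h_{b,a}=1$ and $Dh=|\phi|^{-2}$; thus it is an equivariant hermitian structure on the gamma gerbe. -/

import Mathlib

open scoped Matrix ContDiff

noncomputable section

namespace GammaGerbe

/-! ### The lattice, its primitive vectors and the dual lattice -/

/-- The lattice `Λ = ℤ³`. -/
abbrev Lat : Type := Fin 3 → ℤ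

/-- The dual lattice `Λ^∨ = Hom(Λ, ℤ)`, in the coordinates dual to those of `Λ`:
`δ` is the linear form `v ↦ δ ⬝ᵥ v`. -/
abbrev DualLat : Type := Fin 3 → ℤ

/-- `v` is primitive if `v ∈ k Λ` implies `k = ± 1`. -/
def IsPrimitive (v : Lat) : Prop := ∀ (k : ℤ) (u : Lat), v = k • u → k = 1 ∨ k = -1

/-- The set `Λ_prim` of primitive vectors. -/
def Prim : Type := {v : Lat // IsPrimitive v}

/-- The value `δ(x)` of `δ ∈ Λ^∨` at `x ∈ V_ℂ = ℂ³`. -/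
def ev (δ : DualLat) (x : Fin 3 → ℂ) : ℂ := ∑ i, (δ i : ℂ) * x i

/-- The value at `x ∈ V_ℂ = ℂ³` of a rational linear form. -/
def evQ (α : Fin 3 → ℚ) (x : Fin 3 → ℂ) : ℂ := ∑ i, (α i : ℂ) * x i

/-- `(α, β)` is an oriented basis of the rational plane `H(a) = {α ∈ V^* | α(a) = 0}`. -/
def IsOrientedBasis (a : Lat) (α β : Fin 3 → ℚ) : Prop :=
  α ⬝ᵥ (fun i => (a i : ℚ)) = 0 ∧ β ⬝ᵥ (fun i => (a i : ℚ)) = 0 ∧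
    LinearIndependent ℚ ![α, β] ∧
    ∀ δ : Fin 3 → ℚ, 0 < δ ⬝ᵥ (fun i => (a i : ℚ)) → 0 < Matrix.det (Matrix.of ![α, β, δ])

/-- The open set `U_a^+ ⊆ V_ℂ`. -/
def UPlus (a : Lat) : Set (Fin 3 → ℂ) :=
  {x | ∃ α β : Fin 3 → ℚ, IsOrientedBasis a α β ∧ 0 < (evQ α x * star (evQ β x)).im}

/-! ### The group `ISL₃(ℤ) = SL₃(ℤ) ⋉ ℤ³` -/

/-- The group `ISL₃(ℤ)`; the element `(g, μ)` stands for
the transformation `(w, x) ↦ (w - μ(x), g x)` of `ℂ × V_ℂ`. -/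
@[ext]
structure ISL3 : Type where
  /-- the linear part -/
  lin : Matrix.SpecialLinearGroup (Fin 3) ℤ
  /-- the translation part -/
  tr : DualLat

namespace ISL3

instance : Mul ISL3 := ⟨fun p q => ⟨p.lin * q.lin, q.tr + p.tr ᵥ* q.lin.1⟩⟩
instance : One ISL3 := ⟨⟨1, 0⟩⟩
instance : Inv ISL3 := ⟨fun p => ⟨p.lin⁻¹, -(p.tr ᵥ* (p.lin⁻¹).1)⟩⟩

@[simp] theorem mul_lin (p q : ISL3) : (p * q).lin = p.lin * q.lin := rfl
@[simp] theorem mul_tr (p q : ISL3) : (p * q).tr = q.tr + p.tr ᵥ* q.lin.1 := rfl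
@[simp] theorem one_lin : (1 : ISL3).lin = 1 := rfl
@[simp] theorem one_tr : (1 : ISL3).tr = 0 := rfl
@[simp] theorem inv_lin (p : ISL3) : (p⁻¹).lin = p.lin⁻¹ := rfl
@[simp] theorem inv_tr (p : ISL3) : (p⁻¹).tr = -(p.tr ᵥ* (p.lin⁻¹).1) := rfl

instance : Group ISL3 :=
  Group.ofLeftAxioms
    (fun p q r => by
      ext1
      · simp [mul_assoc]
      · simp [Matrix.add_vecMul, Matrix.vecMul_vecMul, add_assoc])
    (fun p => by ext1 <;> simp)
    (fun p => by
      ext1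
      · simp
      · have h : (p.lin⁻¹).1 * p.lin.1 = 1 :=
          congrArg Subtype.val (inv_mul_cancel p.lin)
        rw [mul_tr, inv_tr, Matrix.neg_vecMul, Matrix.vecMul_vecMul, h]
        simp)

end ISL3

theorem isPrimitive_mulVec (g : Matrix.SpecialLinearGroup (Fin 3) ℤ) {v : Lat}
    (hv : IsPrimitive v) : IsPrimitive (g.1 *ᵥ v) := by
  intro k u h
  apply hv k ((g⁻¹).1 *ᵥ u)
  rw [← Matrix.mulVec_smul, ← h, Matrix.mulVec_mulVec, ← Matrix.SpecialLinearGroup.coe_mul]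
  simp

/-- `ISL₃(ℤ)` acts on `Λ_prim` through its linear part. -/
instance : MulAction ISL3 Prim where
  smul p a := ⟨p.lin.1 *ᵥ a.1, isPrimitive_mulVec p.lin a.2⟩
  one_smul a := Subtype.ext (by
    change (1 : Matrix.SpecialLinearGroup (Fin 3) ℤ).1 *ᵥ a.1 = a.1
    simp)
  mul_smul p q a := Subtype.ext (by
    change (p.lin * q.lin).1 *ᵥ a.1 = p.lin.1 *ᵥ (q.lin.1 *ᵥ a.1)
    simp [Matrix.mulVec_mulVec])

/-! ### The complex manifold `X₃` -/

/-- The open subset `ℂ × (V_ℂ ∖ ℂ · V_ℝ)` of `ℂ × V_ℂ`. -/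
def cone : Set (ℂ × (Fin 3 → ℂ)) :=
  {p | ¬ ∃ (c : ℂ) (r : Fin 3 → ℝ), p.2 = fun i => c * (r i : ℂ)}

/-- The orbit relation of the action `t • (w, x) = (t w, t x)` of `ℂ^×`. -/
instance coneSetoid : Setoid cone where
  r p q := ∃ t : ℂˣ, (t : ℂ) • p.1 = q.1
  iseqv :=
    { refl := fun p => ⟨1, by simp⟩
      symm := fun {p q} ⟨t, h⟩ => ⟨t⁻¹, by rw [← h, smul_smul]; simp⟩
      trans := fun {p q r} ⟨t, h⟩ ⟨s, k⟩ => ⟨s * t, by rw [← k, ← h, smul_smul]; simp⟩ }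

/-- `X₃ = (ℂ × (V_ℂ ∖ ℂ · V_ℝ)) / ℂ^×`, the total space of `O(1) → ℂP² ∖ ℝP²`. -/
def X3 : Type := Quotient coneSetoid

instance : TopologicalSpace X3 := inferInstanceAs (TopologicalSpace (Quotient coneSetoid))

/-- The point of `X₃` with homogeneous coordinates `(w, x)`. -/
def X3.mk (p : cone) : X3 := Quotient.mk coneSetoid p

/-- The linear action of an integral matrix on `V_ℂ`. -/
def actC (g : Matrix.SpecialLinearGroup (Fin 3) ℤ) (x : Fin 3 → ℂ) : Fin 3 → ℂ :=
  g.1.map (Int.cast : ℤ → ℂ) *ᵥ x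

theorem actC_one (x : Fin 3 → ℂ) : actC 1 x = x := by
  simp [actC]

theorem actC_mul (g h : Matrix.SpecialLinearGroup (Fin 3) ℤ) (x : Fin 3 → ℂ) :
    actC (g * h) x = actC g (actC h x) := by
  simp only [actC, Matrix.mulVec_mulVec, Matrix.SpecialLinearGroup.coe_mul]
  congr 1
  exact Matrix.map_mul (f := Int.castRingHom ℂ)

theorem actC_smul (g : Matrix.SpecialLinearGroup (Fin 3) ℤ) (t : ℂ) (x : Fin 3 → ℂ) :
    actC g (t • x) = t • actC g x := by
  simp [actC, Matrix.mulVec_smul]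

theorem actC_real (g : Matrix.SpecialLinearGroup (Fin 3) ℤ) (c : ℂ) (r : Fin 3 → ℝ) :
    actC g (fun i => c * (r i : ℂ)) =
      fun i => c * ((g.1.map (Int.cast : ℤ → ℝ) *ᵥ r) i : ℂ) := by
  ext i
  simp only [actC, Matrix.mulVec, dotProduct, Matrix.map_apply, Complex.ofReal_sum,
    Complex.ofReal_mul, Complex.ofReal_intCast, Finset.mul_sum]
  exact Finset.sum_congr rfl fun j _ => by ring

theorem ev_smul (δ : DualLat) (t : ℂ) (x : Fin 3 → ℂ) : ev δ (t • x) = t * ev δ x := by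
  simp only [ev, Pi.smul_apply, smul_eq_mul, Finset.mul_sum]
  exact Finset.sum_congr rfl fun j _ => by ring

theorem ev_add (δ ε : DualLat) (x : Fin 3 → ℂ) : ev (δ + ε) x = ev δ x + ev ε x := by
  simp [ev, add_mul, Finset.sum_add_distrib]

theorem ev_vecMul (δ : DualLat) (g : Matrix.SpecialLinearGroup (Fin 3) ℤ) (x : Fin 3 → ℂ) :
    ev (δ ᵥ* g.1) x = ev δ (actC g x) := by
  simp only [ev, actC, Matrix.vecMul, Matrix.mulVec, dotProduct, Matrix.map_apply,
    Int.cast_sum, Int.cast_mul, Finset.mul_sum, Finset.sum_mul]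
  rw [Finset.sum_comm]
  exact Finset.sum_congr rfl fun j _ => Finset.sum_congr rfl fun k _ => by ring

/-- The action `(g, μ) · (w, x) = (w - μ(x), g x)` on `ℂ × (V_ℂ ∖ ℂ · V_ℝ)`. -/
def coneAct (p : ISL3) (y : cone) : cone :=
  ⟨(y.1.1 - ev p.tr y.1.2, actC p.lin y.1.2), by
    rintro ⟨c, r, h⟩
    apply y.2
    refine ⟨c, (p.lin⁻¹).1.map (Int.cast : ℤ → ℝ) *ᵥ r, ?_⟩
    rw [← actC_real, ← h, ← actC_mul, inv_mul_cancel, actC_one]⟩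

/-- The induced action of `ISL₃(ℤ)` on `X₃`. -/
instance : MulAction ISL3 X3 where
  smul p := Quotient.map (coneAct p) (by
    rintro y z ⟨t, h⟩
    refine ⟨t, ?_⟩
    change (t : ℂ) • (y.1.1 - ev p.tr y.1.2, actC p.lin y.1.2)
      = (z.1.1 - ev p.tr z.1.2, actC p.lin z.1.2)
    rw [← h]
    simp [ev_smul, actC_smul, mul_sub])
  one_smul y := by
    induction y using Quotient.inductionOn with
    | h y =>
      refine congrArg (Quotient.mk coneSetoid) (Subtype.ext (Prod.ext ?_ ?_))
      · simp [coneAct, ev]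
      · simp [coneAct, actC_one]
  mul_smul p q y := by
    induction y using Quotient.inductionOn with
    | h y =>
      refine congrArg (Quotient.mk coneSetoid) (Subtype.ext (Prod.ext ?_ ?_))
      · simp only [coneAct, ISL3.mul_tr, ev_add, ev_vecMul]
        ring
      · simp only [coneAct, ISL3.mul_lin, actC_mul]

/-- The open set `V_a = {(w, x) | x ∈ U_a^+} / ℂ^×` of `X₃`. -/
def V (a : Prim) : Set X3 := X3.mk '' {p | p.1.2 ∈ UPlus a.1}

/-- A function of homogeneous coordinates that is invariant under rescaling,
viewed as a function on `X₃`. -/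
def X3.descend {M : Type*} (F : ℂ → (Fin 3 → ℂ) → M)
    (hF : ∀ (t : ℂˣ) (w : ℂ) (x : Fin 3 → ℂ), F ((t : ℂ) * w) ((t : ℂ) • x) = F w x) : X3 → M :=
  Quotient.lift (fun p : cone => F p.1.1 p.1.2) (by
    rintro y z ⟨t, h⟩
    rw [← h]
    exact (hF t _ _).symm)

open Classical in
/-- The pull-back of a function on `X₃` to `ℂ × (V_ℂ ∖ ℂ · V_ℝ)` (extended by `0`). -/
def pull {M : Type*} [Zero M] (F : X3 → M) (p : ℂ × (Fin 3 → ℂ)) : M :=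
  if h : p ∈ cone then F (X3.mk ⟨p, h⟩) else 0

/-- The preimage in `ℂ × (V_ℂ ∖ ℂ · V_ℝ)` of a subset of `X₃`. -/
def preim (U : Set X3) : Set (ℂ × (Fin 3 → ℂ)) := {p | ∃ h : p ∈ cone, X3.mk ⟨p, h⟩ ∈ U}

/-- `F` is a positive smooth function on the open set `U ⊆ X₃`.  The smooth structure of `X₃` is
that of the quotient by the free and proper action of `ℂ^×`: a function is smooth
if and only if its pull-back is. -/
def IsPosSmoothOn (U : Set X3) (F : X3 → ℝ) : Prop :=
  (∀ y ∈ U, 0 < F y) ∧ ContDiffOn ℝ ∞ (pull F) (preim U)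

/-- `F` is a nowhere vanishing holomorphic function on the open set `U ⊆ X₃`
(for the complex structure of the quotient), that is, a section of `𝒪^×` over `U`. -/
def IsHolUnitOn (U : Set X3) (F : X3 → ℂ) : Prop :=
  (∀ y ∈ U, F y ≠ 0) ∧ DifferentiableOn ℂ (pull F) (preim U)

/-- Equality on `U` of meromorphic functions, which are represented by their values outside of
their poles: the two functions agree on a dense open subset of `U`. -/
def MeroEqOn (U : Set X3) (F G : X3 → ℂ) : Prop :=
  ∃ W : Set X3, IsOpen W ∧ W ⊆ U ∧ U ⊆ closure W ∧ Set.EqOn F G W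

/-! ### The group-Čech double complex of the covering `(V_a)` in total degrees 1, 2, 3

The coefficients are written multiplicatively and sections over a (multiple) intersection of the
sets `V_a` are represented by functions on `X₃`, of which only the values on that
intersection matter. -/

/-- A 1-cochain: components `s_{a,b}` on `V_a ∩ V_b` and `s_a(g; ·)` on `V_a`. -/
structure Cochain1 (M : Type*) where
  /-- the component in group degree 0 and Čech degree 1 -/
  c01 : Prim → Prim → X3 → M
  /-- the component in group degree 1 and Čech degree 0 -/
  c10 : Prim → ISL3 → X3 → M

/-- A 2-cochain: components `φ_{a,b,c}` on `V_a ∩ V_b ∩ V_c`, `φ_{a,b}(g; ·)` on `V_a ∩ V_b` and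
`φ_a(g, h; ·)` on `V_a`. -/
structure Cochain2 (M : Type*) where
  /-- the component in group degree 0 and Čech degree 2 -/
  c02 : Prim → Prim → Prim → X3 → M
  /-- the component in group degree 1 and Čech degree 1 -/
  c11 : Prim → Prim → ISL3 → X3 → M
  /-- the component in group degree 2 and Čech degree 0 -/
  c20 : Prim → ISL3 → ISL3 → X3 → M

/-- The total differential `D = δ + (-1)^p δ̌` on 1-cochains. -/
def D {M : Type*} [Field M] (s : Cochain1 M) : Cochain2 M where
  c02 a b c y := s.c01 b c y * (s.c01 a c y)⁻¹ * s.c01 a b y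
  c11 a b g y := (s.c01 (g⁻¹ • a) (g⁻¹ • b) (g⁻¹ • y))⁻¹ * s.c01 a b y
    * (s.c10 b g y * (s.c10 a g y)⁻¹)⁻¹
  c20 a g h y := s.c10 (g⁻¹ • a) h (g⁻¹ • y) * (s.c10 a (g * h) y)⁻¹ * s.c10 a g y

/-- The 2-cocycle condition `D φ = 1`, in its components of group degree 0, 1, 2, 3. -/
def IsCocycle2 (φ : Cochain2 ℂ) : Prop :=
  (∀ a b c d : Prim, ∀ y ∈ V a ∩ V b ∩ V c ∩ V d,
    φ.c02 b c d y * (φ.c02 a c d y)⁻¹ * φ.c02 a b d y * (φ.c02 a b c y)⁻¹ = 1) ∧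
  (∀ (a b c : Prim) (g : ISL3), ∀ y ∈ V a ∩ V b ∩ V c,
    (φ.c02 (g⁻¹ • a) (g⁻¹ • b) (g⁻¹ • c) (g⁻¹ • y))⁻¹ * φ.c02 a b c y
      * (φ.c11 b c g y * (φ.c11 a c g y)⁻¹ * φ.c11 a b g y)⁻¹ = 1) ∧
  (∀ (a b : Prim) (g h : ISL3), ∀ y ∈ V a ∩ V b,
    φ.c11 (g⁻¹ • a) (g⁻¹ • b) h (g⁻¹ • y) * (φ.c11 a b (g * h) y)⁻¹ * φ.c11 a b g y
      * (φ.c20 b g h y * (φ.c20 a g h y)⁻¹) = 1) ∧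
  (∀ (a : Prim) (g h k : ISL3), ∀ y ∈ V a,
    (φ.c20 (g⁻¹ • a) h k (g⁻¹ • y))⁻¹ * φ.c20 a (g * h) k y * (φ.c20 a g (h * k) y)⁻¹
      * φ.c20 a g h y = 1)

/-- An equivariant holomorphic gerbe on `X₃`, given with respect to the covering `(V_a)` by trivial
line bundles `L_{a,b}` and `L_a(g)`: a 2-cocycle with values in `𝒪^×`
whose components `φ_{a,b,c}` are skew-symmetric. -/
structure IsHolGerbe (φ : Cochain2 ℂ) : Prop where
  hol02 : ∀ a b c : Prim, IsHolUnitOn (V a ∩ V b ∩ V c) (φ.c02 a b c)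
  hol11 : ∀ (a b : Prim) (g : ISL3), IsHolUnitOn (V a ∩ V b) (φ.c11 a b g)
  hol20 : ∀ (a : Prim) (g h : ISL3), IsHolUnitOn (V a) (φ.c20 a g h)
  cocycle : IsCocycle2 φ
  skew₁ : ∀ a b c : Prim, ∀ y ∈ V a ∩ V b ∩ V c, φ.c02 b a c y = (φ.c02 a b c y)⁻¹
  skew₂ : ∀ a b c : Prim, ∀ y ∈ V a ∩ V b ∩ V c, φ.c02 a c b y = (φ.c02 a b c y)⁻¹

/-- An equivariant hermitian structure on the equivariant gerbe with cocycle `φ`: a 1-cochain `h` of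
positive smooth functions (the norms squared of the trivializing sections of `L_{a,b}` and `L_a(g)`)
such that `h_{a,b} h_{b,a} = 1` and `D h = |φ|⁻²` (unitarity of the structure maps). -/
structure IsEquivariantHermitianStructure (φ : Cochain2 ℂ) (h : Cochain1 ℝ) : Prop where
  smooth01 : ∀ a b : Prim, IsPosSmoothOn (V a ∩ V b) (h.c01 a b)
  smooth10 : ∀ (a : Prim) (g : ISL3), IsPosSmoothOn (V a) (h.c10 a g)
  skew : ∀ a b : Prim, ∀ y ∈ V a ∩ V b, h.c01 a b y * h.c01 b a y = 1
  unitary02 : ∀ a b c : Prim, ∀ y ∈ V a ∩ V b ∩ V c,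
    (D h).c02 a b c y = (‖φ.c02 a b c y‖ ^ 2)⁻¹
  unitary11 : ∀ (a b : Prim) (g : ISL3), ∀ y ∈ V a ∩ V b,
    (D h).c11 a b g y = (‖φ.c11 a b g y‖ ^ 2)⁻¹
  unitary20 : ∀ (a : Prim) (g₁ g₂ : ISL3), ∀ y ∈ V a,
    (D h).c20 a g₁ g₂ y = (‖φ.c20 a g₁ g₂ y‖ ^ 2)⁻¹

/-! ### Wedges, gamma functions and theta functions -/

/-- The direction vector `γ_{a,b}`: the form `det(a, b, ·)` divided by the gcd of its coefficients
(which is the modulus of the wedge). -/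
def dirVec (a b : Lat) : DualLat :=
  fun i => (crossProduct a b) i / Finset.univ.gcd (crossProduct a b)

/-- The quotient `Λ^∨ / ℤγ`. -/
abbrev Quo (γ : DualLat) : Type := DualLat ⧸ AddSubgroup.zmultiples γ

/-- The image in `Λ^∨ / ℤγ` of a subset of `Λ^∨`. -/
def modSet (γ : DualLat) (S : Set DualLat) : Set (Quo γ) := QuotientAddGroup.mk '' S

/-- `C_{+-}(a,b) = {δ | δ(a) > 0, δ(b) ≤ 0}`; also `C_{-+}(a,b) = C_{+-}(b,a)`. -/
def Cpm (a b : Lat) : Set DualLat := {δ | 0 < δ ⬝ᵥ a ∧ δ ⬝ᵥ b ≤ 0}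

/-- The gamma function `Γ_{a,b}(w, x)` of a wedge of linearly independent primitive vectors.
The factors only depend on the class of `δ` modulo `ℤγ`. -/
def wedgeGamma (a b : Lat) (w : ℂ) (x : Fin 3 → ℂ) : ℂ :=
  (∏' q : modSet (dirVec a b) (Cpm a b),
    (1 - Complex.exp (-(2 * Real.pi * Complex.I *
      ((ev q.1.out x - w) / ev (dirVec a b) x))))) /
  (∏' q : modSet (dirVec a b) (Cpm b a),
    (1 - Complex.exp (2 * Real.pi * Complex.I *
      ((ev q.1.out x - w) / ev (dirVec a b) x))))

/-- The theta function `θ₀(z, τ)` (for `Im τ > 0`). -/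
def theta0 (z τ : ℂ) : ℂ :=
  ∏' j : ℕ, (1 - Complex.exp (2 * Real.pi * Complex.I * (((j : ℂ) + 1) * τ - z))) *
    (1 - Complex.exp (2 * Real.pi * Complex.I * ((j : ℂ) * τ + z)))

/-- The product `∏_{j=0}^{m-1} f j`, understood as
`∏_{-N ≤ j < m} f j / ∏_{-N ≤ j < 0} f j` for large `N`. -/
def zprod {M : Type*} [Field M] (m : ℤ) (f : ℤ → M) : M :=
  (∏ j ∈ Finset.Ico 0 m, f j) / ∏ j ∈ Finset.Ico m 0, f j

/-- A framing of `Λ_prim`: it assigns to `a` an oriented basis `(α₁, α₂, α₃)` (here indexed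
by `0, 1, 2`) of `Λ^∨` such that `α₁(a) = 1` and `α₂(a) = α₃(a) = 0`. -/
structure Framing where
  /-- the basis assigned to `a` -/
  basis : Prim → Module.Basis (Fin 3) ℤ DualLat
  oriented : ∀ a, 0 < Matrix.det (Matrix.of fun i => basis a i)
  first : ∀ a, basis a 0 ⬝ᵥ a.1 = 1
  second : ∀ a, basis a 1 ⬝ᵥ a.1 = 0
  third : ∀ a, basis a 2 ⬝ᵥ a.1 = 0

/-- The meromorphic function `Δ_a(μ; w, x)`. -/
def Delta (f : Framing) (a : Prim) (μ : DualLat) (w : ℂ) (x : Fin 3 → ℂ) : ℂ :=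
  zprod (μ ⬝ᵥ a.1) fun j =>
    theta0 ((w + (j : ℂ) * ev (f.basis a 0) x) / ev (f.basis a 2) x)
      (ev (f.basis a 1) x / ev (f.basis a 2) x)

theorem ratio_smul (t : ℂˣ) (w : ℂ) (δ γ : DualLat) (x : Fin 3 → ℂ) :
    ((t : ℂ) * w + ev δ ((t : ℂ) • x)) / ev γ ((t : ℂ) • x) = (w + ev δ x) / ev γ x := by
  rw [ev_smul, ev_smul, ← mul_add, mul_div_mul_left _ _ t.ne_zero]

theorem ratio_smul_sub (t : ℂˣ) (w : ℂ) (δ γ : DualLat) (x : Fin 3 → ℂ) :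
    (ev δ ((t : ℂ) • x) - (t : ℂ) * w) / ev γ ((t : ℂ) • x) = (ev δ x - w) / ev γ x := by
  rw [ev_smul, ev_smul, ← mul_sub, mul_div_mul_left _ _ t.ne_zero]

theorem ratio_smul_mul (t : ℂˣ) (w c : ℂ) (δ γ : DualLat) (x : Fin 3 → ℂ) :
    ((t : ℂ) * w + c * ev δ ((t : ℂ) • x)) / ev γ ((t : ℂ) • x) = (w + c * ev δ x) / ev γ x := by
  rw [ev_smul, ev_smul, mul_left_comm, ← mul_add, mul_div_mul_left _ _ t.ne_zero]

theorem ratio_smul_zero (t : ℂˣ) (δ γ : DualLat) (x : Fin 3 → ℂ) :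
    ev δ ((t : ℂ) • x) / ev γ ((t : ℂ) • x) = ev δ x / ev γ x := by
  rw [ev_smul, ev_smul, mul_div_mul_left _ _ t.ne_zero]

open Classical in
/-- The meromorphic 1-cochain `s = (Γ, Δ)`, where `Γ_{a,a} = 1` and
`Δ_a((g, μ); w, x) = Δ_a(μ ∘ g⁻¹; w, x)`.  (If `b = -a`, then `V_a ∩ V_b` is empty.) -/
def gammaCochain (f : Framing) : Cochain1 ℂ where
  c01 a b := if a = b then fun _ => 1 else
    X3.descend (wedgeGamma a.1 b.1) (fun t w x => by
      simp only [wedgeGamma, ratio_smul_sub])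
  c10 a g := X3.descend (Delta f a (g.tr ᵥ* (g.lin⁻¹).1)) (fun t w x => by
      simp only [Delta, ratio_smul_mul, ratio_smul_zero])

/-- `φ` is the cocycle of the gamma gerbe: it is the cocycle of an equivariant holomorphic gerbe and
it is equal to `D s` as a cochain of meromorphic functions, where `s = (Γ, Δ)`. -/
structure IsGammaGerbe (f : Framing) (φ : Cochain2 ℂ) : Prop where
  gerbe : IsHolGerbe φ
  eq02 : ∀ a b c : Prim,
    MeroEqOn (V a ∩ V b ∩ V c) (φ.c02 a b c) ((D (gammaCochain f)).c02 a b c)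
  eq11 : ∀ (a b : Prim) (g : ISL3),
    MeroEqOn (V a ∩ V b) (φ.c11 a b g) ((D (gammaCochain f)).c11 a b g)
  eq20 : ∀ (a : Prim) (g₁ g₂ : ISL3),
    MeroEqOn (V a) (φ.c20 a g₁ g₂) ((D (gammaCochain f)).c20 a g₁ g₂)

/-! ### The hermitian structure -/

/-- `h₂(z, τ)`, the hermitian metric of the theta line bundle. -/
def h2 (z τ : ℂ) : ℝ :=
  Real.exp (-2 * Real.pi * z.im ^ 2 / τ.im + 2 * Real.pi * (z - τ / 6).im)

/-- The multiple Bernoulli polynomial `R₃ = B_{2,3}`, the coefficient of `u³/3!` in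
`e^{ζ u} u² / ((e^{t u} - 1) (e^{s u} - 1))`. -/
def R3 (ζ t s : ℝ) : ℝ :=
  ζ ^ 3 / (t * s) - 3 / 2 * (1 / t + 1 / s) * ζ ^ 2 + (t / (2 * s) + s / (2 * t) + 3 / 2) * ζ
    - (t + s) / 4

/-- `h₃(z, τ, σ)`. -/
def h3 (z τ σ : ℂ) : ℝ := Real.exp (-(2 * Real.pi / 3) * R3 z.im τ.im σ.im)

/-- The condition on the auxiliary forms `α, β` of a wedge: `α(b) = β(a) = 0` and
`α(a), β(b) > 0`. -/
def IsWedgePair (a b : Lat) (α β : DualLat) : Prop :=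
  α ⬝ᵥ b = 0 ∧ β ⬝ᵥ a = 0 ∧ 0 < α ⬝ᵥ a ∧ 0 < β ⬝ᵥ b

/-- The set `F` of the forms `δ` with `0 ≤ δ(a) < α(a)` and `0 ≤ δ(b) < β(b)`. -/
def Fset (a b : Lat) (α β : DualLat) : Set DualLat :=
  {δ | 0 ≤ δ ⬝ᵥ a ∧ δ ⬝ᵥ a < α ⬝ᵥ a ∧ 0 ≤ δ ⬝ᵥ b ∧ δ ⬝ᵥ b < β ⬝ᵥ b}

/-- The product of `h₃((w + δ(x))/γ(x), α(x)/γ(x), β(x)/γ(x))` over `δ ∈ F / ℤγ`, as a function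
on `X₃`.  The factors only depend on the class of `δ` modulo `ℤγ`, and `F / ℤγ` is finite. -/
def wedgeHerm (a b : Lat) (α β : DualLat) : X3 → ℝ :=
  X3.descend (fun w x => ∏ᶠ q ∈ modSet (dirVec a b) (Fset a b α β),
    h3 ((w + ev (Quotient.out q) x) / ev (dirVec a b) x) (ev α x / ev (dirVec a b) x)
      (ev β x / ev (dirVec a b) x)) (fun t w x => by
    simp only [ratio_smul, ratio_smul_zero])

/-- The form `v ↦ det(b, a × b, v)`. -/
def wedgeAlpha (a b : Lat) : DualLat := crossProduct b (crossProduct a b)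

/-- The form `v ↦ det(a × b, a, v)`. -/
def wedgeBeta (a b : Lat) : DualLat := crossProduct (crossProduct a b) a

/-- `(wedgeAlpha, wedgeBeta)` is one of the pairs `(α, β)` that are allowed for the wedge. -/
theorem isWedgePair_wedge (a b : Lat) (h : crossProduct a b ≠ 0) :
    IsWedgePair a b (wedgeAlpha a b) (wedgeBeta a b) := by
  have hpos : 0 < crossProduct a b 0 ^ 2 + crossProduct a b 1 ^ 2 + crossProduct a b 2 ^ 2 := by
    by_contra hn
    apply h
    have h0 := sq_nonneg (crossProduct a b 0)
    have h1 := sq_nonneg (crossProduct a b 1)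
    have h2 := sq_nonneg (crossProduct a b 2)
    ext i
    fin_cases i
    · exact pow_eq_zero_iff two_ne_zero |>.mp (by simp only [Fin.zero_eta]; linarith)
    · exact pow_eq_zero_iff two_ne_zero |>.mp (by simp only [Fin.mk_one]; linarith)
    · exact pow_eq_zero_iff two_ne_zero |>.mp (by simp only [Fin.reduceFinMk]; linarith)
  simp only [cross_apply, Matrix.cons_val_zero, Matrix.cons_val_one, Matrix.cons_val] at hpos
  refine ⟨?_, ?_, ?_, ?_⟩ <;>
    simp only [wedgeAlpha, wedgeBeta, cross_apply, dotProduct, Fin.sum_univ_three,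
      Matrix.cons_val_zero, Matrix.cons_val_one, Matrix.cons_val]
  · ring
  · ring
  · linarith
  · linarith

open Classical in
/-- The 1-cochain `(h_{a,b}, h_a)`: `h_{a,b}` is the product `wedgeHerm` for one pair `(α, β)`,
`h_{a,a} = 1`, `h_a(μ; w, x)` is the product of the values of `h₂` along the framing and
`h_a((g, μ); w, x) = h_a(μ ∘ g⁻¹; w, x)`. -/
def hermCochain (f : Framing) : Cochain1 ℝ where
  c01 a b := if a = b then fun _ => 1 else
    wedgeHerm a.1 b.1 (wedgeAlpha a.1 b.1) (wedgeBeta a.1 b.1)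
  c10 a g := X3.descend (fun w x => zprod ((g.tr ᵥ* (g.lin⁻¹).1) ⬝ᵥ a.1) fun j =>
      h2 ((w + (j : ℂ) * ev (f.basis a 0) x) / ev (f.basis a 2) x)
        (ev (f.basis a 1) x / ev (f.basis a 2) x)) (fun t w x => by
      simp only [ratio_smul_mul, ratio_smul_zero])

end GammaGerbe

end

open scoped Matrix ContDiff

noncomputable section

namespace GammaGerbe

open Filter Topology Set

/-! ### Complex analysis -/

/-! Weight the meromorphic cochain s = (Γ, Δ) by h and consider the real cochain n = |s|²h. The
heart of the matter is that Dn = 1 at the generic points, those with w ≠ δ(x) for all δ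
(`norm_D_c02`, `norm_D_c11`, `norm_D_c20`). Then |Ds|² · Dh = 1 there, and Dh is positive and
continuous everywhere, so the meromorphic functions Ds are locally bounded and bounded away from
zero. Riemann's theorem on the lines x = const and Cauchy's integral formula extend them to
holomorphic units (`extend_spec`). The cocycle identities and the norm identity hold at generic
points, which are dense, hence everywhere. In this way the norm identity gives the existence of φ
and its hermitian structure at once, without an explicit formula for φ.

The norms reduce to one for theta functions, `thetaNorm` = |θ₀|²h₂. It is elliptic in z and
invariant under SL₂(ℤ): for τ ↦ -1/τ the quotient of the two sides is the norm squared of a bounded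
entire function, so it is a constant c by Liouville, and the duplication formula forces c = c⁴
(`thetaNorm_neg_inv`). Consequently the theta norm belongs to a lattice in ℂ and, for a primitive a
and an integer j, to the coset δ(a) = j of H(a), whatever the framing (`lineNorm_eq`).

For the equivariance, the numerator and denominator of Γ_{a,b} are products over quadrants of
Λ^∨/ℤγ, and log h_{a,b} is a sum of Bernoulli polynomials over a box. Translating w by μ(x) shifts
quadrants and box. Each unit shift changes the products by q-Pochhammer symbols, which pair up to a
theta function, and the sum by a quadratic Bernoulli polynomial, which is the weight of that theta
function (`wedgeNorm_step_left`). So the norm of Γ_{a,b} changes by theta norms that depend on a or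
on b alone (`pairNorm_translate`).

For the Čech component, n = n_{a,b} n_{b,c} / n_{a,c} is therefore periodic under all δ(x). The
weights are cubic polynomials in w whose non-harmonic part is a Čech cocycle (`exists_boxSum_eq_re`,
`nuv_cross_cyclic`), so n is the norm squared of a meromorphic function without poles at w = 0,
hence by periodicity without poles, and Liouville makes it constant. Since n(w) n(-w) = 1 and n > 0,
the constant is 1 (`pairNorm_mul`). -/

/-- Weierstrass' theorem in several variables: by Cauchy's estimate on balls the derivatives are
uniformly Cauchy, so the limit is differentiable. -/
theorem differentiableOn_of_tendstoUniformlyOn {ι E F : Type*} [NormedAddCommGroup E]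
    [NormedSpace ℂ E] [NormedAddCommGroup F] [NormedSpace ℂ F] [CompleteSpace F] {l : Filter ι}
    [l.NeBot] {f : ι → E → F} {g : E → F} {U : Set E} (hU : IsOpen U)
    (hf : ∀ n, DifferentiableOn ℂ (f n) U) (h : TendstoUniformlyOn f g l U) :
    DifferentiableOn ℂ g U := by
  intro x hx
  obtain ⟨R, hR, hRU⟩ := Metric.isOpen_iff.1 hU x hx
  obtain ⟨r, hr, rfl⟩ : ∃ r, 0 < r ∧ R = 2 * r := ⟨R / 2, by positivity, by ring⟩
  have hsub : ∀ y ∈ Metric.ball x r, Metric.ball y r ⊆ U := fun y hy =>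
    (Metric.ball_subset_ball' (by rw [Metric.mem_ball] at hy; linarith)).trans hRU
  have hd : ∀ n, ∀ y ∈ U, DifferentiableAt ℂ (f n) y := fun n y hy =>
    (hf n y hy).differentiableAt (hU.mem_nhds hy)
  have hball : Metric.ball x r ⊆ U := hsub x (Metric.mem_ball_self hr)
  have hC : UniformCauchySeqOn (fun n y => fderiv ℂ (f n) y) l (Metric.ball x r) := by
    intro u hu
    obtain ⟨ε, hε, hεu⟩ := Metric.mem_uniformity_dist.1 hu
    -- The constant makes a difference of two terms oscillate by at most ε r / 2 on a ball of radius
    -- r, so Cauchy's estimate bounds its derivative by ε / 2.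
    have h1 := h.uniformCauchySeqOn _ (Metric.dist_mem_uniformity (ε := ε * r / 4) (by positivity))
    filter_upwards [h1] with p hp y hy
    refine hεu ?_
    have hb : DifferentiableOn ℂ (f p.1 - f p.2) (Metric.ball y r) :=
      ((hf p.1).sub (hf p.2)).mono (hsub y hy)
    have h2 := Complex.norm_fderiv_le_div_of_mapsTo_ball (R₂ := ε * r / 2) hb (fun z hz => by
      rw [Metric.mem_closedBall]
      have e1 : dist (f p.1 z) (f p.2 z) < ε * r / 4 := hp z (hsub y hy hz)
      have e2 : dist (f p.1 y) (f p.2 y) < ε * r / 4 := hp y (hball hy)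
      rw [dist_eq_norm] at *
      simp only [Pi.sub_apply]
      exact (norm_sub_le _ _).trans (by linarith)) hr
    rw [fderiv_sub (hd _ _ (hball hy)) (hd _ _ (hball hy))] at h2
    rw [dist_eq_norm]
    refine h2.trans_lt ?_
    rw [div_lt_iff₀ hr]
    nlinarith
  have hlim : ∀ y ∈ Metric.ball x r, ∃ L, Tendsto (fun n => fderiv ℂ (f n) y) l (𝓝 L) :=
    fun y hy => CompleteSpace.complete (hC.cauchy_map hy)
  choose! g' hg' using hlim
  have hT := hC.tendstoUniformlyOn_of_tendsto hg'
  exact (hasFDerivAt_of_tendstoUniformlyOn Metric.isOpen_ball hT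
    (fun n y hy => (hd n y (hball hy)).hasFDerivAt)
    (fun y hy => h.tendsto_at (hball hy))
    (Metric.mem_ball_self hr)).differentiableAt.differentiableWithinAt

theorem differentiableOn_tprod_one_add {ι E : Type*} [NormedAddCommGroup E] [NormedSpace ℂ E]
    [ProperSpace E] {f : ι → E → ℂ} {U : Set E} (hU : IsOpen U)
    (hf : ∀ i, DifferentiableOn ℂ (f i) U)
    (hb : ∀ x ∈ U, ∃ u : ι → ℝ, Summable u ∧ ∀ᶠ y in 𝓝 x, ∀ i, ‖f i y‖ ≤ u i) :
    DifferentiableOn ℂ (fun x => ∏' i, (1 + f i x)) U := by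
  intro x hx
  obtain ⟨u, hu, hux⟩ := hb x hx
  obtain ⟨r, hr, hrU⟩ := Metric.nhds_basis_closedBall.mem_iff.1 (inter_mem hux (hU.mem_nhds hx))
  have h := Summable.hasProdUniformlyOn_one_add (f := f) (isCompact_closedBall x r) hu
    (Eventually.of_forall fun i y hy => (hrU hy).1 i)
    (fun i => ((hf i).mono fun y hy => (hrU hy).2).continuousOn)
  rw [hasProdUniformlyOn_iff_tendstoUniformlyOn] at h
  have h2 := differentiableOn_of_tendstoUniformlyOn (Metric.isOpen_ball (x := x) (ε := r))
    (fun s y hy => by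
      classical
      exact (HasFDerivWithinAt.finsetProd fun i _ => (((hf i).mono fun y hy =>
        (hrU (Metric.ball_subset_closedBall hy)).2) y hy).hasFDerivWithinAt.const_add 1
        ).differentiableWithinAt)
    (h.mono Metric.ball_subset_closedBall)
  exact (h2.differentiableAt (Metric.ball_mem_nhds x hr)).differentiableWithinAt

/-- Cauchy's estimate turns a bound for the integrand on a compact set into a bound for its
derivative, as differentiation under the integral sign requires. -/
theorem differentiableOn_intervalIntegral {E : Type*} [NormedAddCommGroup E] [NormedSpace ℂ E]
    [ProperSpace E] {k : ℝ → E → ℂ} {U : Set E} (hU : IsOpen U) (a b : ℝ)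
    (hk : ContinuousOn (fun p : ℝ × E => k p.1 p.2) (univ ×ˢ U))
    (hd : ∀ t, DifferentiableOn ℂ (k t) U) :
    DifferentiableOn ℂ (fun y => ∫ t in a..b, k t y) U := by
  intro x hx
  obtain ⟨R, hR, hRU⟩ := Metric.nhds_basis_closedBall.mem_iff.1 (hU.mem_nhds hx)
  obtain ⟨r, hr, rfl⟩ : ∃ r, 0 < r ∧ R = 2 * r := ⟨R / 2, by positivity, by ring⟩
  have hkt : ∀ y ∈ U, Continuous fun t => k t y := fun y hy =>
    hk.comp_continuous (f := fun t : ℝ => (t, y)) (by fun_prop) (fun t => ⟨mem_univ _, hy⟩)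
  have hsub : ∀ y ∈ Metric.ball x r, Metric.ball y r ⊆ Metric.closedBall x (2 * r) := fun y hy =>
    (Metric.ball_subset_ball' (by rw [Metric.mem_ball] at hy; linarith)).trans
      Metric.ball_subset_closedBall
  have hball : Metric.ball x r ⊆ U := fun y hy => hRU (hsub y hy (Metric.mem_ball_self hr))
  have hda : ∀ t, ∀ y ∈ Metric.ball x r, DifferentiableAt ℂ (k t) y := fun t y hy =>
    (hd t y (hball hy)).differentiableAt (hU.mem_nhds (hball hy))
  obtain ⟨M, hM⟩ := ((isCompact_uIcc (a := a) (b := b)).prod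
    (isCompact_closedBall x (2 * r))).exists_bound_of_continuousOn
      (hk.mono (prod_mono (subset_univ _) hRU))
  have hbd : ∀ t ∈ uIcc a b, ∀ y ∈ Metric.ball x r, ‖fderiv ℂ (k t) y‖ ≤ 2 * M / r := by
    intro t ht y hy
    refine Complex.norm_fderiv_le_div_of_mapsTo_ball
      ((hd t).mono ((hsub y hy).trans hRU)) (fun z hz => ?_) hr
    rw [Metric.mem_closedBall, dist_eq_norm]
    have e1 := hM (t, z) ⟨ht, hsub y hy hz⟩
    have e2 := hM (t, y) ⟨ht, hsub y hy (Metric.mem_ball_self hr)⟩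
    exact (norm_sub_le _ _).trans (by simp only at e1 e2; linarith)
  have hxb := Metric.mem_ball_self (x := x) hr
  -- Only the measurability of the derivative in t is needed. It follows from continuity, again by
  -- Cauchy's estimate, because `k t` is uniformly close to `k t₀` on a compact ball.
  have hcont : Continuous fun t => fderiv ℂ (k t) x := by
    rw [continuous_iff_continuousAt]
    intro t₀
    rw [ContinuousAt, Metric.tendsto_nhds]
    intro ε hε
    have h1 : ∀ᶠ t in 𝓝 t₀, ∀ y ∈ Metric.closedBall x (2 * r),
        ‖k t y - k t₀ y‖ < ε * r / 4 := by
      refine (isCompact_closedBall x (2 * r)).eventually_forall_of_forall_eventually ?_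
      intro y hy
      have c1 : ContinuousAt (fun p : ℝ × E => k p.1 p.2) (t₀, y) :=
        hk.continuousAt (prod_mem_nhds univ_mem (hU.mem_nhds (hRU hy)))
      have c2 : ContinuousAt (fun p : ℝ × E => k t₀ p.2) (t₀, y) :=
        ContinuousAt.comp (g := k t₀) (f := Prod.snd) (x := (t₀, y))
          ((hd t₀ y (hRU hy)).differentiableAt (hU.mem_nhds (hRU hy))).continuousAt
          continuousAt_snd
      have c3 := (c1.sub c2).norm
      exact c3.eventually_lt continuousAt_const (by simp; positivity)
    filter_upwards [h1] with t ht
    have hb : DifferentiableOn ℂ (k t - k t₀) (Metric.ball x r) :=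
      ((hd t).sub (hd t₀)).mono hball
    have h2 := Complex.norm_fderiv_le_div_of_mapsTo_ball (R₂ := ε * r / 2) hb (fun z hz => by
      rw [Metric.mem_closedBall]
      have e1 := ht z (hsub x hxb hz)
      have e2 := ht x (hsub x hxb hxb)
      rw [dist_eq_norm]
      simp only [Pi.sub_apply]
      exact (norm_sub_le _ _).trans (by linarith)) hr
    rw [fderiv_sub (hda _ _ hxb) (hda _ _ hxb)] at h2
    rw [dist_eq_norm]
    refine h2.trans_lt ?_
    rw [div_lt_iff₀ hr]
    nlinarith
  have := intervalIntegral.hasFDerivAt_integral_of_dominated_of_fderiv_le (𝕜 := ℂ)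
    (μ := MeasureTheory.volume) (a := a) (b := b)
    (F := fun y t => k t y) (F' := fun y t => fderiv ℂ (k t) y) (x₀ := x)
    (bound := fun _ => 2 * M / r) (Metric.ball_mem_nhds x hr)
    (by
      filter_upwards [hU.mem_nhds hx] with y hy
      exact (hkt y hy).aestronglyMeasurable)
    ((hkt x hx).intervalIntegrable _ _)
    hcont.aestronglyMeasurable
    (Eventually.of_forall fun t ht y hy => hbd t (uIoc_subset_uIcc ht) y hy)
    (by simp)
    (Eventually.of_forall fun t ht y hy => (hda t y hy).hasFDerivAt)
  exact this.differentiableAt.differentiableWithinAt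

/-- The quotient of two entire functions, extended to its removable singularities. -/
def remQuot (F G : ℂ → ℂ) (w : ℂ) : ℂ := limUnder (𝓝[≠] w) fun ζ => F ζ / G ζ

theorem remQuot_eq {F G : ℂ → ℂ} (hF : Differentiable ℂ F) (hG : Differentiable ℂ G) {w : ℂ}
    (hw : G w ≠ 0) : remQuot F G w = F w / G w := by
  have h : ContinuousAt (fun ζ => F ζ / G ζ) w :=
    (hF w).continuousAt.div (hG w).continuousAt hw
  exact (h.tendsto.mono_left nhdsWithin_le_nhds).limUnder_eq

/-- A function that vanishes near a point has an uncountable zero set, so countably many zeros are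
isolated. -/
theorem eventually_ne_zero_of_countable {G : ℂ → ℂ} (hG : Differentiable ℂ G)
    (hc : {w | G w = 0}.Countable) (w : ℂ) : ∀ᶠ ζ in 𝓝[≠] w, G ζ ≠ 0 := by
  rcases (hG.analyticAt w).eventually_eq_zero_or_eventually_ne_zero with h | h
  · obtain ⟨r, hr, hrG⟩ := Metric.eventually_nhds_iff_ball.1 h
    have := hc.dense_compl ℝ
    obtain ⟨z, hz, hz'⟩ := this.inter_open_nonempty _ Metric.isOpen_ball
      ⟨w, Metric.mem_ball_self hr⟩
    exact absurd (hrG z hz) hz'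
  · exact h

theorem differentiable_remQuot {F G : ℂ → ℂ} (hF : Differentiable ℂ F) (hG : Differentiable ℂ G)
    (hc : {w | G w = 0}.Countable) (hb : ∀ w, ∃ C, ∀ᶠ ζ in 𝓝 w, ‖F ζ‖ ≤ C * ‖G ζ‖) :
    Differentiable ℂ (remQuot F G) := by
  intro w
  obtain ⟨C, hC⟩ := hb w
  have hne := eventually_ne_zero_of_countable hG hc w
  rw [eventually_nhdsWithin_iff] at hne
  obtain ⟨r, hr, hrB⟩ := Metric.eventually_nhds_iff_ball.1 (hC.and hne)
  set f : ℂ → ℂ := fun ζ => F ζ / G ζ with hf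
  have h1 : DifferentiableOn ℂ (Function.update f w (limUnder (𝓝[≠] w) f)) (Metric.ball w r) := by
    refine Complex.differentiableOn_update_limUnder_of_bddAbove (Metric.ball_mem_nhds w hr) ?_ ?_
    · intro z hz
      exact ((hF z).div (hG z) ((hrB z hz.1).2 hz.2)).differentiableWithinAt
    · refine ⟨C, ?_⟩
      rintro _ ⟨z, hz, rfl⟩
      simp only [Function.comp_apply, hf, norm_div]
      rw [div_le_iff₀ (norm_pos_iff.2 ((hrB z hz.1).2 hz.2))]
      exact (hrB z hz.1).1
  refine (h1.differentiableAt (Metric.ball_mem_nhds w hr)).congr_of_eventuallyEq ?_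
  filter_upwards [Metric.ball_mem_nhds w hr] with z hz
  by_cases hzw : z = w
  · subst hzw; simp [remQuot, hf]
  · rw [Function.update_of_ne hzw, remQuot_eq hF hG ((hrB z hz).2 hzw)]

/-- Riemann's theorem gives holomorphy in w only. Near a point, choose a circle in w that avoids the
zeros of G; by compactness it does so for all nearby x. Cauchy's formula then writes the extension
as an integral over this circle of a kernel that is holomorphic in both variables. -/
theorem differentiableOn_remQuot_prod {E : Type*} [NormedAddCommGroup E] [NormedSpace ℂ E]
    [ProperSpace E] {F G : ℂ × E → ℂ} {U : Set E} (hU : IsOpen U)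
    (hF : DifferentiableOn ℂ F (univ ×ˢ U)) (hG : DifferentiableOn ℂ G (univ ×ˢ U))
    (hc : ∀ x ∈ U, {w | G (w, x) = 0}.Countable)
    (hb : ∀ x ∈ U, ∀ w, ∃ C, ∀ᶠ ζ in 𝓝 w, ‖F (ζ, x)‖ ≤ C * ‖G (ζ, x)‖) :
    DifferentiableOn ℂ
      (fun p : ℂ × E => remQuot (fun ζ => F (ζ, p.2)) (fun ζ => G (ζ, p.2)) p.1)
      (univ ×ˢ U) := by
  have hUU : IsOpen ((univ : Set ℂ) ×ˢ U) := isOpen_univ.prod hU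
  have hslice : ∀ {H : ℂ × E → ℂ}, DifferentiableOn ℂ H (univ ×ˢ U) → ∀ x ∈ U,
      Differentiable ℂ fun ζ => H (ζ, x) := by
    intro H hH x hx ζ
    have h1 : DifferentiableAt ℂ H (ζ, x) :=
      (hH (ζ, x) ⟨mem_univ _, hx⟩).differentiableAt (hUU.mem_nhds ⟨mem_univ _, hx⟩)
    exact DifferentiableAt.comp (g := H) (f := fun ζ => (ζ, x)) ζ h1 (by fun_prop)
  rintro ⟨w₀, x₀⟩ ⟨-, hx₀⟩
  simp only at hx₀
  have hne := eventually_ne_zero_of_countable (hslice hG x₀ hx₀) (hc x₀ hx₀) w₀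
  rw [eventually_nhdsWithin_iff] at hne
  obtain ⟨R, hR, hRB⟩ := Metric.eventually_nhds_iff_ball.1 hne
  set r := R / 2 with hrdef
  have hr : 0 < r := by positivity
  have hGs : ∀ t : ℝ, G (circleMap w₀ r t, x₀) ≠ 0 := by
    intro t
    refine hRB _ ?_ (circleMap_ne_center hr.ne')
    have := circleMap_mem_sphere w₀ hr.le t
    rw [Metric.mem_sphere] at this
    rw [Metric.mem_ball, this]
    linarith
  have hev : ∀ᶠ x in 𝓝 x₀, ∀ ζ ∈ Metric.sphere w₀ r, x ∈ U ∧ G (ζ, x) ≠ 0 := by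
    refine (isCompact_sphere w₀ r).eventually_forall_of_forall_eventually ?_
    intro ζ hζ
    have c1 : ContinuousAt G (ζ, x₀) :=
      hG.continuousOn.continuousAt (hUU.mem_nhds ⟨mem_univ _, hx₀⟩)
    have c2 : ContinuousAt (fun z : E × ℂ => G (z.2, z.1)) (x₀, ζ) :=
      ContinuousAt.comp (g := G) (f := fun z : E × ℂ => (z.2, z.1)) (x := (x₀, ζ)) c1
        (by fun_prop)
    have hne : G (ζ, x₀) ≠ 0 := by
      rw [← abs_of_pos hr, ← range_circleMap] at hζ
      obtain ⟨t, rfl⟩ := hζ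
      exact hGs t
    have e1 := c2.eventually_ne hne
    have e2 : ∀ᶠ z : E × ℂ in 𝓝 (x₀, ζ), z.1 ∈ U :=
      continuousAt_fst.eventually_mem (hU.mem_nhds hx₀)
    exact e2.and e1
  obtain ⟨ρ, hρ, hB⟩ := Metric.eventually_nhds_iff_ball.1 hev
  set B := Metric.ball x₀ ρ
  have hBU : B ⊆ U := fun x hx => (hB x hx (circleMap w₀ r 0) (circleMap_mem_sphere w₀ hr.le 0)).1
  have hO : IsOpen (Metric.ball w₀ r ×ˢ B) := Metric.isOpen_ball.prod Metric.isOpen_ball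
  set k : ℝ → ℂ × E → ℂ := fun t p => deriv (circleMap w₀ r) t •
    ((circleMap w₀ r t - p.1)⁻¹ • (F (circleMap w₀ r t, p.2) / G (circleMap w₀ r t, p.2))) with hk
  have hsub : ∀ (t : ℝ), ∀ p ∈ Metric.ball w₀ r ×ˢ B, circleMap w₀ r t - p.1 ≠ 0 := by
    intro t p hp h
    have h1 := circleMap_mem_sphere w₀ hr.le t
    rw [sub_eq_zero.1 h] at h1
    have h2 := hp.1
    rw [Metric.mem_ball] at h2
    rw [Metric.mem_sphere] at h1
    linarith
  have hGk : ∀ (t : ℝ), ∀ p ∈ Metric.ball w₀ r ×ˢ B, G (circleMap w₀ r t, p.2) ≠ 0 :=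
    fun t p hp => (hB p.2 hp.2 _ (circleMap_mem_sphere w₀ hr.le t)).2
  have hint := differentiableOn_intervalIntegral (k := k) hO 0 (2 * Real.pi) (by
      have hm : MapsTo (fun p : ℝ × ℂ × E => (circleMap w₀ r p.1, p.2.2))
          (univ ×ˢ (Metric.ball w₀ r ×ˢ B)) (univ ×ˢ U) := fun p hp => ⟨mem_univ _, hBU hp.2.2⟩
      have hcm : Continuous fun p : ℝ × ℂ × E => circleMap w₀ r p.1 :=
        (continuous_circleMap w₀ r).comp continuous_fst
      have hc0 : ContinuousOn (fun p : ℝ × ℂ × E => (circleMap w₀ r p.1, p.2.2))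
          (univ ×ˢ (Metric.ball w₀ r ×ˢ B)) := by fun_prop
      have c1 := hF.continuousOn.comp hc0 hm
      have c2 := hG.continuousOn.comp hc0 hm
      have c3 := c1.div c2 fun p hp => hGk p.1 p.2 hp.2
      refine ContinuousOn.fun_smul ?_ (ContinuousOn.fun_smul ?_ c3)
      · simp only [deriv_circleMap]
        have : Continuous fun p : ℝ × ℂ × E => circleMap 0 r p.1 :=
          (continuous_circleMap 0 r).comp continuous_fst
        fun_prop
      · exact ContinuousOn.inv₀ (by fun_prop) fun p hp => hsub p.1 p.2 hp.2)
    (fun t => by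
      have hm : MapsTo (fun p : ℂ × E => (circleMap w₀ r t, p.2))
          (Metric.ball w₀ r ×ˢ B) (univ ×ˢ U) := fun p hp => ⟨mem_univ _, hBU hp.2⟩
      have hc0 : DifferentiableOn ℂ (fun p : ℂ × E => (circleMap w₀ r t, p.2))
          (Metric.ball w₀ r ×ˢ B) := by fun_prop
      have c1 := hF.comp hc0 hm
      have c2 := hG.comp hc0 hm
      intro p hp
      have c4 : DifferentiableWithinAt ℂ (fun p : ℂ × E => (circleMap w₀ r t - p.1)⁻¹)
          (Metric.ball w₀ r ×ˢ B) p := by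
        exact DifferentiableWithinAt.fun_inv (by fun_prop) (hsub t p hp)
      have c5 := (c1 p hp).mul ((c2 p hp).inv (hGk t p hp))
      have c6 := (c4.fun_mul c5).const_mul (deriv (circleMap w₀ r) t)
      simpa only [hk, smul_eq_mul, div_eq_mul_inv, Pi.mul_apply, Pi.inv_apply,
        Function.comp_apply] using c6)
  have hO' : Metric.ball w₀ r ×ˢ B ∈ 𝓝 (w₀, x₀) :=
    hO.mem_nhds ⟨Metric.mem_ball_self hr, Metric.mem_ball_self hρ⟩
  refine DifferentiableAt.differentiableWithinAt ?_
  refine ((hint.differentiableAt hO').const_smul ((2 * Real.pi * Complex.I : ℂ)⁻¹)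
    ).congr_of_eventuallyEq ?_
  filter_upwards [hO'] with p hp
  have hx := hBU hp.2
  have hd := differentiable_remQuot (hslice hF _ hx) (hslice hG _ hx) (hc _ hx) (hb _ hx)
  have := hd.diffContOnCl (s := Metric.ball w₀ r)
    |>.two_pi_i_inv_smul_circleIntegral_sub_inv_smul hp.1
  simp only [Pi.smul_apply]
  rw [← this, circleIntegral]
  congr 1
  refine intervalIntegral.integral_congr fun t _ => ?_
  simp only [hk]
  rw [remQuot_eq (hslice hF _ hx) (hslice hG _ hx) (hGk t p hp)]

/-! ### Liouville's theorem for norms that are periodic under a lattice -/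

theorem norm_sq_le_of_dense {F G : ℂ → ℂ} (hF : Continuous F) (hG : Continuous G) {S : Set ℂ}
    (hS : S.Countable) {O : Set ℂ} (hO : IsOpen O) {C : ℝ}
    (h : ∀ w ∈ O, w ∉ S → ‖F w‖ ≤ C * ‖G w‖) : ∀ w ∈ O, ‖F w‖ ≤ C * ‖G w‖ := by
  intro w hw
  have hd : Dense Sᶜ := hS.dense_compl ℝ
  have hcl : IsClosed {w | ‖F w‖ ≤ C * ‖G w‖} :=
    isClosed_le hF.norm (continuous_const.mul hG.norm)
  have : w ∈ closure (O ∩ Sᶜ) := hd.open_subset_closure_inter hO hw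
  exact hcl.closure_subset_iff.2 (fun z hz => h z hz.1 hz.2) this

/-- The common argument for `thetaNorm_neg_inv` and `pairNorm_mul`. A locally bounded periodic
function is bounded by compactness of a period parallelogram; here n is the norm squared of F
e^{q/2} / G, which thus extends to a bounded entire function. S is an exceptional set that may be
dense, so it is only asked to be countable. -/
theorem exists_const_of_lattice_periodic {F G q : ℂ → ℂ} (hF : Differentiable ℂ F)
    (hG : Differentiable ℂ G) (hq : Differentiable ℂ q) {S : Set ℂ} (hS : S.Countable)
    (hG0 : ∀ w ∉ S, G w ≠ 0) {n : ℂ → ℝ}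
    (hn : ∀ w ∉ S, n w = ‖F w‖ ^ 2 * Real.exp (q w).re / ‖G w‖ ^ 2) {u₁ u₂ : ℂ}
    (hω : (u₁ / u₂).im ≠ 0) (hS₁ : ∀ w, w + u₁ ∈ S ↔ w ∈ S) (hS₂ : ∀ w, w + u₂ ∈ S ↔ w ∈ S)
    (hn₁ : ∀ w ∉ S, n (w + u₁) = n w) (hn₂ : ∀ w ∉ S, n (w + u₂) = n w)
    (hloc : ∀ w₀, ∃ C, ∀ᶠ w in 𝓝 w₀, w ∉ S → n w ≤ C) : ∃ c, ∀ w ∉ S, n w = c := by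
  have hu₂ : u₂ ≠ 0 := by rintro rfl; simp at hω
  have hSz : ∀ {v : ℂ}, (∀ w, w + v ∈ S ↔ w ∈ S) → ∀ (m : ℤ) w, w + m * v ∈ S ↔ w ∈ S := by
    intro v h m
    induction m using Int.induction_on with
    | zero => simp
    | succ m ih => intro w; rw [← ih w, ← h (w + (m : ℤ) * v)]; push_cast; ring_nf
    | pred m ih => intro w; rw [← ih w, ← h]; push_cast; ring_nf
  have hnz : ∀ {v : ℂ}, (∀ w, w + v ∈ S ↔ w ∈ S) → (∀ w ∉ S, n (w + v) = n w) →
      ∀ (m : ℤ), ∀ w ∉ S, n (w + m * v) = n w := by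
    intro v hs h m
    induction m using Int.induction_on with
    | zero => simp
    | succ m ih =>
      intro w hw
      rw [← ih w hw, ← h (w + (m : ℤ) * v) (by rwa [hSz hs])]; push_cast; ring_nf
    | pred m ih =>
      intro w hw
      rw [← ih w hw, ← h (w + ((-m - 1 : ℤ) : ℂ) * v) (by rwa [hSz hs])]; push_cast; ring_nf
  -- The closed period parallelogram; u₁ and u₂ are linearly independent over ℝ, so its translates
  -- cover ℂ.
  set D : Set ℂ := (fun p : ℝ × ℝ => (p.1 : ℂ) * u₁ + p.2 * u₂) '' (Icc 0 1 ×ˢ Icc 0 1) with hD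
  have hDc : IsCompact D := (isCompact_Icc.prod isCompact_Icc).image (by fun_prop)
  have hDall : ∀ w : ℂ, ∃ m k : ℤ, w + m * u₁ + k * u₂ ∈ D := by
    intro w
    set s := (w / u₂).im / (u₁ / u₂).im with hs
    set t := (w / u₂).re - s * (u₁ / u₂).re with ht
    have hw : w = s * u₁ + t * u₂ := by
      have : w / u₂ = s * (u₁ / u₂) + t := by
        apply Complex.ext
        · simp [ht]
        · simp [hs, hω]
      field_simp at this
      rw [this]; ring
    refine ⟨-⌊s⌋, -⌊t⌋, (Int.fract s, Int.fract t), ⟨⟨Int.fract_nonneg _, (Int.fract_lt_one _).le⟩,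
      ⟨Int.fract_nonneg _, (Int.fract_lt_one _).le⟩⟩, ?_⟩
    simp only [Int.fract]
    rw [hw]
    push_cast
    ring
  obtain ⟨C, hC⟩ : ∃ C, ∀ w ∈ D, w ∉ S → n w ≤ C := by
    choose C hC using hloc
    obtain ⟨t, htD⟩ := hDc.elim_nhds_subcover' (fun w _ => {z | z ∉ S → n z ≤ C w})
      (fun w _ => hC w)
    rcases t.eq_empty_or_nonempty with rfl | hne
    · exact ⟨0, fun w hw => by simpa using htD hw⟩
    · refine ⟨t.sup' hne fun w => C w, fun w hw hwS => ?_⟩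
      obtain ⟨z, hz, hzw⟩ := mem_iUnion₂.1 (htD hw)
      exact (hzw hwS).trans (Finset.le_sup' (fun w : D => C w) hz)
  have hCall : ∀ w ∉ S, n w ≤ C := by
    intro w hw
    obtain ⟨m, k, hmk⟩ := hDall w
    have h1 : w + m * u₁ ∉ S := by rwa [hSz hS₁]
    have h2 : w + m * u₁ + k * u₂ ∉ S := by rwa [hSz hS₂]
    rw [← hnz hS₁ hn₁ m w hw, ← hnz hS₂ hn₂ k _ h1]
    exact hC _ hmk h2
  -- The weight exp(Re q) is |e^{q/2}|² and is absorbed into the numerator.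
  set F₁ : ℂ → ℂ := fun w => F w * Complex.exp (q w / 2) with hF₁
  have hF₁d : Differentiable ℂ F₁ := hF.mul ((hq.div_const 2).cexp)
  have hnorm : ∀ w, ‖F₁ w‖ ^ 2 = ‖F w‖ ^ 2 * Real.exp (q w).re := by
    intro w
    rw [hF₁, norm_mul, mul_pow, Complex.norm_exp, ← Real.exp_nat_mul]
    congr 2
    simp
    ring
  have hle : ∀ w, ‖F₁ w‖ ≤ Real.sqrt C * ‖G w‖ := by
    intro w
    refine norm_sq_le_of_dense hF₁d.continuous hG.continuous hS isOpen_univ ?_ w (mem_univ w)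
    intro w _ hw
    have h1 := hCall w hw
    have hp : 0 < ‖G w‖ := norm_pos_iff.2 (hG0 w hw)
    rw [hn w hw, ← hnorm, div_le_iff₀ (by positivity)] at h1
    rw [← Real.sqrt_sq hp.le, ← Real.sqrt_mul' _ (by positivity)]
    exact Real.le_sqrt_of_sq_le h1
  have hc : {w | G w = 0}.Countable := hS.mono fun w hw => by
    by_contra h
    exact hG0 w h hw
  have hd := differentiable_remQuot hF₁d hG hc fun w => ⟨_, Eventually.of_forall fun ζ => hle ζ⟩
  have hbd : Bornology.IsBounded (range (remQuot F₁ G)) := by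
    rw [isBounded_iff_forall_norm_le]
    refine ⟨Real.sqrt C, ?_⟩
    rintro _ ⟨w, rfl⟩
    have := norm_sq_le_of_dense (C := Real.sqrt C) hd.continuous
      (continuous_const (y := (1 : ℂ))) hS isOpen_univ (fun w _ hw => by
        rw [remQuot_eq hF₁d hG (hG0 w hw), norm_div, div_le_iff₀ (norm_pos_iff.2 (hG0 w hw))]
        simpa using hle w) w (mem_univ w)
    simpa using this
  refine ⟨‖remQuot F₁ G 0‖ ^ 2, fun w hw => ?_⟩
  rw [hn w hw, ← hnorm, hd.apply_eq_apply_of_bounded hbd 0 w, remQuot_eq hF₁d hG (hG0 w hw),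
    norm_div, div_pow]

/-! ### The theta function and its hermitian norm -/

/-- `e^{2πiu}`. -/
def ee (u : ℂ) : ℂ := Complex.exp (2 * Real.pi * Complex.I * u)

theorem ee_add (u v : ℂ) : ee (u + v) = ee u * ee v := by
  rw [ee, mul_add, Complex.exp_add]; rfl

theorem ee_zero : ee 0 = 1 := by simp [ee]

theorem ee_int (m : ℤ) : ee m = 1 := by
  rw [ee, mul_comm]; exact Complex.exp_int_mul_two_pi_mul_I m

theorem ee_eq_one_iff {u : ℂ} : ee u = 1 ↔ ∃ m : ℤ, u = m := by
  rw [ee, Complex.exp_eq_one_iff]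
  refine exists_congr fun m => ⟨fun h => ?_, fun h => by rw [h]; ring⟩
  have : (2 * Real.pi * Complex.I : ℂ) ≠ 0 := Complex.two_pi_I_ne_zero
  apply mul_left_cancel₀ this
  rw [h]; ring

theorem ee_add_int (u : ℂ) (m : ℤ) : ee (u + m) = ee u := by rw [ee_add, ee_int, mul_one]

theorem norm_ee (u : ℂ) : ‖ee u‖ = Real.exp (-(2 * Real.pi * u.im)) := by
  rw [ee, Complex.norm_exp]
  congr 1
  simp

theorem differentiable_ee : Differentiable ℂ ee := by
  unfold ee; fun_prop

/-- The infinite `q`-Pochhammer symbol `∏_{j ≥ 0} (1 - e^{2πi(jτ + z)})`. -/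
def qPoch (z τ : ℂ) : ℂ := ∏' j : ℕ, (1 + -ee (j * τ + z))

theorem norm_ee_nat_mul (z τ : ℂ) (j : ℕ) :
    ‖-ee (j * τ + z)‖ = Real.exp (-(2 * Real.pi * z.im)) * Real.exp (-(2 * Real.pi * τ.im)) ^ j := by
  rw [norm_neg, norm_ee, ← Real.exp_nat_mul, ← Real.exp_add]
  congr 1
  simp
  ring

theorem summable_qPoch (z : ℂ) {τ : ℂ} (hτ : 0 < τ.im) :
    Summable fun j : ℕ => ‖-ee (j * τ + z)‖ := by
  simp only [norm_ee_nat_mul]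
  refine (summable_geometric_of_lt_one (Real.exp_nonneg _) ?_).mul_left _
  rw [Real.exp_lt_one_iff]
  have := Real.pi_pos
  nlinarith [mul_pos this hτ]

theorem multipliable_qPoch (z : ℂ) {τ : ℂ} (hτ : 0 < τ.im) :
    Multipliable fun j : ℕ => (1 + -ee (j * τ + z)) :=
  multipliable_one_add_of_summable (summable_qPoch z hτ)

theorem qPoch_eq_mul (z : ℂ) {τ : ℂ} (hτ : 0 < τ.im) :
    qPoch z τ = (1 - ee z) * qPoch (z + τ) τ := by
  have h : ∀ j : ℕ, (1 + -ee ((j + 1 : ℕ) * τ + z)) = 1 + -ee (j * τ + (z + τ)) := by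
    intro j; push_cast; ring_nf
  have h2 := tprod_eq_zero_mul' (f := fun j : ℕ => 1 + -ee (j * τ + z))
    (by simpa only [h] using multipliable_qPoch (z + τ) hτ)
  simp only [h] at h2
  rw [qPoch, h2, qPoch]
  simp [sub_eq_add_neg]

theorem qPoch_add_int (z τ : ℂ) (m : ℤ) : qPoch (z + m) τ = qPoch z τ := by
  simp only [qPoch, ← add_assoc, ee_add_int]

theorem qPoch_add_one_right (z τ : ℂ) : qPoch z (τ + 1) = qPoch z τ := by
  simp only [qPoch]
  refine tprod_congr fun j => ?_
  rw [← ee_add_int (j * τ + z) j]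
  push_cast; ring_nf

theorem qPoch_eq_zero_iff (z : ℂ) {τ : ℂ} (hτ : 0 < τ.im) :
    qPoch z τ = 0 ↔ ∃ (j : ℕ) (m : ℤ), j * τ + z = m := by
  constructor
  · intro h
    by_contra hne
    push Not at hne
    refine tprod_one_add_ne_zero_of_summable (fun j h0 => ?_) (summable_qPoch z hτ) h
    obtain ⟨m, hm⟩ := ee_eq_one_iff.1 (by linear_combination -h0 : ee (j * τ + z) = 1)
    exact hne j m hm
  · rintro ⟨j, m, h⟩
    refine tprod_of_exists_eq_zero ⟨j, ?_⟩
    rw [ee_eq_one_iff.2 ⟨m, h⟩]; simp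

theorem qPoch_mul_half (z : ℂ) {τ : ℂ} (hτ : 0 < τ.im) :
    qPoch z τ * qPoch (z + 1 / 2) τ = qPoch (2 * z) (2 * τ) := by
  rw [qPoch, qPoch, ← (multipliable_qPoch z hτ).tprod_mul (multipliable_qPoch _ hτ), qPoch]
  refine tprod_congr fun j => ?_
  have h1 : ee (1 / 2) = -1 := by
    rw [ee, show 2 * (Real.pi : ℂ) * Complex.I * (1 / 2) = Real.pi * Complex.I by ring,
      Complex.exp_pi_mul_I]
  rw [← add_assoc, ee_add _ (1 / 2), h1,
    show (j : ℂ) * (2 * τ) + 2 * z = (j * τ + z) + (j * τ + z) by ring, ee_add (j * τ + z)]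
  ring

theorem qPoch_even_odd (z : ℂ) {τ : ℂ} (hτ : 0 < τ.im) :
    qPoch z (2 * τ) * qPoch (z + τ) (2 * τ) = qPoch z τ := by
  have h2τ : 0 < (2 * τ).im := by simpa using hτ
  have h1 : ∀ j : ℕ, 1 + -ee ((2 * j : ℕ) * τ + z) = 1 + -ee (j * (2 * τ) + z) := by
    intro j; push_cast; ring_nf
  have h2 : ∀ j : ℕ, 1 + -ee ((2 * j + 1 : ℕ) * τ + z) = 1 + -ee (j * (2 * τ) + (z + τ)) := by
    intro j; push_cast; ring_nf
  have := tprod_even_mul_odd (f := fun j : ℕ => 1 + -ee (j * τ + z))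
    (by simpa only [h1] using multipliable_qPoch z h2τ)
    (by simpa only [h2] using multipliable_qPoch (z + τ) h2τ)
  simp only [h1, h2] at this
  exact this

theorem differentiableOn_qPoch :
    DifferentiableOn ℂ (fun p : ℂ × ℂ => qPoch p.1 p.2) {p | 0 < p.2.im} := by
  have hO : IsOpen {p : ℂ × ℂ | 0 < p.2.im} :=
    isOpen_lt continuous_const (Complex.continuous_im.comp continuous_snd)
  refine differentiableOn_tprod_one_add hO (fun j => ?_) ?_
  · exact (differentiable_ee.comp (by fun_prop :
      Differentiable ℂ fun p : ℂ × ℂ => j * p.2 + p.1)).neg.differentiableOn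
  · rintro ⟨z, τ⟩ hτ
    simp only [mem_ofPred_eq] at hτ
    refine ⟨fun j => Real.exp (-(2 * Real.pi * (z.im - 1))) *
      Real.exp (-(2 * Real.pi * (τ.im / 2))) ^ j, ?_, ?_⟩
    · refine (summable_geometric_of_lt_one (Real.exp_nonneg _) ?_).mul_left _
      rw [Real.exp_lt_one_iff]
      have := Real.pi_pos
      nlinarith [mul_pos this hτ]
    · have h1 : ∀ᶠ p : ℂ × ℂ in 𝓝 (z, τ), z.im - 1 < p.1.im :=
        (Complex.continuous_im.comp continuous_fst).continuousAt.eventually_const_lt (by simp)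
      have h2 : ∀ᶠ p : ℂ × ℂ in 𝓝 (z, τ), τ.im / 2 < p.2.im :=
        (Complex.continuous_im.comp continuous_snd).continuousAt.eventually_const_lt
          (by simpa using hτ)
      filter_upwards [h1, h2] with p hp1 hp2 j
      rw [norm_ee_nat_mul]
      have := Real.pi_pos
      gcongr

/-! ### Quasi-periodicity, duplication formula and zeros of the theta function -/

theorem theta0_eq (z : ℂ) {τ : ℂ} (hτ : 0 < τ.im) :
    theta0 z τ = qPoch z τ * qPoch (τ - z) τ := by
  rw [qPoch, qPoch, ← (multipliable_qPoch z hτ).tprod_mul (multipliable_qPoch _ hτ), theta0]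
  refine tprod_congr fun j => ?_
  rw [mul_comm, ← sub_eq_add_neg, ← sub_eq_add_neg,
    show (j : ℂ) * τ + (τ - z) = (j + 1) * τ - z by ring]
  rfl

theorem theta0_add_int (z : ℂ) {τ : ℂ} (hτ : 0 < τ.im) (m : ℤ) :
    theta0 (z + m) τ = theta0 z τ := by
  rw [theta0_eq _ hτ, theta0_eq _ hτ, qPoch_add_int,
    show τ - (z + m) = τ - z + ((-m : ℤ) : ℂ) by push_cast; ring, qPoch_add_int]

theorem theta0_sub (z : ℂ) {τ : ℂ} (hτ : 0 < τ.im) : theta0 (τ - z) τ = theta0 z τ := by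
  rw [theta0_eq _ hτ, theta0_eq _ hτ, mul_comm, sub_sub_cancel]

theorem theta0_add_one_right (z : ℂ) {τ : ℂ} (hτ : 0 < τ.im) :
    theta0 z (τ + 1) = theta0 z τ := by
  rw [theta0_eq _ hτ, theta0_eq _ (by simpa using hτ), qPoch_add_one_right, qPoch_add_one_right,
    show τ + 1 - z = τ - z + (1 : ℤ) by push_cast; ring, qPoch_add_int]

theorem theta0_add_right (z : ℂ) {τ : ℂ} (hτ : 0 < τ.im) :
    theta0 (z + τ) τ = -ee (-z) * theta0 z τ := by
  rw [theta0_eq _ hτ, theta0_eq _ hτ, qPoch_eq_mul z hτ, show τ - (z + τ) = -z by ring,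
    qPoch_eq_mul (-z) hτ, show -z + τ = τ - z by ring]
  have h : ee (-z) * ee z = 1 := by rw [← ee_add]; simp [ee_zero]
  linear_combination (qPoch (z + τ) τ * qPoch (τ - z) τ) * -h

theorem theta0_neg (z : ℂ) {τ : ℂ} (hτ : 0 < τ.im) : theta0 (-z) τ = -ee (-z) * theta0 z τ := by
  rw [← theta0_add_right z hτ, ← theta0_sub (-z) hτ]; congr 1; ring

/-- Both Pochhammer factors of θ₀ duplicate: multiplying over z and z + 1/2 doubles z and τ, and
splitting into even and odd j halves τ again. It matters for `thetaNorm_neg_inv` that no constant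
appears. -/
theorem theta0_two_mul (z : ℂ) {τ : ℂ} (hτ : 0 < τ.im) :
    theta0 (2 * z) τ = theta0 z τ * theta0 (z + 1 / 2) τ * theta0 (z + τ / 2) τ *
      theta0 (z + τ / 2 + 1 / 2) τ := by
  have key : ∀ u, qPoch u τ * qPoch (u + 1 / 2) τ * (qPoch (u + τ / 2) τ *
      qPoch (u + τ / 2 + 1 / 2) τ) = qPoch (2 * u) τ := by
    intro u
    rw [qPoch_mul_half u hτ, qPoch_mul_half _ hτ, mul_add, mul_div_cancel₀ _ two_ne_zero,
      qPoch_even_odd _ hτ]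
  have e1 : qPoch (τ - (z + 1 / 2)) τ = qPoch (τ / 2 - z + τ / 2 + 1 / 2) τ := by
    rw [← qPoch_add_int _ τ 1]; congr 1; push_cast; ring
  have e2 : qPoch (τ - (z + τ / 2 + 1 / 2)) τ = qPoch (τ / 2 - z + 1 / 2) τ := by
    rw [← qPoch_add_int _ τ 1]; congr 1; push_cast; ring
  have e3 := key z
  have e4 := key (τ / 2 - z)
  simp only [theta0_eq _ hτ]
  rw [e1, e2, ← e3, show τ - 2 * z = 2 * (τ / 2 - z) by ring, ← e4,
    show τ - z = τ / 2 - z + τ / 2 by ring, show τ - (z + τ / 2) = τ / 2 - z by ring]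
  ring

theorem theta0_eq_zero_iff (z : ℂ) {τ : ℂ} (hτ : 0 < τ.im) :
    theta0 z τ = 0 ↔ ∃ j m : ℤ, z = j * τ + m := by
  rw [theta0_eq _ hτ, mul_eq_zero, qPoch_eq_zero_iff _ hτ, qPoch_eq_zero_iff _ hτ]
  constructor
  · rintro (⟨j, m, h⟩ | ⟨j, m, h⟩)
    · exact ⟨-j, m, by push_cast; linear_combination h⟩
    · exact ⟨j + 1, -m, by push_cast; linear_combination -h⟩
  · rintro ⟨j, m, h⟩
    rcases le_or_gt j 0 with hj | hj
    · left
      refine ⟨j.natAbs, m, ?_⟩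
      have : ((j.natAbs : ℕ) : ℂ) = -(j : ℂ) := by
        have : ((j.natAbs : ℕ) : ℤ) = -j := by omega
        rw [← Int.cast_natCast, this]; push_cast; ring
      rw [this, h]; ring
    · right
      refine ⟨(j - 1).natAbs, -m, ?_⟩
      have : (((j - 1).natAbs : ℕ) : ℂ) = (j : ℂ) - 1 := by
        have : (((j - 1).natAbs : ℕ) : ℤ) = j - 1 := by omega
        rw [← Int.cast_natCast, this]; push_cast; ring
      rw [this, h]; push_cast; ring

theorem differentiableOn_theta0 :
    DifferentiableOn ℂ (fun p : ℂ × ℂ => theta0 p.1 p.2) {p | 0 < p.2.im} := by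
  have h2 : DifferentiableOn ℂ (fun p : ℂ × ℂ => qPoch (p.2 - p.1) p.2) {p | 0 < p.2.im} :=
    differentiableOn_qPoch.comp (f := fun p : ℂ × ℂ => (p.2 - p.1, p.2)) (by fun_prop)
      fun p hp => hp
  exact (differentiableOn_qPoch.mul h2).congr fun p hp => theta0_eq _ hp

theorem differentiable_theta0 {τ : ℂ} (hτ : 0 < τ.im) : Differentiable ℂ fun z => theta0 z τ := by
  intro z
  have hO : IsOpen {p : ℂ × ℂ | 0 < p.2.im} :=
    isOpen_lt continuous_const (Complex.continuous_im.comp continuous_snd)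
  exact DifferentiableAt.comp (g := fun p : ℂ × ℂ => theta0 p.1 p.2) (f := fun z => (z, τ)) z
    (differentiableOn_theta0.differentiableAt (hO.mem_nhds hτ)) (by fun_prop)

/-- The quadratic Bernoulli polynomial `B_{1,2}`. -/
def R2 (ζ t : ℝ) : ℝ := ζ ^ 2 / t - ζ + t / 6

theorem h2_eq (z τ : ℂ) : h2 z τ = Real.exp (-(2 * Real.pi) * R2 z.im τ.im) := by
  rw [h2, R2]
  congr 1
  simp
  ring

/-! ### The invariant norm of the theta function and its modular invariance -/

theorem h2_pos (z τ : ℂ) : 0 < h2 z τ := Real.exp_pos _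

/-- The invariant norm squared of the theta function. -/
def thetaNorm (z τ : ℂ) : ℝ := ‖theta0 z τ‖ ^ 2 * h2 z τ

theorem thetaNorm_eq_zero_iff (z : ℂ) {τ : ℂ} (hτ : 0 < τ.im) :
    thetaNorm z τ = 0 ↔ ∃ j m : ℤ, z = j * τ + m := by
  rw [← theta0_eq_zero_iff z hτ, thetaNorm, mul_eq_zero, or_iff_left (h2_pos z τ).ne']
  simp

theorem thetaNorm_nonneg (z τ : ℂ) : 0 ≤ thetaNorm z τ :=
  mul_nonneg (by positivity) (h2_pos z τ).le

theorem thetaNorm_add_int (z : ℂ) {τ : ℂ} (hτ : 0 < τ.im) (m : ℤ) :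
    thetaNorm (z + m) τ = thetaNorm z τ := by
  rw [thetaNorm, thetaNorm, theta0_add_int z hτ, h2_eq, h2_eq]
  simp

theorem thetaNorm_add_one_right (z : ℂ) {τ : ℂ} (hτ : 0 < τ.im) :
    thetaNorm z (τ + 1) = thetaNorm z τ := by
  rw [thetaNorm, thetaNorm, theta0_add_one_right z hτ, h2_eq, h2_eq]
  simp

theorem norm_ee_neg_sq (z : ℂ) : ‖-ee (-z)‖ ^ 2 = Real.exp (4 * Real.pi * z.im) := by
  rw [norm_neg, norm_ee, ← Real.exp_nat_mul]
  congr 1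
  simp
  ring

theorem thetaNorm_add_right (z : ℂ) {τ : ℂ} (hτ : 0 < τ.im) :
    thetaNorm (z + τ) τ = thetaNorm z τ := by
  rw [thetaNorm, thetaNorm, theta0_add_right z hτ, norm_mul, mul_pow, norm_ee_neg_sq,
    mul_right_comm, mul_comm, h2_eq, h2_eq, ← Real.exp_add]
  congr 2
  simp only [R2, Complex.add_im]
  field_simp
  ring

theorem thetaNorm_neg (z : ℂ) {τ : ℂ} (hτ : 0 < τ.im) : thetaNorm (-z) τ = thetaNorm z τ := by
  rw [thetaNorm, thetaNorm, theta0_neg z hτ, norm_mul, mul_pow, norm_ee_neg_sq,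
    mul_right_comm, mul_comm, h2_eq, h2_eq, ← Real.exp_add]
  congr 2
  simp only [R2, Complex.neg_im]
  field_simp
  ring

theorem thetaNorm_add_int_mul (z : ℂ) {τ : ℂ} (hτ : 0 < τ.im) (j : ℤ) :
    thetaNorm (z + j * τ) τ = thetaNorm z τ := by
  induction j using Int.induction_on with
  | zero => simp
  | succ j ih => rw [← ih, ← thetaNorm_add_right (z + (j : ℤ) * τ) hτ]; push_cast; ring_nf
  | pred j ih =>
    rw [← ih, ← thetaNorm_add_right (z + ((-j - 1 : ℤ) : ℂ) * τ) hτ]; push_cast; ring_nf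

theorem thetaNorm_add_lattice (z : ℂ) {τ : ℂ} (hτ : 0 < τ.im) (j m : ℤ) :
    thetaNorm (z + (j * τ + m)) τ = thetaNorm z τ := by
  rw [← add_assoc, thetaNorm_add_int _ hτ, thetaNorm_add_int_mul _ hτ]

theorem thetaNorm_two_mul (z : ℂ) {τ : ℂ} (hτ : 0 < τ.im) :
    thetaNorm (2 * z) τ = thetaNorm z τ * thetaNorm (z + 1 / 2) τ * thetaNorm (z + τ / 2) τ *
      thetaNorm (z + τ / 2 + 1 / 2) τ := by
  have h : h2 (2 * z) τ = h2 z τ * h2 (z + 1 / 2) τ * h2 (z + τ / 2) τ *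
      h2 (z + τ / 2 + 1 / 2) τ := by
    simp only [h2_eq, ← Real.exp_add]
    congr 1
    simp [R2]
    field_simp
    ring
  simp only [thetaNorm, theta0_two_mul z hτ, h, norm_mul]
  ring

theorem neg_inv_im_pos {τ : ℂ} (hτ : 0 < τ.im) : 0 < (-1 / τ).im := by
  have h : τ ≠ 0 := by rintro rfl; simp at hτ
  have := Complex.normSq_pos.2 h
  rw [Complex.div_im]
  have : 0 < τ.im / Complex.normSq τ := by positivity
  simpa [neg_div] using this

/-- The term (Im z)² / Im τ is not harmonic in z, but its change under (z, τ) ↦ (z/τ, -1/τ) is the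
imaginary part of z²/τ. So the weights differ by the exponential of the real part of a polynomial in
z, as Liouville's theorem needs. -/
theorem h2_neg_inv (z : ℂ) {τ : ℂ} (hτ : 0 < τ.im) :
    h2 (z / τ) (-1 / τ) = Real.exp (-2 * Real.pi * Complex.I * (z ^ 2 / τ + z / τ - z + 1 / (6 * τ)
      + τ / 6)).re * h2 z τ := by
  rw [h2_eq, h2_eq, ← Real.exp_add]
  congr 1
  have hτ0 : τ ≠ 0 := by rintro rfl; simp at hτ
  have hN : τ.re ^ 2 + τ.im ^ 2 ≠ 0 := by positivity
  have key : -(z / τ).im ^ 2 / (-1 / τ).im + z.im ^ 2 / τ.im = (z ^ 2 / τ).im := by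
    simp only [Complex.div_im, Complex.normSq_apply, pow_two, Complex.mul_re, Complex.mul_im]
    simp only [← pow_two]
    simp
    field_simp
    ring
  have e1 : (1 / (6 * τ)).im = -(-1 / τ).im / 6 := by
    rw [show (1 / (6 * τ)) = ((-1 / 6 : ℝ) : ℂ) * (-1 / τ) by push_cast; field_simp,
      Complex.im_ofReal_mul]
    ring
  have e2 : (τ / 6).im = τ.im / 6 := by simp
  have e3 : ∀ u : ℂ, (-2 * Real.pi * Complex.I * u).re = 2 * Real.pi * u.im := by
    intro u; simp
  rw [e3, Complex.add_im, Complex.add_im, Complex.sub_im, Complex.add_im, e1, e2, ← key, R2, R2]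
  ring

/-- Both sides are elliptic for the same lattice and have the same simple zeros, so their quotient
is a constant c. Both satisfy the duplication formula, whose right-hand side has four factors, hence
c = c⁴ and c = 1. This replaces the modular transformation law of θ₀. -/
theorem thetaNorm_neg_inv (z : ℂ) {τ : ℂ} (hτ : 0 < τ.im) :
    thetaNorm (z / τ) (-1 / τ) = thetaNorm z τ := by
  have hτ0 : τ ≠ 0 := by rintro rfl; simp at hτ
  have hσ := neg_inv_im_pos hτ
  set σ := -1 / τ with hσdef
  set S : Set ℂ := {z | ∃ j m : ℤ, z = j * τ + m} with hSdef
  have hS : S.Countable := by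
    have : S = range fun p : ℤ × ℤ => (p.1 : ℂ) * τ + p.2 := by
      ext z; simp [hSdef, eq_comm]
    rw [this]; exact countable_range _
  have hS' : ∀ z, (∃ j m : ℤ, z / τ = j * σ + m) ↔ z ∈ S := by
    intro z
    constructor
    · rintro ⟨j, m, h⟩
      refine ⟨m, -j, ?_⟩
      rw [div_eq_iff hτ0] at h
      rw [h, hσdef]; push_cast; field_simp; ring
    · rintro ⟨j, m, h⟩
      refine ⟨-m, j, ?_⟩
      rw [h, hσdef]; push_cast; field_simp; ring
  have hz0 : ∀ z, thetaNorm z τ = 0 ↔ z ∈ S := fun z => thetaNorm_eq_zero_iff z hτ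
  have hz1 : ∀ z, thetaNorm (z / τ) σ = 0 ↔ z ∈ S := fun z =>
    (thetaNorm_eq_zero_iff _ hσ).trans (hS' z)
  by_cases hzS : z ∈ S
  · rw [(hz0 z).2 hzS, (hz1 z).2 hzS]
  have hG0 : ∀ w ∉ S, theta0 w τ ≠ 0 := fun w hw h => hw ((theta0_eq_zero_iff w hτ).1 h)
  set n : ℂ → ℝ := fun w => thetaNorm (w / τ) σ / thetaNorm w τ with hn
  have hper : ∀ (j m : ℤ) w, n (w + (j * τ + m)) = n w := by
    intro j m w
    simp only [hn]
    rw [thetaNorm_add_lattice w hτ, ← thetaNorm_add_lattice (w / τ) hσ (-m) j]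
    congr 2
    rw [hσdef]; push_cast; field_simp; ring
  have hSadd : ∀ (j m : ℤ) w, w + (j * τ + m) ∈ S ↔ w ∈ S := by
    intro j m w
    rw [← hz0, ← hz0, thetaNorm_add_lattice w hτ]
  -- At 0 the zeros come from the factors 1 - e^{2πiw/τ} and 1 - e^{2πiw}, whose ratio is bounded
  -- because the second has nonzero derivative. The cofactors v and u are continuous and u does not
  -- vanish at 0.
  have hloc0 : ∃ C, ∀ᶠ w in 𝓝 (0 : ℂ), w ∉ S → n w ≤ C := by
    have hO1 : Continuous fun w : ℂ => (1 - ee w) := (continuous_const.sub differentiable_ee.continuous)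
    have hd : HasDerivAt (fun w : ℂ => 1 - ee w) (-(2 * Real.pi * Complex.I)) 0 := by
      have h1 : HasDerivAt (fun w : ℂ => 2 * Real.pi * Complex.I * w) (2 * Real.pi * Complex.I) 0 := by
        simpa using (hasDerivAt_id (0 : ℂ)).const_mul (2 * Real.pi * Complex.I : ℂ)
      simpa [ee] using h1.cexp.const_sub 1
    have hd' : HasDerivAt (fun w : ℂ => 1 - ee (w / τ)) (-(2 * Real.pi * Complex.I) * (1 / τ)) 0 := by
      have h1 : HasDerivAt (fun w : ℂ => w / τ) (1 / τ) 0 := (hasDerivAt_id (0 : ℂ)).div_const τ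
      exact HasDerivAt.comp (h₂ := fun w : ℂ => 1 - ee w) (h := fun w : ℂ => w / τ) 0
        (by simpa using hd) h1
    have hB1 := hd'.isBigO_sub.trans ((HasDerivAtFilter.isTheta_sub hd
      (neg_ne_zero.2 Complex.two_pi_I_ne_zero)).isBigO_symm.comp_tendsto
        (k := fun x : ℂ => (x, (0 : ℂ))) (tendsto_id.prodMk tendsto_const_pure))
    simp only [zero_div, ee_zero, sub_self, sub_zero, Function.comp_def] at hB1
    obtain ⟨C₁, hC₁⟩ := hB1.bound
    have hqc : ∀ {τ : ℂ}, 0 < τ.im → Continuous fun w : ℂ => qPoch w τ := by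
      intro τ hτ
      have := differentiableOn_qPoch.continuousOn.comp_continuous
        (f := fun w : ℂ => (w, τ)) (by fun_prop) (fun _ => hτ)
      exact this
    set u : ℂ → ℂ := fun w => qPoch (w + τ) τ * qPoch (τ - w) τ with hu
    set v : ℂ → ℂ := fun w => qPoch (w / τ + σ) σ * qPoch (σ - w / τ) σ with hv
    have hu0 : u 0 ≠ 0 := by
      have : qPoch τ τ ≠ 0 := by
        rw [Ne, qPoch_eq_zero_iff _ hτ]
        rintro ⟨j, m, h⟩
        have := congrArg Complex.im h
        simp at this
        nlinarith [(Nat.cast_nonneg j : (0 : ℝ) ≤ j)]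
      simpa [hu] using this
    have huc : Continuous u :=
      ((hqc hτ).comp (by fun_prop)).mul ((hqc hτ).comp (by fun_prop))
    have hvc : Continuous v :=
      ((hqc hσ).comp (by fun_prop)).mul ((hqc hσ).comp (by fun_prop))
    have hhc : ContinuousAt (fun w => ‖v w‖ ^ 2 * Real.exp (-2 * Real.pi * Complex.I *
      (w ^ 2 / τ + w / τ - w + 1 / (6 * τ) + τ / 6)).re / ‖u w‖ ^ 2) 0 := by
      refine ContinuousAt.div ?_ (by fun_prop) (by simpa using hu0)
      fun_prop
    have hev := hhc.eventually_lt_const (lt_add_one _)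
    set C₂ := (‖v 0‖ ^ 2 * Real.exp (-2 * Real.pi * Complex.I *
      ((0 : ℂ) ^ 2 / τ + 0 / τ - 0 + 1 / (6 * τ) + τ / 6)).re / ‖u 0‖ ^ 2) + 1
    refine ⟨C₁ ^ 2 * C₂, ?_⟩
    filter_upwards [hC₁, hev] with w h1 h2 hw
    have hne := hG0 w hw
    have hp : 0 < ‖1 - ee w‖ := by
      rw [norm_pos_iff]; intro h0
      apply hne
      rw [theta0_eq _ hτ, qPoch_eq_mul _ hτ, h0]; ring
    have hq : 0 ≤ ‖v w‖ ^ 2 * Real.exp (-2 * Real.pi * Complex.I *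
      (w ^ 2 / τ + w / τ - w + 1 / (6 * τ) + τ / 6)).re / ‖u w‖ ^ 2 := by positivity
    have e : n w = (‖1 - ee (w / τ)‖ / ‖1 - ee w‖) ^ 2 * (‖v w‖ ^ 2 * Real.exp (-2 * Real.pi *
        Complex.I * (w ^ 2 / τ + w / τ - w + 1 / (6 * τ) + τ / 6)).re / ‖u w‖ ^ 2) := by
      simp only [hn, thetaNorm]
      rw [h2_neg_inv w hτ, ← mul_assoc, mul_div_mul_right _ _ (h2_pos w τ).ne', theta0_eq w hτ,
        theta0_eq _ hσ, qPoch_eq_mul w hτ, qPoch_eq_mul _ hσ]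
      simp only [hu, hv, norm_mul]
      ring
    rw [e]
    refine mul_le_mul ?_ h2.le hq (by positivity)
    have : ‖1 - ee (w / τ)‖ / ‖1 - ee w‖ ≤ C₁ := (div_le_iff₀ hp).2 h1
    gcongr
  have hloc : ∀ w₀, ∃ C, ∀ᶠ w in 𝓝 w₀, w ∉ S → n w ≤ C := by
    intro w₀
    by_cases hw₀ : w₀ ∈ S
    · obtain ⟨j, m, rfl⟩ := hw₀
      obtain ⟨C, hC⟩ := hloc0
      refine ⟨C, ?_⟩
      have ht : Tendsto (fun w : ℂ => w + (((-j : ℤ) : ℂ) * τ + ((-m : ℤ) : ℂ))) (𝓝 (j * τ + m))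
          (𝓝 0) := by
        have : Continuous fun w : ℂ => w + (((-j : ℤ) : ℂ) * τ + ((-m : ℤ) : ℂ)) := by fun_prop
        convert this.tendsto _ using 2
        push_cast; ring
      filter_upwards [ht.eventually hC] with w h hw
      rw [hper, hSadd] at h
      exact h hw
    · have hc : ContinuousAt n w₀ := by
        refine ContinuousAt.div ?_ ?_ (by rwa [Ne, hz0])
        · have h1 := (differentiable_theta0 hσ).continuous
          have h2 : Continuous fun w : ℂ => h2 w σ := by unfold GammaGerbe.h2; fun_prop
          exact (((h1.norm.pow 2).mul h2).comp (by fun_prop : Continuous fun w : ℂ => w / τ)).continuousAt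
        · have h1 := (differentiable_theta0 hτ).continuous
          have h2 : Continuous fun w : ℂ => h2 w τ := by unfold GammaGerbe.h2; fun_prop
          exact ((h1.norm.pow 2).mul h2).continuousAt
      refine ⟨n w₀ + 1, ?_⟩
      filter_upwards [hc.eventually_lt_const (lt_add_one _)] with w h _
      exact h.le
  obtain ⟨c, hc⟩ := exists_const_of_lattice_periodic (F := fun w => theta0 (w / τ) σ)
    (G := fun w => theta0 w τ) (q := fun w => -2 * Real.pi * Complex.I *
      (w ^ 2 / τ + w / τ - w + 1 / (6 * τ) + τ / 6)) (n := n) (u₁ := τ) (u₂ := 1)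
    ((differentiable_theta0 hσ).comp (by fun_prop : Differentiable ℂ fun w : ℂ => w / τ))
    (differentiable_theta0 hτ) (by fun_prop) hS hG0
    (fun w hw => by
      simp only [hn, thetaNorm]
      rw [h2_neg_inv w hτ, ← mul_assoc, mul_div_mul_right _ _ (h2_pos w τ).ne'])
    (by simpa using hτ.ne')
    (fun w => by simpa using hSadd 1 0 w) (fun w => by simpa using hSadd 0 1 w)
    (fun w _ => by simpa using hper 1 0 w) (fun w _ => by simpa using hper 0 1 w) hloc
  have hcK : ∀ w, thetaNorm (w / τ) σ = c * thetaNorm w τ := by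
    intro w
    by_cases hw : w ∈ S
    · rw [(hz0 w).2 hw, (hz1 w).2 hw, mul_zero]
    · rw [← hc w hw, hn, div_mul_cancel₀]
      rwa [Ne, hz0]
  have hcpos : 0 < c := by
    have h1 := hcK z
    have h2 : 0 < thetaNorm z τ := (thetaNorm_nonneg z τ).lt_of_ne' (by rwa [Ne, hz0])
    have h3 : 0 < thetaNorm (z / τ) σ := (thetaNorm_nonneg _ σ).lt_of_ne' (by rwa [Ne, hz1])
    rw [h1] at h3
    exact pos_of_mul_pos_left h3 h2.le
  -- Division by τ permutes the half-periods up to periods (a1, a2, a3), so the two duplication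
  -- formulas can be compared factor by factor.
  have hc4 : c = c ^ 4 := by
    have e1 := thetaNorm_two_mul (z / 2) hτ
    have e2 := thetaNorm_two_mul (z / 2 / τ) hσ
    rw [mul_div_cancel₀ _ two_ne_zero] at e1
    have a1 : z / 2 / τ + 1 / 2 = (z / 2 + τ / 2) / τ := by field_simp
    have a2 : thetaNorm (z / 2 / τ + σ / 2) σ = thetaNorm ((z / 2 + 1 / 2) / τ) σ := by
      rw [← thetaNorm_add_right ((z / 2 + 1 / 2) / τ) hσ]
      congr 1
      rw [hσdef]; field_simp; ring
    have a3 : thetaNorm (z / 2 / τ + σ / 2 + 1 / 2) σ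
        = thetaNorm ((z / 2 + τ / 2 + 1 / 2) / τ) σ := by
      rw [← thetaNorm_add_right ((z / 2 + τ / 2 + 1 / 2) / τ) hσ]
      congr 1
      rw [hσdef]; field_simp; ring
    rw [a2, a3, a1, show 2 * (z / 2 / τ) = z / τ by ring] at e2
    simp only [hcK] at e2
    have h2 : thetaNorm z τ ≠ 0 := by rwa [Ne, hz0]
    apply mul_right_cancel₀ h2
    rw [e2, e1]; ring
  have hc1 : c = 1 := by
    have h3 : (c - 1) * (c ^ 2 + c + 1) = 0 := by
      have : c * ((c - 1) * (c ^ 2 + c + 1)) = 0 := by linear_combination -hc4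
      exact (mul_eq_zero.1 this).resolve_left hcpos.ne'
    have h4 : c ^ 2 + c + 1 ≠ 0 := by positivity
    exact sub_eq_zero.1 ((mul_eq_zero.1 h3).resolve_right h4)
  rw [hcK, hc1, one_mul]

/-! ### Vector algebra -/

theorem dotProduct_three {R : Type*} [CommRing R] (u v : Fin 3 → R) :
    u ⬝ᵥ v = u 0 * v 0 + u 1 * v 1 + u 2 * v 2 := by
  simp [dotProduct, Fin.sum_univ_three]

theorem cross_zero_apply {R : Type*} [CommRing R] (u v : Fin 3 → R) :
    crossProduct u v 0 = u 1 * v 2 - u 2 * v 1 := by simp [cross_apply]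

theorem cross_one_apply {R : Type*} [CommRing R] (u v : Fin 3 → R) :
    crossProduct u v 1 = u 2 * v 0 - u 0 * v 2 := by simp [cross_apply]

theorem cross_two_apply {R : Type*} [CommRing R] (u v : Fin 3 → R) :
    crossProduct u v 2 = u 0 * v 1 - u 1 * v 0 := by simp [cross_apply]

theorem det_of_three {R : Type*} [CommRing R] (u v w : Fin 3 → R) :
    Matrix.det (Matrix.of ![u, v, w]) = u ⬝ᵥ crossProduct v w := by
  rw [Matrix.det_fin_three, dotProduct_three, cross_zero_apply, cross_one_apply, cross_two_apply]
  simp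
  ring

theorem cross_cross_right {R : Type*} [CommRing R] (u v w : Fin 3 → R) :
    crossProduct u (crossProduct v w) = (u ⬝ᵥ w) • v - (u ⬝ᵥ v) • w := by
  ext i
  fin_cases i <;>
  simp only [Fin.zero_eta, Fin.mk_one, Fin.reduceFinMk, cross_zero_apply, cross_one_apply,
    cross_two_apply, dotProduct_three, Pi.sub_apply, Pi.smul_apply, smul_eq_mul] <;> ring

theorem cross_cross_left {R : Type*} [CommRing R] (u v w : Fin 3 → R) :
    crossProduct (crossProduct u v) w = (u ⬝ᵥ w) • v - (v ⬝ᵥ w) • u := by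
  ext i
  fin_cases i <;>
  simp only [Fin.zero_eta, Fin.mk_one, Fin.reduceFinMk, cross_zero_apply, cross_one_apply,
    cross_two_apply, dotProduct_three, Pi.sub_apply, Pi.smul_apply, smul_eq_mul] <;> ring

/-- Cramer's rule. With determinant 1 it gives integral coordinates of δ in the basis (η, ε, γ). -/
theorem det_smul_eq {R : Type*} [CommRing R] (η ε γ δ : Fin 3 → R) :
    (η ⬝ᵥ crossProduct ε γ) • δ = (δ ⬝ᵥ crossProduct ε γ) • η +
      (η ⬝ᵥ crossProduct δ γ) • ε + (η ⬝ᵥ crossProduct ε δ) • γ := by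
  ext i
  fin_cases i <;>
  simp only [Fin.zero_eta, Fin.mk_one, Fin.reduceFinMk, cross_zero_apply, cross_one_apply,
    cross_two_apply, dotProduct_three, Pi.add_apply, Pi.smul_apply, smul_eq_mul] <;> ring

theorem cross_vecMul (g : Matrix.SpecialLinearGroup (Fin 3) ℤ) (u v : Fin 3 → ℤ) :
    crossProduct (u ᵥ* g.1) (v ᵥ* g.1) = (g⁻¹).1 *ᵥ crossProduct u v := by
  rw [Matrix.SpecialLinearGroup.coe_inv, Matrix.adjugate_fin_three]
  ext i
  fin_cases i <;>
  simp only [Fin.zero_eta, Fin.mk_one, Fin.reduceFinMk, cross_zero_apply, cross_one_apply,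
    cross_two_apply, Matrix.vecMul, Matrix.mulVec, dotProduct_three, Matrix.of_apply,
    Matrix.cons_val', Matrix.cons_val_zero, Matrix.cons_val_one, Matrix.cons_val,
    Matrix.cons_val_fin_one] <;> ring

theorem cross_mulVec (g : Matrix.SpecialLinearGroup (Fin 3) ℤ) (u v : Fin 3 → ℤ) :
    crossProduct (g.1 *ᵥ u) (g.1 *ᵥ v) = crossProduct u v ᵥ* (g⁻¹).1 := by
  rw [Matrix.SpecialLinearGroup.coe_inv, Matrix.adjugate_fin_three]
  ext i
  fin_cases i <;>
  simp only [Fin.zero_eta, Fin.mk_one, Fin.reduceFinMk, cross_zero_apply, cross_one_apply,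
    cross_two_apply, Matrix.vecMul, Matrix.mulVec, dotProduct_three, Matrix.of_apply,
    Matrix.cons_val', Matrix.cons_val_zero, Matrix.cons_val_one, Matrix.cons_val,
    Matrix.cons_val_fin_one] <;> ring

theorem vecMul_inv_dotProduct_mulVec (g : Matrix.SpecialLinearGroup (Fin 3) ℤ)
    (u v : Fin 3 → ℤ) : (u ᵥ* (g⁻¹).1) ⬝ᵥ (g.1 *ᵥ v) = u ⬝ᵥ v := by
  rw [← Matrix.dotProduct_mulVec, Matrix.mulVec_mulVec, ← Matrix.SpecialLinearGroup.coe_mul]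
  simp

/-! ### The values of the linear forms -/

theorem ev_eq (δ : DualLat) (x : Fin 3 → ℂ) : ev δ x = δ 0 * x 0 + δ 1 * x 1 + δ 2 * x 2 := by
  simp [ev, Fin.sum_univ_three]

theorem ev_neg (δ : DualLat) (x : Fin 3 → ℂ) : ev (-δ) x = -ev δ x := by
  simp only [ev_eq, Pi.neg_apply, Int.cast_neg]; ring

theorem ev_sub (δ ε : DualLat) (x : Fin 3 → ℂ) : ev (δ - ε) x = ev δ x - ev ε x := by
  simp only [ev_eq, Pi.sub_apply, Int.cast_sub]; ring

theorem ev_zsmul (k : ℤ) (δ : DualLat) (x : Fin 3 → ℂ) : ev (k • δ) x = k * ev δ x := by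
  simp only [ev_eq, Pi.smul_apply, smul_eq_mul, Int.cast_mul]; ring

theorem ev_zero (x : Fin 3 → ℂ) : ev 0 x = 0 := by simp [ev_eq]

theorem ev_vecMul_inv (δ : DualLat) (g : Matrix.SpecialLinearGroup (Fin 3) ℤ) (x : Fin 3 → ℂ) :
    ev (δ ᵥ* (g⁻¹).1) (actC g x) = ev δ x := by
  rw [ev_vecMul, ← actC_mul, inv_mul_cancel, actC_one]

/-- The value of the vector `Im x × Re x` on the integral vector `a`. -/
def nuv (a : Lat) (x : Fin 3 → ℂ) : ℝ :=
  a 0 * ((x 1).im * (x 2).re - (x 2).im * (x 1).re) +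
  a 1 * ((x 2).im * (x 0).re - (x 0).im * (x 2).re) +
  a 2 * ((x 0).im * (x 1).re - (x 1).im * (x 0).re)

/-- All positivity conditions become values of one real linear form, that of Im x × Re x, on cross
products. -/
theorem im_ev_mul_conj (α β : DualLat) (x : Fin 3 → ℂ) :
    (ev α x * star (ev β x)).im = nuv (crossProduct α β) x := by
  simp only [ev_eq, nuv, cross_zero_apply, cross_one_apply, cross_two_apply, Complex.star_def]
  simp
  ring

theorem nuv_zsmul (k : ℤ) (a : Lat) (x : Fin 3 → ℂ) : nuv (k • a) x = k * nuv a x := by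
  simp [nuv]; ring

theorem nuv_sub (a b : Lat) (x : Fin 3 → ℂ) : nuv (a - b) x = nuv a x - nuv b x := by
  simp [nuv]; ring

theorem im_div_eq (z w : ℂ) : (z / w).im = (z * star w).im / Complex.normSq w := by
  rw [Complex.div_im, Complex.star_def, Complex.mul_im, Complex.conj_re, Complex.conj_im]
  ring

theorem im_ev_div (α β : DualLat) (x : Fin 3 → ℂ) :
    (ev α x / ev β x).im = nuv (crossProduct α β) x / Complex.normSq (ev β x) := by
  rw [im_div_eq, im_ev_mul_conj]

theorem nuv_mulVec (g : Matrix.SpecialLinearGroup (Fin 3) ℤ) (a : Lat) (x : Fin 3 → ℂ)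
    {α β : DualLat} (h : crossProduct α β = a) : nuv (g.1 *ᵥ a) (actC g x) = nuv a x := by
  have h2 := cross_vecMul g⁻¹ α β
  rw [inv_inv, h] at h2
  rw [← h2, ← im_ev_mul_conj, ev_vecMul_inv, ev_vecMul_inv, im_ev_mul_conj, h]

theorem nuv_smul (a : Lat) (t : ℂ) (x : Fin 3 → ℂ) :
    nuv a (t • x) = Complex.normSq t * nuv a x := by
  simp [nuv, Complex.normSq_apply]; ring

theorem continuous_nuv (a : Lat) : Continuous (nuv a) := by
  unfold nuv
  fun_prop

namespace Framing

variable (f : Framing) (a : Prim)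

theorem det_eq_one : Matrix.det (Matrix.of fun i => f.basis a i) = 1 := by
  have h1 : IsUnit (Matrix.det (Matrix.of fun i => f.basis a i)) := by
    have h := (Pi.basisFun ℤ (Fin 3)).isUnit_det (f.basis a)
    rw [Pi.basisFun_det] at h
    exact h
  rw [Int.isUnit_iff] at h1
  have h2 := f.oriented a
  rcases h1 with h | h
  · exact h
  · omega

theorem dotProduct_cross : f.basis a 0 ⬝ᵥ crossProduct (f.basis a 1) (f.basis a 2) = 1 := by
  rw [← f.det_eq_one a, ← det_of_three]
  congr 1
  ext i j
  fin_cases i <;> rfl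

/-- Both sides have the same pairing with the three vectors of the basis, whose matrix is
invertible. -/
theorem cross_eq : crossProduct (f.basis a 1) (f.basis a 2) = a.1 := by
  rw [← sub_eq_zero]
  refine Matrix.eq_zero_of_mulVec_eq_zero (M := Matrix.of fun i => f.basis a i)
    (by rw [f.det_eq_one a]; exact one_ne_zero) ?_
  ext i
  have h0 := f.dotProduct_cross a
  have h1 := f.first a
  have h2 := f.second a
  have h3 := f.third a
  have h4 := dot_self_cross (f.basis a 1) (f.basis a 2)
  have h5 := dot_cross_self (f.basis a 1) (f.basis a 2)
  fin_cases i <;> simp [Matrix.mulVec, dotProduct_sub, *]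

end Framing

theorem evQ_mul_conj (α β : Fin 3 → ℚ) (x : Fin 3 → ℂ) :
    (evQ α x * star (evQ β x)).im =
      (crossProduct α β 0 : ℝ) * ((x 1).im * (x 2).re - (x 2).im * (x 1).re) +
      (crossProduct α β 1 : ℝ) * ((x 2).im * (x 0).re - (x 0).im * (x 2).re) +
      (crossProduct α β 2 : ℝ) * ((x 0).im * (x 1).re - (x 1).im * (x 0).re) := by
  simp only [evQ, Fin.sum_univ_three, cross_zero_apply, cross_one_apply, cross_two_apply,
    Complex.star_def]
  simp
  ring

/-- For every oriented basis (α, β) of H(a) the vector α × β is a positive multiple of a; for the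
basis given by the framing it is a itself. -/
theorem mem_UPlus_iff (f : Framing) (a : Prim) (x : Fin 3 → ℂ) :
    x ∈ UPlus a.1 ↔ 0 < nuv a.1 x := by
  constructor
  · rintro ⟨α, β, ⟨hα, hβ, -, hor⟩, hpos⟩
    set A : Fin 3 → ℚ := fun i => (a.1 i : ℚ) with hA
    have hA0 : 0 < A ⬝ᵥ A := by
      have h0 : 0 ≤ A ⬝ᵥ A := by
        rw [dotProduct_three]; nlinarith [sq_nonneg (A 0), sq_nonneg (A 1), sq_nonneg (A 2)]
      refine h0.lt_of_ne fun h => ?_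
      have h1 : A = 0 := dotProduct_self_eq_zero.1 h.symm
      have h2 : a.1 = 0 := by
        ext i; have := congrFun h1 i; simpa [hA] using this
      have := f.first a
      rw [h2] at this
      simp at this
    -- The orientation condition is tested on the form with the coordinates of a, whose value at a
    -- is the positive number a · a.
    have h1 := hor A hA0
    have h2 : A ⬝ᵥ crossProduct α β = Matrix.det (Matrix.of ![α, β, A]) := by
      rw [det_of_three, triple_product_permutation α β A,
        triple_product_permutation β A α]
    rw [← h2] at h1
    have h3 : (A ⬝ᵥ A) • crossProduct α β = (A ⬝ᵥ crossProduct α β) • A := by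
      have h4 := cross_cross_left α β A
      rw [hα, hβ] at h4
      have h5 := cross_cross_right A (crossProduct α β) A
      rw [h4] at h5
      simp only [zero_smul, sub_zero, map_zero] at h5
      exact sub_eq_zero.1 h5.symm
    have h6 : ∀ i, (crossProduct α β i : ℝ) = ((A ⬝ᵥ crossProduct α β / A ⬝ᵥ A : ℚ) : ℝ) * a.1 i := by
      intro i
      have h7 := congrFun h3 i
      simp only [Pi.smul_apply, smul_eq_mul] at h7
      have h8 : crossProduct α β i = A ⬝ᵥ crossProduct α β / A ⬝ᵥ A * A i := by
        field_simp
        linarith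
      rw [h8]
      push_cast
      simp [hA]
    rw [evQ_mul_conj, h6, h6, h6] at hpos
    have h9 : (0 : ℝ) < ((A ⬝ᵥ crossProduct α β / A ⬝ᵥ A : ℚ) : ℝ) := by
      exact_mod_cast div_pos h1 hA0
    refine pos_of_mul_pos_right (a := ((A ⬝ᵥ crossProduct α β / A ⬝ᵥ A : ℚ) : ℝ)) ?_ h9.le
    rw [nuv]
    linarith
  · intro hx
    set α : Fin 3 → ℚ := fun i => (f.basis a 1 i : ℚ) with hα
    set β : Fin 3 → ℚ := fun i => (f.basis a 2 i : ℚ) with hβ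
    have hcr : crossProduct α β = fun i => (a.1 i : ℚ) := by
      rw [← f.cross_eq a]
      ext i
      fin_cases i <;>
      simp only [Fin.zero_eta, Fin.mk_one, Fin.reduceFinMk, cross_zero_apply, cross_one_apply,
        cross_two_apply, hα, hβ] <;> push_cast <;> rfl
    have hdot : ∀ δ : Lat, (fun i => (δ i : ℚ)) ⬝ᵥ (fun i => (a.1 i : ℚ)) = ((δ ⬝ᵥ a.1 : ℤ) : ℚ) := by
      intro δ
      simp only [dotProduct_three]; push_cast; rfl
    refine ⟨α, β, ⟨?_, ?_, ?_, ?_⟩, ?_⟩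
    · rw [hα, hdot, f.second a]; simp
    · rw [hβ, hdot, f.third a]; simp
    · rw [LinearIndependent.pair_iff]
      intro s t hst
      have h1 : s • crossProduct α β = 0 := by
        have := congrArg (fun v => crossProduct v β) hst
        simpa using this
      have h2 : t • crossProduct α β = 0 := by
        have := congrArg (fun v => crossProduct α v) hst
        simpa using this
      have hne : crossProduct α β ≠ 0 := by
        rw [hcr]
        intro h
        have h2 : a.1 = 0 := by
          ext i; have := congrFun h i; simpa using this
        have := f.first a
        rw [h2] at this
        simp at this
      exact ⟨(smul_eq_zero.1 h1).resolve_right hne, (smul_eq_zero.1 h2).resolve_right hne⟩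
    · intro δ hδ
      rw [det_of_three, triple_product_permutation α β δ, triple_product_permutation β δ α, hcr]
      exact hδ
    · rw [evQ_mul_conj, hcr]
      rw [nuv] at hx
      simpa using hx

/-! ### The theta norm of a lattice -/

/-- The theta norm of the lattice spanned by the oriented basis `(u₁, u₂)` of `ℂ`. -/
def latNorm (w u₁ u₂ : ℂ) : ℝ := thetaNorm (w / u₂) (u₁ / u₂)

theorem div_im_pos_iff {u₁ u₂ : ℂ} : 0 < (u₁ / u₂).im ↔ 0 < (u₁ * star u₂).im := by
  rw [im_div_eq]
  by_cases h : u₂ = 0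
  · simp [h]
  · have := Complex.normSq_pos.2 h
    exact ⟨fun h1 => by simpa [this.ne'] using mul_pos h1 this, fun h1 => div_pos h1 this⟩

theorem im_mul_star_transform (u₁ u₂ : ℂ) (p q r t : ℤ) :
    ((p * u₁ + q * u₂) * star (r * u₁ + t * u₂)).im =
      ((p * t - q * r : ℤ) : ℝ) * (u₁ * star u₂).im := by
  simp
  ring

/-- It suffices to treat the generators: S is `thetaNorm_neg_inv` and T is
`thetaNorm_add_one_right`. The quantification over all oriented bases lets the induction pass
through products and inverses. -/
theorem latNorm_transform_aux (M : Matrix.SpecialLinearGroup (Fin 2) ℤ) :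
    ∀ w u₁ u₂ : ℂ, 0 < (u₁ * star u₂).im →
      latNorm w (M 0 0 * u₁ + M 0 1 * u₂) (M 1 0 * u₁ + M 1 1 * u₂) = latNorm w u₁ u₂ := by
  have hpos : ∀ (M : Matrix.SpecialLinearGroup (Fin 2) ℤ) (u₁ u₂ : ℂ), 0 < (u₁ * star u₂).im →
      0 < ((M 0 0 * u₁ + M 0 1 * u₂) * star (M 1 0 * u₁ + M 1 1 * u₂)).im := by
    intro M u₁ u₂ h
    have hdet := M.det_coe
    rw [Matrix.det_fin_two] at hdet
    rw [im_mul_star_transform, hdet]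
    simpa using h
  have hM : M ∈ Subgroup.closure {ModularGroup.S, ModularGroup.T} := by
    rw [SpecialLinearGroup.SL2Z_generators]; trivial
  induction hM using Subgroup.closure_induction with
  | mem M hM =>
    intro w u₁ u₂ h
    have h' := div_im_pos_iff.2 h
    have hu₂ : u₂ ≠ 0 := by rintro rfl; simp at h
    have hu₁ : u₁ ≠ 0 := by rintro rfl; simp at h
    rcases hM with rfl | rfl
    · simp only [ModularGroup.S, latNorm]
      simp
      rw [← thetaNorm_neg_inv (w / u₂) h']
      congr 1 <;> field_simp
    · simp only [ModularGroup.T, latNorm]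
      simp
      rw [← thetaNorm_add_one_right (w / u₂) h']
      congr 1
      field_simp
  | one => intro w u₁ u₂ h; simp
  | mul M N _ _ hM hN =>
    intro w u₁ u₂ h
    rw [← hN w u₁ u₂ h, ← hM w _ _ (hpos N u₁ u₂ h)]
    simp [Matrix.mul_apply, Fin.sum_univ_two]
    congr 1 <;> ring
  | inv M _ hM =>
    intro w u₁ u₂ h
    rw [← hM w _ _ (hpos M⁻¹ u₁ u₂ h)]
    have e := congrArg Subtype.val (mul_inv_cancel M)
    have e00 := congrFun (congrFun e 0) 0
    have e01 := congrFun (congrFun e 0) 1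
    have e10 := congrFun (congrFun e 1) 0
    have e11 := congrFun (congrFun e 1) 1
    simp only [Matrix.SpecialLinearGroup.coe_mul, Matrix.mul_apply, Fin.sum_univ_two,
      Matrix.SpecialLinearGroup.coe_one, Matrix.one_apply] at e00 e01 e10 e11
    have c00 := congrArg (Int.cast : ℤ → ℂ) e00
    have c01 := congrArg (Int.cast : ℤ → ℂ) e01
    have c10 := congrArg (Int.cast : ℤ → ℂ) e10
    have c11 := congrArg (Int.cast : ℤ → ℂ) e11
    push_cast at c00 c01 c10 c11
    simp at c00 c01 c10 c11
    congr 1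
    · simp
      linear_combination u₁ * c00 + u₂ * c01
    · simp
      linear_combination u₁ * c10 + u₂ * c11

theorem latNorm_transform (w : ℂ) {u₁ u₂ : ℂ} (h : 0 < (u₁ * star u₂).im) {p q r t : ℤ}
    (hdet : p * t - q * r = 1) : latNorm w (p * u₁ + q * u₂) (r * u₁ + t * u₂) = latNorm w u₁ u₂ := by
  have := latNorm_transform_aux ⟨!![p, q; r, t], by rw [Matrix.det_fin_two]; simpa using hdet⟩
    w u₁ u₂ h
  simpa using this

theorem latNorm_add (w : ℂ) {u₁ u₂ : ℂ} (h : 0 < (u₁ * star u₂).im) (j m : ℤ) :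
    latNorm (w + (j * u₁ + m * u₂)) u₁ u₂ = latNorm w u₁ u₂ := by
  have hu₂ : u₂ ≠ 0 := by rintro rfl; simp at h
  rw [latNorm, latNorm, ← thetaNorm_add_lattice (w / u₂) (div_im_pos_iff.2 h) j m]
  congr 1
  field_simp

/-- The theta norm attached to the coset `δ(a) = j` of `H(a)`. -/
def lineNorm (f : Framing) (a : Prim) (j : ℤ) (w : ℂ) (x : Fin 3 → ℂ) : ℝ :=
  latNorm (w + j * ev (f.basis a 0) x) (ev (f.basis a 1) x) (ev (f.basis a 2) x)

theorem exists_eq_of_dotProduct_eq_zero (f : Framing) (a : Prim) {δ : DualLat}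
    (h : δ ⬝ᵥ a.1 = 0) : ∃ p q : ℤ, δ = p • f.basis a 1 + q • f.basis a 2 := by
  have h1 := det_smul_eq (f.basis a 0) (f.basis a 1) (f.basis a 2) δ
  rw [f.dotProduct_cross a, f.cross_eq a, h, one_smul, zero_smul, zero_add] at h1
  exact ⟨_, _, h1⟩

/-- Any ε, γ with ε × γ = a form an oriented basis of the lattice of forms vanishing at a, hence
differ from the framing by SL₂(ℤ); and δ is determined by δ(a) up to this lattice, whose values are
periods. In particular the norm does not depend on the framing. -/
theorem lineNorm_eq (f : Framing) (a : Prim) {ε γ δ : DualLat} (h : crossProduct ε γ = a.1)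
    (w : ℂ) {x : Fin 3 → ℂ} (hx : 0 < nuv a.1 x) :
    lineNorm f a (δ ⬝ᵥ a.1) w x = latNorm (w + ev δ x) (ev ε x) (ev γ x) := by
  have hεa : ε ⬝ᵥ a.1 = 0 := by rw [← h]; exact dot_self_cross _ _
  have hγa : γ ⬝ᵥ a.1 = 0 := by rw [← h]; exact dot_cross_self _ _
  obtain ⟨p, q, hε⟩ := exists_eq_of_dotProduct_eq_zero f a hεa
  obtain ⟨r, t, hγ⟩ := exists_eq_of_dotProduct_eq_zero f a hγa
  obtain ⟨j, m, hδ⟩ := exists_eq_of_dotProduct_eq_zero f a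
    (δ := δ - (δ ⬝ᵥ a.1) • f.basis a 0) (by rw [sub_dotProduct, smul_dotProduct, f.first a]; simp)
  have hpos : 0 < (ev (f.basis a 1) x * star (ev (f.basis a 2) x)).im := by
    rw [im_ev_mul_conj, f.cross_eq a]; exact hx
  have hdet : p * t - q * r = 1 := by
    have h1 : crossProduct ε γ = (p * t - q * r) • a.1 := by
      rw [hε, hγ, ← f.cross_eq a]
      ext i
      fin_cases i <;>
      simp only [Fin.zero_eta, Fin.mk_one, Fin.reduceFinMk, cross_zero_apply, cross_one_apply,
        cross_two_apply, Pi.add_apply, Pi.smul_apply, smul_eq_mul] <;> ring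
    have h2 : f.basis a 0 ⬝ᵥ crossProduct ε γ = 1 := by rw [h]; exact f.first a
    rw [h1, dotProduct_smul, f.first a] at h2
    simpa using h2
  have hev : ev δ x = (δ ⬝ᵥ a.1 : ℤ) * ev (f.basis a 0) x +
      (j * ev (f.basis a 1) x + m * ev (f.basis a 2) x) := by
    rw [← ev_zsmul, ← ev_zsmul, ← ev_zsmul, ← ev_add, ← ev_add, ← hδ]; congr 1; abel
  rw [hε, hγ, ev_add, ev_add, ev_zsmul, ev_zsmul, ev_zsmul, ev_zsmul,
    latNorm_transform _ hpos hdet, hev, ← add_assoc, latNorm_add _ hpos]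
  rfl

/-! ### Wedges -/

/-- `γ` is the direction vector of the wedge of `a` and `b`, `s` is its modulus,
`(η, ε, γ)` and `(η', ε', -γ)` are oriented bases of `Λ^∨` adapted to `a` and to `b`. -/
structure IsWedge (a b γ ε ε' η η' : DualLat) (s : ℤ) : Prop where
  crossA : crossProduct ε γ = a
  crossB : crossProduct ε' (-γ) = b
  pos : 0 < s
  smul_eq : s • γ = crossProduct a b
  dotA : η ⬝ᵥ a = 1
  dotB : η' ⬝ᵥ b = 1

namespace IsWedge

variable {a b γ ε ε' η η' : DualLat} {s : ℤ} (h : IsWedge a b γ ε ε' η η' s)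

include h

theorem symm : IsWedge b a (-γ) ε' ε η' η s where
  crossA := h.crossB
  crossB := by rw [neg_neg]; exact h.crossA
  pos := h.pos
  smul_eq := by rw [smul_neg, h.smul_eq, cross_anticomm]
  dotA := h.dotB
  dotB := h.dotA

theorem dir_dot : γ ⬝ᵥ a = 0 := by rw [← h.crossA]; exact dot_cross_self _ _

theorem dir_dot' : γ ⬝ᵥ b = 0 := by simpa using h.symm.dir_dot

theorem eps_dot : ε ⬝ᵥ a = 0 := by rw [← h.crossA]; exact dot_self_cross _ _

theorem left_ne_zero : a ≠ 0 := by
  intro h0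
  have := h.dotA
  rw [h0] at this
  simp at this

theorem dir_ne_zero : γ ≠ 0 := by
  intro h0
  apply h.left_ne_zero
  rw [← h.crossA, h0, map_zero]

/-- Expand a × b = (ε × γ) × b. Moving by ε within the kernel of a changes the value at b by the
modulus s, which is why windows of length s occur below. -/
theorem eps_dot' : ε ⬝ᵥ b = s := by
  have h1 := h.smul_eq
  nth_rewrite 1 [← h.crossA] at h1
  rw [cross_cross_left, h.dir_dot', zero_smul, sub_zero, ← sub_eq_zero, ← sub_smul] at h1
  have := (smul_eq_zero.1 h1).resolve_right h.dir_ne_zero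
  omega

theorem exists_eq (δ : DualLat) : ∃ p t : ℤ, δ = (δ ⬝ᵥ a) • η + p • ε + t • γ := by
  have h1 := det_smul_eq η ε γ δ
  rw [h.crossA, h.dotA, one_smul] at h1
  exact ⟨_, _, h1⟩

/-- Together with `window_unique`: each row δ(a) = i meets a window of length s for δ(b) in exactly
one class modulo γ. The witness is i η reduced by a multiple of ε, by division with remainder. -/
theorem exists_window (i k : ℤ) : ∃ δ : DualLat, δ ⬝ᵥ a = i ∧ k ≤ δ ⬝ᵥ b ∧ δ ⬝ᵥ b < k + s := by
  refine ⟨i • η - ((i * (η ⬝ᵥ b) - k) / s) • ε, ?_, ?_⟩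
  · rw [sub_dotProduct, smul_dotProduct, smul_dotProduct, h.dotA, h.eps_dot]; simp
  · rw [sub_dotProduct, smul_dotProduct, smul_dotProduct, h.eps_dot']
    simp only [smul_eq_mul]
    have h1 := Int.emod_nonneg (i * (η ⬝ᵥ b) - k) h.pos.ne'
    have h2 := Int.emod_lt_of_pos (i * (η ⬝ᵥ b) - k) h.pos
    have h3 := Int.mul_ediv_add_emod (i * (η ⬝ᵥ b) - k) s
    constructor <;> linarith [mul_comm s ((i * (η ⬝ᵥ b) - k) / s)]

theorem exists_eq_add_of_eq {δ δ' : DualLat} (ha : δ ⬝ᵥ a = δ' ⬝ᵥ a) :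
    ∃ p t : ℤ, δ = δ' + p • ε + t • γ ∧ δ ⬝ᵥ b = δ' ⬝ᵥ b + p * s := by
  obtain ⟨p, t, hpt⟩ := h.exists_eq (δ - δ')
  rw [sub_dotProduct, ha, sub_self, zero_smul, zero_add, sub_eq_iff_eq_add] at hpt
  refine ⟨p, t, by rw [hpt]; abel, ?_⟩
  rw [hpt, add_dotProduct, add_dotProduct, smul_dotProduct, smul_dotProduct, h.eps_dot',
    h.dir_dot']
  simp
  ring

theorem window_unique {δ δ' : DualLat} {k : ℤ} (ha : δ ⬝ᵥ a = δ' ⬝ᵥ a) (h1 : k ≤ δ ⬝ᵥ b)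
    (h2 : δ ⬝ᵥ b < k + s) (h3 : k ≤ δ' ⬝ᵥ b) (h4 : δ' ⬝ᵥ b < k + s) :
    ∃ t : ℤ, δ = δ' + t • γ := by
  obtain ⟨p, t, e1, e2⟩ := h.exists_eq_add_of_eq ha
  have hs := h.pos
  have hp : p = 0 := by
    by_contra hne
    rcases lt_or_gt_of_ne hne with hp | hp <;> nlinarith
  exact ⟨t, by rw [e1, hp]; simp⟩

theorem eq_of_dot_eq {δ δ' : DualLat} (ha : δ ⬝ᵥ a = δ' ⬝ᵥ a) (hb : δ ⬝ᵥ b = δ' ⬝ᵥ b) :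
    ∃ t : ℤ, δ = δ' + t • γ :=
  h.window_unique (k := δ ⬝ᵥ b) ha le_rfl (by linarith [h.pos]) hb.le (by linarith [h.pos])

theorem dot_add_zsmul (δ : DualLat) (k : ℤ) : (δ + k • γ) ⬝ᵥ a = δ ⬝ᵥ a := by
  rw [add_dotProduct, smul_dotProduct, h.dir_dot]; simp

theorem dot_add_zsmul' (δ : DualLat) (k : ℤ) : (δ + k • γ) ⬝ᵥ b = δ ⬝ᵥ b := by
  rw [add_dotProduct, smul_dotProduct, h.dir_dot']; simp

variable {x : Fin 3 → ℂ}

theorem ev_ne_zero (hx : 0 < nuv a x) : ev γ x ≠ 0 := by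
  rw [← h.crossA, ← im_ev_mul_conj] at hx
  intro h0
  rw [h0] at hx
  simp at hx

theorem im_eps_div (x : Fin 3 → ℂ) : (ev ε x / ev γ x).im = nuv a x / Complex.normSq (ev γ x) := by
  rw [im_ev_div, h.crossA]

theorem im_eps_div_pos (hx : 0 < nuv a x) : 0 < (ev ε x / ev γ x).im := by
  rw [h.im_eps_div]
  exact div_pos hx (Complex.normSq_pos.2 (h.ev_ne_zero hx))

/-- From s (δ × γ) = δ × (a × b). On a quadrant, where δ(a) is bounded below and δ(b) above, the
imaginary part tends to -∞ linearly in both values; the convergence of the wedge products rests on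
this. -/
theorem im_ev_div_dir (δ : DualLat) (x : Fin 3 → ℂ) : (ev δ x / ev γ x).im =
    (δ ⬝ᵥ b : ℤ) * (nuv a x / (s * Complex.normSq (ev γ x))) -
      (δ ⬝ᵥ a : ℤ) * (nuv b x / (s * Complex.normSq (ev γ x))) := by
  have h1 : s • crossProduct δ γ = (δ ⬝ᵥ b) • a - (δ ⬝ᵥ a) • b := by
    rw [← cross_cross_right, ← h.smul_eq]; exact (map_smul _ s γ).symm
  have h2 := congrArg (fun v => nuv v x) h1
  simp only [nuv_zsmul, nuv_sub] at h2
  have hs : (s : ℝ) ≠ 0 := by exact_mod_cast h.pos.ne'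
  rw [im_ev_div, show nuv (crossProduct δ γ) x = (s * nuv (crossProduct δ γ) x) / s by
    field_simp, h2]
  by_cases h0 : Complex.normSq (ev γ x) = 0
  · simp [h0]
  · field_simp

end IsWedge

/-! ### Products and sums over subsets of `Λ^∨ / ℤγ` -/

theorem mk_eq_mk_iff {γ δ δ' : DualLat} :
    (QuotientAddGroup.mk δ : Quo γ) = QuotientAddGroup.mk δ' ↔ ∃ k : ℤ, δ = δ' + k • γ := by
  rw [QuotientAddGroup.eq, AddSubgroup.mem_zmultiples_iff]
  constructor
  · rintro ⟨k, hk⟩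
    exact ⟨-k, by rw [neg_smul, hk]; abel⟩
  · rintro ⟨k, hk⟩
    exact ⟨-k, by rw [hk, neg_smul]; abel⟩

theorem exists_out_eq (γ δ : DualLat) :
    ∃ k : ℤ, Quotient.out (QuotientAddGroup.mk δ : Quo γ) = δ + k • γ :=
  mk_eq_mk_iff.1 (QuotientAddGroup.out_eq' (QuotientAddGroup.mk δ : Quo γ))

theorem out_mem_of_mem {γ : DualLat} {S : Set DualLat} (hS : ∀ δ ∈ S, ∀ k : ℤ, δ + k • γ ∈ S)
    {q : Quo γ} (hq : q ∈ modSet γ S) : Quotient.out q ∈ S := by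
  obtain ⟨δ, hδ, rfl⟩ := hq
  obtain ⟨k, hk⟩ := exists_out_eq γ δ
  rw [hk]
  exact hS δ hδ k

theorem exists_equiv_modSet {ι : Type*} {γ : DualLat} {S : Set DualLat} (e : ι → DualLat)
    (he : ∀ i, e i ∈ S) (hinj : ∀ i j, (∃ k : ℤ, e i = e j + k • γ) → i = j)
    (hsurj : ∀ δ ∈ S, ∃ i, ∃ k : ℤ, δ = e i + k • γ) :
    ∃ E : ι ≃ modSet γ S, ∀ i, (E i).1 = QuotientAddGroup.mk (e i) := by
  refine ⟨Equiv.ofBijective (fun i => ⟨QuotientAddGroup.mk (e i), e i, he i, rfl⟩) ⟨?_, ?_⟩,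
    fun i => rfl⟩
  · intro i j hij
    exact hinj i j (mk_eq_mk_iff.1 (congrArg Subtype.val hij))
  · rintro ⟨_, δ, hδ, rfl⟩
    obtain ⟨i, hi⟩ := hsurj δ hδ
    exact ⟨i, Subtype.ext (mk_eq_mk_iff.2 hi).symm⟩

/-- A product over classes may be computed with any system of representatives, since the factor is
invariant under γ and the representative chosen by `Quotient.out` differs by a multiple of γ. -/
theorem tprod_modSet_eq {ι : Type*} {γ : DualLat} {S : Set DualLat} {F : DualLat → ℂ}
    (hF : ∀ (δ : DualLat) (k : ℤ), F (δ + k • γ) = F δ) (e : ι → DualLat)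
    (he : ∀ i, e i ∈ S) (hinj : ∀ i j, (∃ k : ℤ, e i = e j + k • γ) → i = j)
    (hsurj : ∀ δ ∈ S, ∃ i, ∃ k : ℤ, δ = e i + k • γ) :
    ∏' q : modSet γ S, F (Quotient.out q.1) = ∏' i, F (e i) := by
  obtain ⟨E, hE⟩ := exists_equiv_modSet e he hinj hsurj
  rw [← E.tprod_eq]
  refine tprod_congr fun i => ?_
  obtain ⟨k, hk⟩ := exists_out_eq γ (e i)
  rw [hE, hk, hF]

theorem finsum_modSet_eq {ι : Type*} {γ : DualLat} {S : Set DualLat} {F : DualLat → ℝ}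
    (hF : ∀ (δ : DualLat) (k : ℤ), F (δ + k • γ) = F δ) (e : ι → DualLat)
    (he : ∀ i, e i ∈ S) (hinj : ∀ i j, (∃ k : ℤ, e i = e j + k • γ) → i = j)
    (hsurj : ∀ δ ∈ S, ∃ i, ∃ k : ℤ, δ = e i + k • γ) :
    ∑ᶠ q : modSet γ S, F (Quotient.out q.1) = ∑ᶠ i, F (e i) := by
  obtain ⟨E, hE⟩ := exists_equiv_modSet e he hinj hsurj
  rw [← finsum_comp_equiv E]
  refine finsum_congr fun i => ?_
  obtain ⟨k, hk⟩ := exists_out_eq γ (e i)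
  rw [hE, hk, hF]

/-- The conditions that a map of `Λ^∨` has to satisfy to induce a bijection from `S'/ℤγ'` to
`S/ℤγ`. -/
theorem modSet_transport {γ γ' : DualLat} {S S' : Set DualLat}
    (hS' : ∀ δ ∈ S', ∀ k : ℤ, δ + k • γ' ∈ S') (φ : DualLat → DualLat)
    (hφ : ∀ δ ∈ S', φ δ ∈ S)
    (hiff : ∀ δ δ', (∃ k : ℤ, φ δ = φ δ' + k • γ) ↔ ∃ k : ℤ, δ = δ' + k • γ')
    (hsurj : ∀ δ ∈ S, ∃ δ' ∈ S', δ = φ δ') :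
    (∀ q : modSet γ' S', φ (Quotient.out q.1) ∈ S) ∧
    (∀ q r : modSet γ' S', (∃ k : ℤ, φ (Quotient.out q.1) = φ (Quotient.out r.1) + k • γ) → q = r) ∧
    (∀ δ ∈ S, ∃ q : modSet γ' S', ∃ k : ℤ, δ = φ (Quotient.out q.1) + k • γ) := by
  refine ⟨fun q => hφ _ (out_mem_of_mem hS' q.2), fun q r h => ?_, fun δ hδ => ?_⟩
  · have := mk_eq_mk_iff.2 ((hiff _ _).1 h)
    rw [QuotientAddGroup.out_eq', QuotientAddGroup.out_eq'] at this
    exact Subtype.ext this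
  · obtain ⟨δ', hδ', rfl⟩ := hsurj δ hδ
    refine ⟨⟨QuotientAddGroup.mk δ', δ', hδ', rfl⟩, (hiff _ _).2 ?_⟩
    obtain ⟨k, hk⟩ := exists_out_eq γ' δ'
    exact ⟨-k, by simp only [hk]; simp⟩

/-- The set of the forms `δ` with `δ(a) ≥ i` and `δ(b) < k`. -/
def quadrant (a b : Lat) (i k : ℤ) : Set DualLat := {δ | i ≤ δ ⬝ᵥ a ∧ δ ⬝ᵥ b < k}

/-- A factor of the gamma function of a wedge. -/
def wedgeFactor (γ : DualLat) (w : ℂ) (x : Fin 3 → ℂ) (δ : DualLat) : ℂ :=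
  1 + -ee (-((ev δ x - w) / ev γ x))

theorem wedgeFactor_add {γ : DualLat} {x : Fin 3 → ℂ} (hγ : ev γ x ≠ 0) (w : ℂ) (δ : DualLat)
    (k : ℤ) : wedgeFactor γ w x (δ + k • γ) = wedgeFactor γ w x δ := by
  rw [wedgeFactor, wedgeFactor, ← ee_add_int _ k, ev_add, ev_zsmul]
  congr 3
  field_simp
  ring

/-- The product of the factors with `δ(a) ≥ i` and `δ(b) < k`. -/
def wedgeProd (a b γ : Lat) (i k : ℤ) (w : ℂ) (x : Fin 3 → ℂ) : ℂ :=
  ∏' q : modSet γ (quadrant a b i k), wedgeFactor γ w x (Quotient.out q.1)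

/-- The domain `{(w, x) | x ∈ U_a^+ ∩ U_b^+}`. -/
def wedgeDom (a b : Lat) : Set (ℂ × (Fin 3 → ℂ)) := {p | 0 < nuv a p.2 ∧ 0 < nuv b p.2}

theorem isOpen_wedgeDom (a b : Lat) : IsOpen (wedgeDom a b) :=
  (isOpen_lt continuous_const ((continuous_nuv a).comp continuous_snd)).inter
    (isOpen_lt continuous_const ((continuous_nuv b).comp continuous_snd))

theorem differentiable_ev (δ : DualLat) : Differentiable ℂ (ev δ) := by
  unfold ev; fun_prop

namespace IsWedge

variable {a b γ ε ε' η η' : DualLat} {s : ℤ} (h : IsWedge a b γ ε ε' η η' s)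

include h

theorem quadrant_add {i k : ℤ} : ∀ δ ∈ quadrant a b i k, ∀ n : ℤ, δ + n • γ ∈ quadrant a b i k := by
  intro δ hδ n
  rw [quadrant, mem_ofPred_eq, h.dot_add_zsmul, h.dot_add_zsmul']
  exact hδ

/-- The exponents δ(a) - i and k - 1 - δ(b) are nonnegative on the quadrant, so the terms are those
of a double geometric series. -/
theorem norm_factor_term {x : Fin 3 → ℂ} (w : ℂ) {i k : ℤ} {δ : DualLat}
    (hδ : δ ∈ quadrant a b i k) : ‖-ee (-((ev δ x - w) / ev γ x))‖ =
      Real.exp (2 * Real.pi * ((k - 1) * (nuv a x / (s * Complex.normSq (ev γ x))) -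
        i * (nuv b x / (s * Complex.normSq (ev γ x))) - (w / ev γ x).im)) *
      (Real.exp (-(2 * Real.pi * (nuv b x / (s * Complex.normSq (ev γ x))))) ^ (δ ⬝ᵥ a - i).toNat *
       Real.exp (-(2 * Real.pi * (nuv a x / (s * Complex.normSq (ev γ x))))) ^
        (k - 1 - δ ⬝ᵥ b).toNat) := by
  have h1 : (((δ ⬝ᵥ a - i).toNat : ℕ) : ℝ) = (δ ⬝ᵥ a : ℤ) - i := by
    have : (((δ ⬝ᵥ a - i).toNat : ℕ) : ℤ) = δ ⬝ᵥ a - i := Int.toNat_of_nonneg (by linarith [hδ.1])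
    rw [← Int.cast_natCast, this]; push_cast; rfl
  have h2 : (((k - 1 - δ ⬝ᵥ b).toNat : ℕ) : ℝ) = k - 1 - (δ ⬝ᵥ b : ℤ) := by
    have : (((k - 1 - δ ⬝ᵥ b).toNat : ℕ) : ℤ) = k - 1 - δ ⬝ᵥ b :=
      Int.toNat_of_nonneg (by have := hδ.2; omega)
    rw [← Int.cast_natCast, this]; push_cast; rfl
  rw [norm_neg, norm_ee, ← Real.exp_nat_mul, ← Real.exp_nat_mul, ← Real.exp_add, ← Real.exp_add,
    Complex.neg_im, sub_div, Complex.sub_im, h.im_ev_div_dir, h1, h2]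
  congr 1
  ring

/-- A class modulo γ is determined by the values at a and b (`eq_of_dot_eq`), so the sum is part of
a double geometric series. -/
theorem summable_bound (i k : ℤ) (C : ℝ) {r₁ r₂ : ℝ} (h₁ : 0 ≤ r₁) (h₁' : r₁ < 1) (h₂ : 0 ≤ r₂)
    (h₂' : r₂ < 1) : Summable fun q : modSet γ (quadrant a b i k) =>
      C * (r₁ ^ (Quotient.out q.1 ⬝ᵥ a - i).toNat * r₂ ^ (k - 1 - Quotient.out q.1 ⬝ᵥ b).toNat) := by
  refine Summable.mul_left _ ?_
  have hs := (summable_geometric_of_lt_one h₁ h₁').mul_of_nonneg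
    (summable_geometric_of_lt_one h₂ h₂') (fun n => pow_nonneg h₁ n) (fun n => pow_nonneg h₂ n)
  refine hs.comp_injective (i := fun q : modSet γ (quadrant a b i k) =>
    ((Quotient.out q.1 ⬝ᵥ a - i).toNat, (k - 1 - Quotient.out q.1 ⬝ᵥ b).toNat)) ?_
  intro q r hqr
  have hq := out_mem_of_mem h.quadrant_add q.2
  have hr := out_mem_of_mem h.quadrant_add r.2
  simp only [Prod.mk.injEq] at hqr
  have e1 : Quotient.out q.1 ⬝ᵥ a = Quotient.out r.1 ⬝ᵥ a := by
    have := hqr.1; have := hq.1; have := hr.1; omega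
  have e2 : Quotient.out q.1 ⬝ᵥ b = Quotient.out r.1 ⬝ᵥ b := by
    have := hqr.2; have := hq.2; have := hr.2; omega
  have := mk_eq_mk_iff.2 (h.eq_of_dot_eq e1 e2)
  rw [QuotientAddGroup.out_eq', QuotientAddGroup.out_eq'] at this
  exact Subtype.ext this

theorem div_pos_of {x : Fin 3 → ℂ} (hxa : 0 < nuv a x) (hxb : 0 < nuv b x) :
    0 < nuv a x / (s * Complex.normSq (ev γ x)) ∧ 0 < nuv b x / (s * Complex.normSq (ev γ x)) := by
  have hs : (0 : ℝ) < s := by exact_mod_cast h.pos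
  have := Complex.normSq_pos.2 (h.ev_ne_zero hxa)
  constructor <;> positivity

theorem summable_factor {x : Fin 3 → ℂ} (hxa : 0 < nuv a x) (hxb : 0 < nuv b x) (w : ℂ) (i k : ℤ) :
    Summable fun q : modSet γ (quadrant a b i k) =>
      ‖-ee (-((ev (Quotient.out q.1) x - w) / ev γ x))‖ := by
  obtain ⟨hT, hS⟩ := h.div_pos_of hxa hxb
  have hpi := Real.pi_pos
  refine (h.summable_bound i k _ (Real.exp_nonneg _) ?_ (Real.exp_nonneg _) ?_).congr
    fun q => (h.norm_factor_term w (out_mem_of_mem h.quadrant_add q.2)).symm <;>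
  · rw [Real.exp_lt_one_iff, neg_lt_zero]
    positivity

theorem multipliable_factor_subset {x : Fin 3 → ℂ} (hxa : 0 < nuv a x) (hxb : 0 < nuv b x) (w : ℂ)
    {i k : ℤ} {S : Set DualLat} (hS : S ⊆ quadrant a b i k) : Multipliable fun q : modSet γ S =>
      wedgeFactor γ w x (Quotient.out q.1) := by
  have hinj : Function.Injective fun q : modSet γ S =>
      (⟨q.1, image_mono hS q.2⟩ : modSet γ (quadrant a b i k)) := fun q r hqr =>
    Subtype.ext (congrArg (fun z => z.1) hqr)
  have key := (h.summable_factor hxa hxb w i k).comp_injective hinj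
  exact multipliable_one_add_of_summable
    (f := fun q : modSet γ S => -ee (-((ev (Quotient.out q.1) x - w) / ev γ x))) key

/-- Near a given point the decay rates stay above half of their values there and the constant stays
below its value plus one, which gives a common majorant. -/
theorem exists_summable_bound {x : Fin 3 → ℂ} (hxa : 0 < nuv a x) (hxb : 0 < nuv b x) (w : ℂ)
    (i k : ℤ) : ∃ u : modSet γ (quadrant a b i k) → ℝ, Summable u ∧
      ∀ᶠ p : ℂ × (Fin 3 → ℂ) in 𝓝 (w, x), ∀ q : modSet γ (quadrant a b i k),
        ‖-ee (-((ev (Quotient.out q.1) p.2 - p.1) / ev γ p.2))‖ ≤ u q := by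
  have hev : Continuous fun p : ℂ × (Fin 3 → ℂ) => ev γ p.2 :=
    ((differentiable_ev γ).comp differentiable_snd).continuous
  have hγ := h.ev_ne_zero hxa
  have hs : (0 : ℝ) < s := by exact_mod_cast h.pos
  obtain ⟨hT, hS⟩ := h.div_pos_of hxa hxb
  have hpi := Real.pi_pos
  have hcn : ∀ c : Lat, ContinuousAt (fun p : ℂ × (Fin 3 → ℂ) =>
      nuv c p.2 / (s * Complex.normSq (ev γ p.2))) (w, x) := by
    intro c
    refine ContinuousAt.div ((continuous_nuv c).comp continuous_snd).continuousAt ?_ ?_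
    · exact (continuous_const.mul (Complex.continuous_normSq.comp hev)).continuousAt
    · have := Complex.normSq_pos.2 hγ
      positivity
  have hcw : ContinuousAt (fun p : ℂ × (Fin 3 → ℂ) => (p.1 / ev γ p.2).im) (w, x) := by
    refine Complex.continuous_im.continuousAt.comp ?_
    exact continuousAt_fst.div hev.continuousAt hγ
  have e1 := (hcn a).eventually_const_lt (half_lt_self hT)
  have e2 := (hcn b).eventually_const_lt (half_lt_self hS)
  have e3 := (((continuousAt_const (y := (k : ℝ) - 1)).mul (hcn a)).sub
    ((continuousAt_const (y := (i : ℝ))).mul (hcn b)) |>.sub hcw).eventually_lt_const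
      (lt_add_one _)
  obtain ⟨M, hM⟩ : ∃ M, M = (k - 1) * (nuv a x / (s * Complex.normSq (ev γ x))) -
    i * (nuv b x / (s * Complex.normSq (ev γ x))) - (w / ev γ x).im + 1 := ⟨_, rfl⟩
  obtain ⟨T, hT2⟩ : ∃ T, T = nuv a x / (s * Complex.normSq (ev γ x)) / 2 := ⟨_, rfl⟩
  obtain ⟨S, hS2⟩ : ∃ S, S = nuv b x / (s * Complex.normSq (ev γ x)) / 2 := ⟨_, rfl⟩
  have hT3 : 0 < T := by rw [hT2]; positivity
  have hS3 : 0 < S := by rw [hS2]; positivity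
  rw [← hT2] at e1
  rw [← hS2] at e2
  refine ⟨_, h.summable_bound i k (Real.exp (2 * Real.pi * M))
    (r₁ := Real.exp (-(2 * Real.pi * S))) (r₂ := Real.exp (-(2 * Real.pi * T)))
    (Real.exp_nonneg _) (by rw [Real.exp_lt_one_iff, neg_lt_zero]; positivity)
    (Real.exp_nonneg _) (by rw [Real.exp_lt_one_iff, neg_lt_zero]; positivity), ?_⟩
  filter_upwards [e1, e2, e3] with p h1 h2 h3 q
  rw [h.norm_factor_term p.1 (out_mem_of_mem h.quadrant_add q.2)]
  have h3' := h3.le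
  gcongr
  exact h3'.trans_eq hM.symm

theorem differentiableOn_wedgeProd (i k : ℤ) :
    DifferentiableOn ℂ (fun p : ℂ × (Fin 3 → ℂ) => wedgeProd a b γ i k p.1 p.2) (wedgeDom a b) := by
  have hev : ∀ δ, Differentiable ℂ fun p : ℂ × (Fin 3 → ℂ) => ev δ p.2 := fun δ =>
    (differentiable_ev δ).comp differentiable_snd
  have key := differentiableOn_tprod_one_add (f := fun (q : modSet γ (quadrant a b i k))
    (p : ℂ × (Fin 3 → ℂ)) => -ee (-((ev (Quotient.out q.1) p.2 - p.1) / ev γ p.2)))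
    (isOpen_wedgeDom a b) (fun q p hp => by
      have h0 : DifferentiableAt ℂ (fun p : ℂ × (Fin 3 → ℂ) =>
          -((ev (Quotient.out q.1) p.2 - p.1) * (ev γ p.2)⁻¹)) p :=
        (((hev _ p).sub differentiableAt_fst).fun_mul
          (DifferentiableAt.fun_inv (hev γ p) (h.ev_ne_zero hp.1))).fun_neg
      simp only [← div_eq_mul_inv] at h0
      exact (DifferentiableAt.comp (g := ee) p (differentiable_ee _) h0).neg.differentiableWithinAt)
    (fun p hp => h.exists_summable_bound hp.1 hp.2 p.1 i k)
  exact key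

theorem wedgeProd_ne_zero {x : Fin 3 → ℂ} (hxa : 0 < nuv a x) (hxb : 0 < nuv b x) {w : ℂ}
    {i k : ℤ} (hw : ∀ δ ∈ quadrant a b i k, w ≠ ev δ x) : wedgeProd a b γ i k w x ≠ 0 := by
  refine tprod_one_add_ne_zero_of_summable (fun q hq => ?_) (h.summable_factor hxa hxb w i k)
  have hγ := h.ev_ne_zero hxa
  obtain ⟨m, hm⟩ := ee_eq_one_iff.1 (by linear_combination -hq :
    ee (-((ev (Quotient.out q.1) x - w) / ev γ x)) = 1)
  apply hw _ (h.quadrant_add _ (out_mem_of_mem h.quadrant_add q.2) m)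
  rw [ev_add, ev_zsmul]
  field_simp at hm
  linear_combination hm

/-- On this quadrant Im δ(x)/γ(x) < 0. Hence neither the numerator nor the denominator of Γ_{a,b}
vanishes at w = 0; the Čech relation uses 0 as its base point for this reason. -/
theorem ev_ne_zero_of_mem {x : Fin 3 → ℂ} (hxa : 0 < nuv a x) (hxb : 0 < nuv b x) {δ : DualLat}
    (hδ : δ ∈ quadrant a b 1 1) : 0 ≠ ev δ x := by
  intro h0
  have h1 := h.im_ev_div_dir δ x
  obtain ⟨hT, hS⟩ := h.div_pos_of hxa hxb
  rw [← h0, zero_div, Complex.zero_im] at h1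
  have h2 : (1 : ℝ) ≤ (δ ⬝ᵥ a : ℤ) := by exact_mod_cast hδ.1
  have h3 : ((δ ⬝ᵥ b : ℤ) : ℝ) ≤ 0 := by exact_mod_cast Int.lt_add_one_iff.1 hδ.2
  nlinarith [mul_nonneg (neg_nonneg.2 h3) hT.le, mul_le_mul_of_nonneg_right h2 hS.le]

theorem wedgeProd_split {x : Fin 3 → ℂ} (hxa : 0 < nuv a x) (hxb : 0 < nuv b x) (w : ℂ)
    {i k : ℤ} {A B : Set DualLat} (hAB : A ∪ B = quadrant a b i k)
    (hd : ∀ δ ∈ A, ∀ n : ℤ, δ + n • γ ∉ B) : wedgeProd a b γ i k w x =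
      (∏' q : modSet γ A, wedgeFactor γ w x (Quotient.out q.1)) *
      ∏' q : modSet γ B, wedgeFactor γ w x (Quotient.out q.1) := by
  have hu : modSet γ (quadrant a b i k) = modSet γ A ∪ modSet γ B := by
    rw [← hAB, modSet, image_union]; rfl
  have hdis : Disjoint (modSet γ A) (modSet γ B) := by
    rw [Set.disjoint_left]
    rintro _ ⟨δ, hδ, rfl⟩ ⟨δ', hδ', he⟩
    obtain ⟨n, hn⟩ := mk_eq_mk_iff.1 he
    rw [hn] at hδ'
    exact hd δ hδ n hδ'
  have := Multipliable.tprod_union_disjoint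
    (f := fun q : Quo γ => wedgeFactor γ w x (Quotient.out q)) hdis
    (h.multipliable_factor_subset hxa hxb w (hAB ▸ subset_union_left))
    (h.multipliable_factor_subset hxa hxb w (hAB ▸ subset_union_right))
  rw [wedgeProd, hu]
  exact this

/-! ### Shifts, translations and reflection of the wedge products -/

/-- Raising i by one removes the row δ(a) = i, which modulo γ is a half-line with step ε, so its
product is a q-Pochhammer symbol. -/
theorem wedgeProd_step_left {x : Fin 3 → ℂ} (hxa : 0 < nuv a x) (hxb : 0 < nuv b x) (w : ℂ)
    {i k : ℤ} {δ : DualLat} (hi : δ ⬝ᵥ a = i) (hk : k ≤ δ ⬝ᵥ b) (hk' : δ ⬝ᵥ b < k + s) :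
    wedgeProd a b γ i k w x = wedgeProd a b γ (i + 1) k w x *
      qPoch (ev ε x / ev γ x - (ev δ x - w) / ev γ x) (ev ε x / ev γ x) := by
  have hγ := h.ev_ne_zero hxa
  rw [h.wedgeProd_split hxa hxb w (A := quadrant a b (i + 1) k)
    (B := {δ | δ ⬝ᵥ a = i ∧ δ ⬝ᵥ b < k})]
  · congr 1
    -- The form δ lies in the first window outside the quadrant, so the row starts at δ - ε.
    rw [tprod_modSet_eq (wedgeFactor_add hγ w) (fun j : ℕ => δ - ((j : ℤ) + 1) • ε), qPoch]
    · refine tprod_congr fun j => ?_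
      rw [wedgeFactor, ev_sub, ev_zsmul]
      congr 3
      push_cast
      field_simp
      ring
    · intro j
      rw [mem_ofPred_eq, sub_dotProduct, sub_dotProduct, smul_dotProduct, smul_dotProduct,
        h.eps_dot, h.eps_dot', hi]
      refine ⟨by simp, ?_⟩
      simp only [smul_eq_mul]
      nlinarith [h.pos, (Nat.cast_nonneg j : (0 : ℤ) ≤ j)]
    · rintro j j' ⟨n, hn⟩
      have := congrArg (fun v => v ⬝ᵥ b) hn
      simp only [h.dot_add_zsmul', sub_dotProduct, smul_dotProduct, h.eps_dot'] at this
      have h1 : ((j : ℤ) - j') * s = 0 := by simp only [smul_eq_mul] at this; linarith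
      have h2 := (mul_eq_zero.1 h1).resolve_right h.pos.ne'
      omega
    · rintro δ' ⟨h1, h2⟩
      obtain ⟨p, t, e1, e2⟩ := h.exists_eq_add_of_eq (h1.trans hi.symm)
      have hp : p < 0 := by
        by_contra hp
        nlinarith [h.pos]
      refine ⟨(-p - 1).toNat, t, ?_⟩
      rw [Int.toNat_of_nonneg (by omega), e1]
      simp only [sub_add_cancel, neg_smul, sub_neg_eq_add]
  · ext δ'
    simp only [quadrant, mem_union, mem_ofPred_eq]
    omega
  · intro δ' hδ' n hn
    have h1 := hn.1
    rw [h.dot_add_zsmul] at h1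
    have h2 := hδ'.1
    omega

/-- Here the row δ(b) = k is added. It is a half-line with step ε', where ε'(a) = s, and it starts
at δ itself, which lies in the first window inside. -/
theorem wedgeProd_step_right {x : Fin 3 → ℂ} (hxa : 0 < nuv a x) (hxb : 0 < nuv b x) (w : ℂ)
    {i k : ℤ} {δ : DualLat} (hk : δ ⬝ᵥ b = k) (hi : i ≤ δ ⬝ᵥ a) (hi' : δ ⬝ᵥ a < i + s) :
    wedgeProd a b γ i (k + 1) w x = wedgeProd a b γ i k w x *
      qPoch ((ev δ x - w) / ev (-γ) x) (ev ε' x / ev (-γ) x) := by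
  have hγ := h.ev_ne_zero hxa
  rw [h.wedgeProd_split hxa hxb w (A := quadrant a b i k)
    (B := {δ | δ ⬝ᵥ b = k ∧ i ≤ δ ⬝ᵥ a})]
  · congr 1
    rw [tprod_modSet_eq (wedgeFactor_add hγ w) (fun j : ℕ => δ + (j : ℤ) • ε'), qPoch]
    · refine tprod_congr fun j => ?_
      rw [wedgeFactor, ev_add, ev_zsmul, ev_neg]
      congr 3
      push_cast
      field_simp
      ring
    · intro j
      rw [mem_ofPred_eq, add_dotProduct, add_dotProduct, smul_dotProduct, smul_dotProduct,
        h.symm.eps_dot, h.symm.eps_dot', hk]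
      refine ⟨by simp, ?_⟩
      simp only [smul_eq_mul]
      nlinarith [h.pos, (Nat.cast_nonneg j : (0 : ℤ) ≤ j)]
    · rintro j j' ⟨n, hn⟩
      have := congrArg (fun v => v ⬝ᵥ a) hn
      simp only [h.dot_add_zsmul, add_dotProduct, smul_dotProduct, h.symm.eps_dot'] at this
      have h1 : ((j : ℤ) - j') * s = 0 := by simp only [smul_eq_mul] at this; linarith
      have h2 := (mul_eq_zero.1 h1).resolve_right h.pos.ne'
      omega
    · rintro δ' ⟨h1, h2⟩
      obtain ⟨p, t, e1, e2⟩ := h.symm.exists_eq_add_of_eq (h1.trans hk.symm)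
      have hp : 0 ≤ p := by
        by_contra hp
        nlinarith [h.pos]
      refine ⟨p.toNat, -t, ?_⟩
      rw [Int.toNat_of_nonneg hp, e1]
      simp only [neg_smul, smul_neg]
  · ext δ'
    simp only [quadrant, mem_union, mem_ofPred_eq]
    omega
  · intro δ' hδ' n hn
    have h1 := hn.1
    rw [h.dot_add_zsmul'] at h1
    have h2 := hδ'.2
    omega

theorem wedgeProd_translate {x : Fin 3 → ℂ} (hxa : 0 < nuv a x) (w : ℂ) (i k : ℤ) (μ : DualLat) :
    wedgeProd a b γ i k (w + ev μ x) x = wedgeProd a b γ (i - μ ⬝ᵥ a) (k - μ ⬝ᵥ b) w x := by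
  have hγ := h.ev_ne_zero hxa
  obtain ⟨h1, h2, h3⟩ := modSet_transport (γ := γ) (γ' := γ) (S := quadrant a b i k)
    (S' := quadrant a b (i - μ ⬝ᵥ a) (k - μ ⬝ᵥ b)) h.quadrant_add (fun δ => δ + μ)
    (fun δ hδ => by
      obtain ⟨e1, e2⟩ := hδ
      refine ⟨?_, ?_⟩ <;> rw [add_dotProduct] <;> omega)
    (fun δ δ' => exists_congr fun n => by rw [add_right_comm, add_left_inj])
    (fun δ hδ => ⟨δ - μ, by
      obtain ⟨e1, e2⟩ := hδ
      refine ⟨?_, ?_⟩ <;> rw [sub_dotProduct] <;> omega, by simp⟩)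
  rw [wedgeProd, tprod_modSet_eq (wedgeFactor_add hγ _) _ h1 h2 h3, wedgeProd]
  refine tprod_congr fun q => ?_
  rw [wedgeFactor, wedgeFactor, ev_add, add_sub_add_right_eq_sub]

/-- The map δ ↦ -δ exchanges the roles of a and b; the shifts by 1 come from one bound of a quadrant
being strict and the other not. -/
theorem wedgeProd_neg {x : Fin 3 → ℂ} (hxa : 0 < nuv a x) (w : ℂ) (i k : ℤ) :
    wedgeProd a b γ i k (-w) x = wedgeProd b a (-γ) (1 - k) (1 - i) w x := by
  have hγ := h.ev_ne_zero hxa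
  obtain ⟨h1, h2, h3⟩ := modSet_transport (γ := γ) (γ' := -γ) (S := quadrant a b i k)
    (S' := quadrant b a (1 - k) (1 - i)) h.symm.quadrant_add (fun δ => -δ)
    (fun δ hδ => by
      obtain ⟨e1, e2⟩ := hδ
      refine ⟨?_, ?_⟩ <;> rw [neg_dotProduct] <;> omega)
    (fun δ δ' => exists_congr fun n => by
      rw [← neg_inj, neg_neg, neg_add, neg_neg, smul_neg])
    (fun δ hδ => ⟨-δ, by
      obtain ⟨e1, e2⟩ := hδ
      refine ⟨?_, ?_⟩ <;> rw [neg_dotProduct] <;> omega, by simp⟩)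
  rw [wedgeProd, tprod_modSet_eq (wedgeFactor_add hγ _) _ h1 h2 h3, wedgeProd]
  refine tprod_congr fun q => ?_
  rw [wedgeFactor, wedgeFactor, ev_neg, ev_neg]
  congr 3
  field_simp
  ring

theorem wedgeGamma_eq {x : Fin 3 → ℂ} (hxa : 0 < nuv a x) (hγd : dirVec a b = γ) (w : ℂ) :
    wedgeGamma a b w x = wedgeProd a b γ 1 1 w x / wedgeProd b a (-γ) 1 1 w x := by
  have hγ := h.ev_ne_zero hxa
  have hC : ∀ a b : Lat, Cpm a b = quadrant a b 1 1 := by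
    intro a b; ext δ; simp only [Cpm, quadrant, mem_ofPred_eq]; omega
  have hF : ∀ (δ : DualLat) (n : ℤ), (1 - ee ((ev (δ + n • γ) x - w) / ev γ x)) =
      1 - ee ((ev δ x - w) / ev γ x) := by
    intro δ n
    rw [← ee_add_int ((ev δ x - w) / ev γ x) n, ev_add, ev_zsmul]
    congr 2
    field_simp
    ring
  obtain ⟨h1, h2, h3⟩ := modSet_transport (γ := γ) (γ' := -γ) (S := quadrant b a 1 1)
    (S' := quadrant b a 1 1) h.symm.quadrant_add (fun δ => δ) (fun δ hδ => hδ)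
    (fun δ δ' => by
      constructor
      · rintro ⟨n, hn⟩; exact ⟨-n, by simpa using hn⟩
      · rintro ⟨n, hn⟩; exact ⟨-n, by simpa using hn⟩)
    (fun δ hδ => ⟨δ, hδ, rfl⟩)
  rw [wedgeGamma, hγd, hC, hC]
  congr 1
  · refine tprod_congr fun q => ?_
    rw [wedgeFactor, ee, sub_eq_add_neg, mul_neg]
  · refine (tprod_modSet_eq (F := fun δ => 1 - ee ((ev δ x - w) / ev γ x)) hF _ h1 h2 h3).trans (tprod_congr fun q => ?_)
    rw [wedgeFactor, ev_neg, div_neg, neg_neg, sub_eq_add_neg]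

end IsWedge

/-! ### The hermitian weight of a wedge -/

theorem R3_neg (ζ t s : ℝ) : R3 (-ζ) (-s) (-t) = -R3 ζ t s := by
  simp only [R3]; ring

/-- Reflection formula of the Bernoulli polynomial, the weight counterpart of w ↦ -w. -/
theorem R3_reflect {t s : ℝ} (ht : t ≠ 0) (hs : s ≠ 0) (ζ : ℝ) :
    R3 (t + s - ζ) t s = -R3 ζ t s := by
  simp only [R3]; field_simp; ring

/-- Difference equation of the Bernoulli polynomials. It matches the fact that a step of the gamma
function is a theta function. -/
theorem R3_add_left {t s : ℝ} (ht : t ≠ 0) (hs : s ≠ 0) (ζ : ℝ) :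
    R3 (ζ + t) t s = R3 ζ t s + 3 * R2 ζ s := by
  simp only [R3, R2]; field_simp; ring

theorem R2_add_self {t : ℝ} (ht : t ≠ 0) (ζ : ℝ) : R2 (-ζ + t) t = R2 ζ t := by
  simp only [R2]; field_simp; ring

theorem sum_cubic (c₃ c₂ c₁ c₀ ζ σ : ℝ) (n : ℕ) :
    ∑ j ∈ Finset.range n, (c₃ * (ζ + j * σ) ^ 3 + c₂ * (ζ + j * σ) ^ 2 + c₁ * (ζ + j * σ) + c₀) =
      c₃ * (n * ζ ^ 3 + 3 * ζ ^ 2 * σ * (n * (n - 1) / 2) +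
        3 * ζ * σ ^ 2 * (n * (n - 1) * (2 * n - 1) / 6) + σ ^ 3 * (n * (n - 1) / 2) ^ 2) +
      c₂ * (n * ζ ^ 2 + 2 * ζ * σ * (n * (n - 1) / 2) + σ ^ 2 * (n * (n - 1) * (2 * n - 1) / 6)) +
      c₁ * (n * ζ + σ * (n * (n - 1) / 2)) + c₀ * n := by
  induction n with
  | zero => simp
  | succ n ih => rw [Finset.sum_range_succ, ih]; push_cast; ring

/-- Multiplication formula in one parameter: a row of n equally spaced points collapses to one
point. This is why the weight does not depend on the auxiliary forms. -/
theorem sum_R3 {t σ : ℝ} (ht : t ≠ 0) (hσ : σ ≠ 0) {n : ℕ} (hn : n ≠ 0) (ζ : ℝ) :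
    ∑ j ∈ Finset.range n, R3 (ζ + j * σ) t (n * σ) = R3 ζ t σ := by
  have hn' : (n : ℝ) ≠ 0 := Nat.cast_ne_zero.2 hn
  have h := sum_cubic (1 / (t * (n * σ))) (-(3 / 2 * (1 / t + 1 / (n * σ))))
    (t / (2 * (n * σ)) + n * σ / (2 * t) + 3 / 2) (-((t + n * σ) / 4)) ζ σ n
  refine Eq.trans (Finset.sum_congr rfl fun j _ => ?_) (h.trans ?_)
  · simp only [R3]; ring
  · simp only [R3]; field_simp; ring

/-- The set of the `δ` with `m ≤ δ(a) < m + α(a)` and `n ≤ δ(b) < n + β(b)`. -/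
def box (a b α β : Lat) (m n : ℤ) : Set DualLat :=
  {δ | (m ≤ δ ⬝ᵥ a ∧ δ ⬝ᵥ a < m + α ⬝ᵥ a) ∧ n ≤ δ ⬝ᵥ b ∧ δ ⬝ᵥ b < n + β ⬝ᵥ b}

theorem box_swap (a b α β : Lat) (m n : ℤ) : box b a β α n m = box a b α β m n := by
  ext δ; simp only [box, mem_ofPred_eq]; exact and_comm

/-- A summand of the weight of a wedge. -/
def boxTerm (γ α β : DualLat) (w : ℂ) (x : Fin 3 → ℂ) (δ : DualLat) : ℝ :=
  R3 ((w + ev δ x) / ev γ x).im (ev α x / ev γ x).im (ev β x / ev γ x).im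

theorem boxTerm_add {γ : DualLat} {x : Fin 3 → ℂ} (hγ : ev γ x ≠ 0) (α β : DualLat) (w : ℂ)
    (δ : DualLat) (k : ℤ) : boxTerm γ α β w x (δ + k • γ) = boxTerm γ α β w x δ := by
  rw [boxTerm, boxTerm, ev_add, ev_zsmul, ← add_assoc, add_div _ ((k : ℂ) * _),
    mul_div_cancel_right₀ _ hγ]
  simp

/-- The weight of a wedge: the sum of the Bernoulli polynomials over a box. -/
def boxSum (a b γ α β : DualLat) (m n : ℤ) (w : ℂ) (x : Fin 3 → ℂ) : ℝ :=
  ∑ᶠ q : modSet γ (box a b α β m n), boxTerm γ α β w x (Quotient.out q.1)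

theorem IsWedgePair.symm {a b : Lat} {α β : DualLat} (hp : IsWedgePair a b α β) :
    IsWedgePair b a β α :=
  ⟨hp.2.1, hp.1, hp.2.2.2, hp.2.2.1⟩

namespace IsWedge

variable {a b γ ε ε' η η' : DualLat} {s : ℤ} (h : IsWedge a b γ ε ε' η η' s)

include h

theorem box_add {α β : DualLat} {m n : ℤ} :
    ∀ δ ∈ box a b α β m n, ∀ k : ℤ, δ + k • γ ∈ box a b α β m n := by
  intro δ hδ k
  rw [box, mem_ofPred_eq, h.dot_add_zsmul, h.dot_add_zsmul']
  exact hδ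

theorem boxSum_transport {S : Set DualLat} {α β : DualLat} {x : Fin 3 → ℂ} {γ' : DualLat}
    {m n : ℤ} (hxa : 0 < nuv a x) (w : ℂ)
    (hS' : ∀ δ ∈ S, ∀ k : ℤ, δ + k • γ' ∈ S) (φ : DualLat → DualLat)
    (hφ : ∀ δ ∈ S, φ δ ∈ box a b α β m n)
    (hiff : ∀ δ δ', (∃ k : ℤ, φ δ = φ δ' + k • γ) ↔ ∃ k : ℤ, δ = δ' + k • γ')
    (hsurj : ∀ δ ∈ box a b α β m n, ∃ δ' ∈ S, δ = φ δ') :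
    boxSum a b γ α β m n w x =
      ∑ᶠ q : modSet γ' S, boxTerm γ α β w x (φ (Quotient.out q.1)) := by
  obtain ⟨h1, h2, h3⟩ := modSet_transport (γ := γ) (γ' := γ') hS' φ hφ hiff hsurj
  exact finsum_modSet_eq (boxTerm_add (h.ev_ne_zero hxa) α β w) _ h1 h2 h3

/-- The box is the same set, and changing the sign of γ changes the sign of all three arguments of
the odd function `R3`. -/
theorem boxSum_swap (α β : DualLat) (m n : ℤ) (w : ℂ) {x : Fin 3 → ℂ} (hxa : 0 < nuv a x) :
    boxSum b a (-γ) β α n m w x = -boxSum a b γ α β m n w x := by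
  rw [h.boxSum_transport (γ' := -γ) (S := box b a β α n m) hxa w h.symm.box_add (fun δ => δ)
    (fun δ hδ => by rwa [box_swap] at hδ)
    (fun δ δ' => by
      constructor
      · rintro ⟨n, hn⟩; exact ⟨-n, by simpa using hn⟩
      · rintro ⟨n, hn⟩; exact ⟨-n, by simpa using hn⟩)
    (fun δ hδ => ⟨δ, by rwa [box_swap], rfl⟩), boxSum, ← finsum_neg_distrib]
  refine finsum_congr fun q => ?_
  simp only [boxTerm, ev_neg, div_neg, Complex.neg_im, R3_neg]

theorem boxSum_translate (α β : DualLat) (m n : ℤ) (w : ℂ) {x : Fin 3 → ℂ} (hxa : 0 < nuv a x)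
    (μ : DualLat) : boxSum a b γ α β m n (w + ev μ x) x =
      boxSum a b γ α β (m + μ ⬝ᵥ a) (n + μ ⬝ᵥ b) w x := by
  rw [h.boxSum_transport (γ' := γ) (S := box a b α β (m + μ ⬝ᵥ a) (n + μ ⬝ᵥ b)) hxa _ h.box_add
    (fun δ => δ - μ)
    (fun δ hδ => by
      obtain ⟨⟨e1, e2⟩, e3, e4⟩ := hδ
      refine ⟨⟨?_, ?_⟩, ?_, ?_⟩ <;> rw [sub_dotProduct] <;> omega)
    (fun δ δ' => exists_congr fun n => by rw [sub_add_eq_add_sub, sub_left_inj])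
    (fun δ hδ => ⟨δ + μ, by
      obtain ⟨⟨e1, e2⟩, e3, e4⟩ := hδ
      refine ⟨⟨?_, ?_⟩, ?_, ?_⟩ <;> rw [add_dotProduct] <;> omega, by simp⟩), boxSum]
  refine finsum_congr fun q => ?_
  rw [boxTerm, boxTerm, ev_sub, add_add_sub_cancel]

variable {α β : DualLat}

theorem im_pair_ne_zero (hp : IsWedgePair a b α β) {x : Fin 3 → ℂ} (hxa : 0 < nuv a x)
    (hxb : 0 < nuv b x) : (ev α x / ev γ x).im ≠ 0 ∧ (ev β x / ev γ x).im ≠ 0 := by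
  obtain ⟨h1, h2, hp3, hp4⟩ := hp
  rw [h.im_ev_div_dir, h.im_ev_div_dir, h1, h2]
  constructor
  · simpa using ⟨hp3.ne', hxb.ne', h.pos.ne', h.ev_ne_zero hxa⟩
  · simpa using ⟨hp4.ne', hxa.ne', h.pos.ne', h.ev_ne_zero hxa⟩

/-- Substitute δ ↦ α + β - δ and apply the reflection formula `R3_reflect`. -/
theorem boxSum_neg (hp : IsWedgePair a b α β) (m n : ℤ) (w : ℂ) {x : Fin 3 → ℂ}
    (hxa : 0 < nuv a x) (hxb : 0 < nuv b x) :
    boxSum a b γ α β m n (-w) x = -boxSum a b γ α β (1 - m) (1 - n) w x := by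
  obtain ⟨ht, hs⟩ := h.im_pair_ne_zero hp hxa hxb
  obtain ⟨p1, p2, p3, p4⟩ := hp
  rw [h.boxSum_transport (γ' := γ) (S := box a b α β (1 - m) (1 - n)) hxa _ h.box_add
    (fun δ => α + β - δ)
    (fun δ hδ => by
      obtain ⟨⟨e1, e2⟩, e3, e4⟩ := hδ
      refine ⟨⟨?_, ?_⟩, ?_, ?_⟩ <;> rw [sub_dotProduct, add_dotProduct] <;> omega)
    (fun δ δ' => by
      constructor
      · rintro ⟨n, hn⟩; exact ⟨-n, by rw [neg_smul]; linear_combination -hn⟩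
      · rintro ⟨n, hn⟩; exact ⟨-n, by rw [neg_smul, hn]; abel⟩)
    (fun δ hδ => ⟨α + β - δ, by
      obtain ⟨⟨e1, e2⟩, e3, e4⟩ := hδ
      refine ⟨⟨?_, ?_⟩, ?_, ?_⟩ <;> rw [sub_dotProduct, add_dotProduct] <;> omega, by abel⟩),
    boxSum, ← finsum_neg_distrib]
  refine finsum_congr fun q => ?_
  rw [boxTerm, boxTerm, ← R3_reflect ht hs, ev_sub, ev_add, ← Complex.add_im, ← Complex.sub_im]
  congr 2
  ring

/-- Representatives of the box modulo `γ`. -/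
theorem exists_box_param (hp : IsWedgePair a b α β) {m n : ℤ} {d : ℤ → DualLat}
    (hd : ∀ k, d k ⬝ᵥ a = k ∧ n ≤ d k ⬝ᵥ b ∧ d k ⬝ᵥ b < n + s) :
    ∃ N : ℕ, N ≠ 0 ∧ (∃ t : ℤ, β = (N : ℤ) • ε + t • γ) ∧
      let e : Fin (α ⬝ᵥ a).toNat × Fin N → DualLat := fun p => d (m + p.1) + (p.2 : ℤ) • ε
      (∀ i, e i ∈ box a b α β m n) ∧ (∀ i j, (∃ k : ℤ, e i = e j + k • γ) → i = j) ∧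
      (∀ δ ∈ box a b α β m n, ∃ i, ∃ k : ℤ, δ = e i + k • γ) := by
  obtain ⟨p1, p2, p3, p4⟩ := hp
  have hs := h.pos
  -- Since β(a) = 0, the form β is N ε modulo γ, and β(b) = N s says that each row of the box
  -- consists of N windows.
  obtain ⟨N, t, hN, hN'⟩ := h.exists_eq_add_of_eq (δ := β) (δ' := 0) (by rw [p2, zero_dotProduct])
  rw [zero_dotProduct, zero_add] at hN'
  rw [zero_add] at hN
  have hN0 : 0 < N := by
    by_contra hn
    nlinarith
  lift N to ℕ using hN0.le
  refine ⟨N, by omega, ⟨t, hN⟩, ?_, ?_, ?_⟩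
  · rintro ⟨i, j⟩
    have hi := i.2
    have hj : ((j : ℕ) : ℤ) + 1 ≤ N := by exact_mod_cast j.2
    obtain ⟨d1, d2, d3⟩ := hd (m + i)
    have hjs := mul_le_mul_of_nonneg_right hj hs.le
    have hj0 : 0 ≤ ((j : ℕ) : ℤ) * s := by positivity
    refine ⟨⟨?_, ?_⟩, ?_, ?_⟩ <;> rw [add_dotProduct, smul_dotProduct] <;>
      simp only [h.eps_dot, h.eps_dot', smul_eq_mul, d1] <;> first | omega | linarith
  · rintro ⟨i, j⟩ ⟨i', j'⟩ ⟨k, hk⟩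
    have ha := congrArg (fun v => v ⬝ᵥ a) hk
    have hb := congrArg (fun v => v ⬝ᵥ b) hk
    simp only [h.dot_add_zsmul', h.dot_add_zsmul, add_dotProduct, smul_dotProduct, h.eps_dot',
      h.eps_dot, (hd _).1, smul_eq_mul, mul_zero, add_zero] at ha hb
    have hi : i = i' := Fin.ext (by omega)
    subst hi
    have h1 : ((j : ℕ) - (j' : ℕ) : ℤ) * s = 0 := by linarith
    have h2 := (mul_eq_zero.1 h1).resolve_right hs.ne'
    rw [Fin.ext (by omega : (j : ℕ) = j')]
  · rintro δ ⟨⟨e1, e2⟩, e3, e4⟩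
    obtain ⟨d1, d2, d3⟩ := hd (δ ⬝ᵥ a)
    obtain ⟨p, k, q1, q2⟩ := h.exists_eq_add_of_eq d1.symm
    have hp0 : 0 ≤ p := by
      by_contra hp
      nlinarith
    have hpN : p < N := by
      by_contra hp
      nlinarith
    refine ⟨⟨⟨(δ ⬝ᵥ a - m).toNat, by omega⟩, ⟨p.toNat, by omega⟩⟩, k, ?_⟩
    simp only [Int.toNat_of_nonneg hp0, Int.toNat_of_nonneg (sub_nonneg.2 e1)]
    rw [add_sub_cancel]
    exact q1

theorem finite_modSet_box (hp : IsWedgePair a b α β) (m n : ℤ) :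
    (modSet γ (box a b α β m n)).Finite := by
  choose d hd1 hd2 hd3 using fun k => h.exists_window k n
  obtain ⟨N, -, -, h1, h2, h3⟩ := h.exists_box_param hp (m := m) (n := n) (d := d)
    fun k => ⟨hd1 k, hd2 k, hd3 k⟩
  obtain ⟨E, -⟩ := exists_equiv_modSet _ h1 h2 h3
  exact Set.finite_coe_iff.1 (Finite.of_equiv _ E)

/-- Each row is an arithmetic progression of N points with step ε, and β is N ε modulo γ, so
`sum_R3` leaves one term per row with β replaced by ε. The form β has disappeared. -/
theorem boxSum_eq_sum (hp : IsWedgePair a b α β) {m n : ℤ} {d : ℤ → DualLat}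
    (hd : ∀ k, d k ⬝ᵥ a = k ∧ n ≤ d k ⬝ᵥ b ∧ d k ⬝ᵥ b < n + s) (w : ℂ) {x : Fin 3 → ℂ}
    (hxa : 0 < nuv a x) (hxb : 0 < nuv b x) : boxSum a b γ α β m n w x =
      ∑ i ∈ Finset.range (α ⬝ᵥ a).toNat, R3 ((w + ev (d (m + i)) x) / ev γ x).im
        (ev α x / ev γ x).im (ev ε x / ev γ x).im := by
  obtain ⟨N, hN, ⟨t, hβ⟩, h1, h2, h3⟩ := h.exists_box_param hp (m := m) hd
  have hγ := h.ev_ne_zero hxa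
  rw [boxSum, finsum_modSet_eq (boxTerm_add hγ α β w) _ h1 h2 h3, finsum_eq_sum_of_fintype,
    Fintype.sum_prod_type, Finset.sum_range]
  refine Finset.sum_congr rfl fun i _ => ?_
  rw [← sum_R3 (h.im_pair_ne_zero hp hxa hxb).1 (h.im_eps_div_pos hxa).ne' hN, Finset.sum_range]
  refine Finset.sum_congr rfl fun j _ => ?_
  rw [boxTerm, hβ, ev_add, ev_add, ev_zsmul, ev_zsmul, ev_zsmul]
  congr 1
  · rw [← add_assoc, add_div _ (_ * _), Complex.add_im, mul_div_assoc]
    simp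
  · rw [add_div, Complex.add_im, mul_div_assoc, mul_div_assoc, div_self hγ]
    simp

theorem boxSum_congr_right {β' : DualLat} (hp : IsWedgePair a b α β) (hp' : IsWedgePair a b α β')
    (m n : ℤ) (w : ℂ) {x : Fin 3 → ℂ} (hxa : 0 < nuv a x) (hxb : 0 < nuv b x) :
    boxSum a b γ α β m n w x = boxSum a b γ α β' m n w x := by
  choose d hd1 hd2 hd3 using fun k => h.exists_window k n
  rw [h.boxSum_eq_sum hp (fun k => ⟨hd1 k, hd2 k, hd3 k⟩) w hxa hxb,
    h.boxSum_eq_sum hp' (fun k => ⟨hd1 k, hd2 k, hd3 k⟩) w hxa hxb]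

/-- The weight of a wedge does not depend on the auxiliary forms. -/
theorem boxSum_congr {α' β' : DualLat} (hp : IsWedgePair a b α β) (hp' : IsWedgePair a b α' β')
    (m n : ℤ) (w : ℂ) {x : Fin 3 → ℂ} (hxa : 0 < nuv a x) (hxb : 0 < nuv b x) :
    boxSum a b γ α β m n w x = boxSum a b γ α' β' m n w x := by
  have hm : IsWedgePair a b α β' := ⟨hp.1, hp'.2.1, hp.2.2.1, hp'.2.2.2⟩
  rw [h.boxSum_congr_right hp hm m n w hxa hxb, ← neg_inj, ← h.boxSum_swap α β' m n w hxa,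
    ← h.boxSum_swap α' β' m n w hxa, h.symm.boxSum_congr_right hm.symm hp'.symm n m w hxb hxa]

/-- Sliding the box by one row drops the row m and adds the row m + α(a). Because α(b) = 0, the new
row is the old one translated by α, so the difference equation applies. -/
theorem boxSum_step_left (hp : IsWedgePair a b α β) (m n : ℤ) (w : ℂ) {x : Fin 3 → ℂ}
    (hxa : 0 < nuv a x) (hxb : 0 < nuv b x) {δ : DualLat} (hm : δ ⬝ᵥ a = m) (hn : n ≤ δ ⬝ᵥ b)
    (hn' : δ ⬝ᵥ b < n + s) : boxSum a b γ α β (m + 1) n w x =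
      boxSum a b γ α β m n w x + 3 * R2 ((w + ev δ x) / ev γ x).im (ev ε x / ev γ x).im := by
  have hγ := h.ev_ne_zero hxa
  choose d hd1 hd2 hd3 using fun k => h.exists_window k n
  have hd : ∀ k, d k ⬝ᵥ a = k ∧ n ≤ d k ⬝ᵥ b ∧ d k ⬝ᵥ b < n + s :=
    fun k => ⟨hd1 k, hd2 k, hd3 k⟩
  rw [h.boxSum_eq_sum hp hd w hxa hxb, h.boxSum_eq_sum hp hd w hxa hxb]
  obtain ⟨t, ht⟩ := h.window_unique (δ := d m) (δ' := δ) ((hd m).1.trans hm.symm) (hd m).2.1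
    (hd m).2.2 hn hn'
  obtain ⟨r, hr⟩ := h.window_unique (δ := d (m + α ⬝ᵥ a)) (δ' := δ + α) (k := n)
    (by rw [(hd _).1, add_dotProduct, hm]) (hd _).2.1 (hd _).2.2
    (by rw [add_dotProduct, hp.1, add_zero]; exact hn)
    (by rw [add_dotProduct, hp.1, add_zero]; exact hn')
  -- The sum over one row more than the box is split off at its last and at its first term.
  have e1 := Finset.sum_range_succ (fun i : ℕ => R3 ((w + ev (d (m + i)) x) / ev γ x).im
    (ev α x / ev γ x).im (ev ε x / ev γ x).im) (α ⬝ᵥ a).toNat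
  rw [Finset.sum_range_succ'] at e1
  have hA : m + ((α ⬝ᵥ a).toNat : ℤ) = m + α ⬝ᵥ a := by
    rw [Int.toNat_of_nonneg hp.2.2.1.le]
  simp only [hA, Nat.cast_zero, add_zero, ht, hr, Nat.cast_add, Nat.cast_one] at e1
  have e2 : ∀ i : ℕ, m + 1 + (i : ℤ) = m + (i + 1) := fun i => by ring
  have e3 : ((w + ev (δ + α + r • γ) x) / ev γ x).im =
      ((w + ev δ x) / ev γ x).im + (ev α x / ev γ x).im := by
    rw [ev_add, ev_add, ev_zsmul, ← add_assoc, ← add_assoc, add_div, add_div _ (ev α x),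
      mul_div_cancel_right₀ _ hγ]
    simp
  have e4 : ((w + ev (δ + t • γ) x) / ev γ x).im = ((w + ev δ x) / ev γ x).im := by
    rw [ev_add, ev_zsmul, ← add_assoc, add_div, mul_div_cancel_right₀ _ hγ]
    simp
  rw [e3, e4, R3_add_left (h.im_pair_ne_zero hp hxa hxb).1 (h.im_eps_div_pos hxa).ne'] at e1
  simp only [e2]
  linarith

/-- Negating w moves the box from (0, 0) to (1, 1) and changes the sign. Two steps, one for a and
one for b, lead back, so the even part of the weight is a difference of two quadratic Bernoulli
polynomials. -/
theorem boxSum_even (hp : IsWedgePair a b α β) (w : ℂ) {x : Fin 3 → ℂ} (hxa : 0 < nuv a x)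
    (hxb : 0 < nuv b x) : boxSum a b γ α β 0 0 w x + boxSum a b γ α β 0 0 (-w) x =
      -3 * (R2 (w / ev γ x).im (nuv a x / Complex.normSq (ev γ x)) -
        R2 (w / ev γ x).im (nuv b x / Complex.normSq (ev γ x))) := by
  have h1 := h.boxSum_neg hp 0 0 w hxa hxb
  have h2 := h.boxSum_step_left hp 0 0 w hxa hxb (δ := 0) (by simp) (by simp)
    (by simpa using h.pos)
  have h3 := h.symm.boxSum_step_left hp.symm 0 1 w hxb hxa (δ := ε') h.symm.eps_dot
    (by rw [h.symm.eps_dot']; exact h.pos) (by rw [h.symm.eps_dot']; linarith)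
  rw [h.boxSum_swap _ _ _ _ _ hxa, h.boxSum_swap _ _ _ _ _ hxa, add_div, Complex.add_im,
    ev_neg, div_neg, Complex.neg_im, ← ev_neg, R2_add_self (h.symm.im_eps_div_pos hxb).ne'] at h3
  rw [h.im_eps_div, ev_zero, add_zero] at h2
  rw [h.symm.im_eps_div, ev_neg, Complex.normSq_neg] at h3
  norm_num at h1 h2 h3
  linarith

/-- The cubic coefficient is a sum of equal contributions of the rows, and `boxSum_even` fixes the
quadratic one. The terms of degree at most one are harmonic and may stay unspecified. -/
theorem exists_boxSum_eq (hp : IsWedgePair a b α β) {x : Fin 3 → ℂ} (hxa : 0 < nuv a x)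
    (hxb : 0 < nuv b x) : ∃ c₁ c₀ : ℝ, ∀ w, boxSum a b γ α β 0 0 w x =
      -(s * Complex.normSq (ev γ x) ^ 2 / (nuv a x * nuv b x)) * (w / ev γ x).im ^ 3 -
        3 / 2 * (Complex.normSq (ev γ x) / nuv a x - Complex.normSq (ev γ x) / nuv b x) *
          (w / ev γ x).im ^ 2 + c₁ * (w / ev γ x).im + c₀ := by
  obtain ⟨c₃, c₂, c₁, c₀, hc₃, hc⟩ : ∃ c₃ c₂ c₁ c₀ : ℝ,
      c₃ = -(s * Complex.normSq (ev γ x) ^ 2 / (nuv a x * nuv b x)) ∧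
      ∀ w, boxSum a b γ α β 0 0 w x = c₃ * (w / ev γ x).im ^ 3 + c₂ * (w / ev γ x).im ^ 2 +
        c₁ * (w / ev γ x).im + c₀ := by
    choose d hd1 hd2 hd3 using fun k => h.exists_window k 0
    have hd : ∀ k, d k ⬝ᵥ a = k ∧ 0 ≤ d k ⬝ᵥ b ∧ d k ⬝ᵥ b < 0 + s :=
      fun k => ⟨hd1 k, hd2 k, hd3 k⟩
    obtain ⟨t, ht⟩ : ∃ t, t = (ev α x / ev γ x).im := ⟨_, rfl⟩
    obtain ⟨σ, hσ⟩ : ∃ σ, σ = (ev ε x / ev γ x).im := ⟨_, rfl⟩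
    obtain ⟨f, hf⟩ : ∃ f : ℕ → ℝ, ∀ i, f i = (ev (d (0 + i)) x / ev γ x).im := ⟨_, fun i => rfl⟩
    refine ⟨_, ∑ i ∈ Finset.range (α ⬝ᵥ a).toNat, (3 * f i / (t * σ) - 3 / 2 * (1 / t + 1 / σ)),
      ∑ i ∈ Finset.range (α ⬝ᵥ a).toNat, (3 * f i ^ 2 / (t * σ) - 3 * (1 / t + 1 / σ) * f i +
        (t / (2 * σ) + σ / (2 * t) + 3 / 2)),
      ∑ i ∈ Finset.range (α ⬝ᵥ a).toNat, R3 (f i) t σ, rfl, fun w => ?_⟩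
    have hA : (((α ⬝ᵥ a).toNat : ℕ) : ℝ) = (α ⬝ᵥ a : ℤ) := by
      rw [← Int.cast_natCast, Int.toNat_of_nonneg hp.2.2.1.le]
    -- There are α(a) rows and t is proportional to α(a), which therefore cancels.
    have hlead : -(s * Complex.normSq (ev γ x) ^ 2 / (nuv a x * nuv b x)) =
        ∑ i ∈ Finset.range (α ⬝ᵥ a).toNat, (1 / (t * σ)) := by
      have hs : (s : ℝ) ≠ 0 := by exact_mod_cast h.pos.ne'
      have hn := (Complex.normSq_pos.2 (h.ev_ne_zero hxa)).ne'
      have hA0 : ((α ⬝ᵥ a : ℤ) : ℝ) ≠ 0 := by exact_mod_cast hp.2.2.1.ne'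
      rw [Finset.sum_const, Finset.card_range, nsmul_eq_mul, hA, ht, hσ, h.im_eps_div,
        h.im_ev_div_dir, hp.1, Int.cast_zero, zero_mul, zero_sub]
      have := hxa.ne'
      have := hxb.ne'
      field_simp
    rw [h.boxSum_eq_sum hp hd w hxa hxb, hlead, Finset.sum_mul, Finset.sum_mul, Finset.sum_mul,
      ← Finset.sum_add_distrib, ← Finset.sum_add_distrib, ← Finset.sum_add_distrib]
    refine Finset.sum_congr rfl fun i _ => ?_
    rw [← ht, ← hσ, add_div, Complex.add_im, ← hf, R3, R3]
    ring
  have hγ := h.ev_ne_zero hxa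
  -- Evaluating at w = i z γ(x) makes Im(w/γ(x)) an arbitrary real number z; the values 0 and 1
  -- suffice to find c₂.
  have key : ∀ z : ℝ, 2 * c₂ * z ^ 2 + 2 * c₀ =
      -3 * (R2 z (nuv a x / Complex.normSq (ev γ x)) -
        R2 z (nuv b x / Complex.normSq (ev γ x))) := by
    intro z
    have hz : ((z : ℂ) * Complex.I * ev γ x / ev γ x).im = z := by
      rw [mul_div_cancel_right₀ _ hγ]; simp
    have h1 := h.boxSum_even hp (z * Complex.I * ev γ x) hxa hxb
    rw [hc, hc, neg_div, Complex.neg_im, hz] at h1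
    linarith
  have k0 := key 0
  have k1 := key 1
  simp only [R2, div_div_eq_mul_div] at k0 k1
  norm_num at k0 k1
  refine ⟨c₁, c₀, fun w => ?_⟩
  rw [hc, hc₃]
  have : c₂ = -(3 / 2 * (Complex.normSq (ev γ x) / nuv a x - Complex.normSq (ev γ x) / nuv b x)) := by
    linarith
  rw [this]
  ring

end IsWedge

theorem wedgeHerm_mk_eq {a b γ ε ε' η η' α β : DualLat} {s : ℤ}
    (h : IsWedge a b γ ε ε' η η' s) (hd : dirVec a b = γ) (hp : IsWedgePair a b α β) (p : cone) :
    wedgeHerm a b α β (X3.mk p) =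
      Real.exp (-(2 * Real.pi / 3) * boxSum a b γ α β 0 0 p.1.1 p.1.2) := by
  have hF : Fset a b α β = box a b α β 0 0 := by
    ext δ; simp only [Fset, box, mem_ofPred_eq, zero_add, and_assoc]
  have hfin := h.finite_modSet_box hp 0 0
  change (∏ᶠ q ∈ modSet (dirVec a b) (Fset a b α β), h3 _ _ _) = _
  rw [hd, hF, finprod_mem_eq_finite_toFinset_prod _ hfin, boxSum]
  rw [finsum_set_coe_eq_finsum_mem (f := fun q : Quo γ => boxTerm γ α β p.1.1 p.1.2 q.out),
    finsum_mem_eq_finite_toFinset_sum _ hfin, Finset.mul_sum, Real.exp_sum]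
  rfl

/-! ### Products over intervals of integers -/

theorem zprod_zero {M : Type*} [Field M] (f : ℤ → M) : zprod 0 f = 1 := by simp [zprod]

theorem zprod_add_one {M : Type*} [Field M] {f : ℤ → M} (hf : ∀ j, f j ≠ 0) (m : ℤ) :
    zprod (m + 1) f = zprod m f * f m := by
  rcases le_or_gt 0 m with hm | hm
  · have h1 : Finset.Ico 0 (m + 1) = insert m (Finset.Ico 0 m) := by
      ext j; simp only [Finset.mem_Ico, Finset.mem_insert]; omega
    rw [zprod, zprod, h1, Finset.prod_insert (by simp), Finset.Ico_eq_empty (by omega : ¬m + 1 < 0),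
      Finset.Ico_eq_empty (by omega : ¬m < 0)]
    simp [mul_comm]
  · have h1 : Finset.Ico m 0 = insert m (Finset.Ico (m + 1) 0) := by
      ext j; simp only [Finset.mem_Ico, Finset.mem_insert]; omega
    rw [zprod, zprod, h1, Finset.prod_insert (by simp), Finset.Ico_eq_empty (by omega : ¬0 < m + 1),
      Finset.Ico_eq_empty (by omega : ¬0 < m)]
    have := hf m
    have h2 : ∏ j ∈ Finset.Ico (m + 1) 0, f j ≠ 0 := Finset.prod_ne_zero_iff.2 fun j _ => hf j
    field_simp

theorem zprod_ne_zero {M : Type*} [Field M] {f : ℤ → M} (hf : ∀ j, f j ≠ 0) (m : ℤ) :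
    zprod m f ≠ 0 :=
  div_ne_zero (Finset.prod_ne_zero_iff.2 fun j _ => hf j) (Finset.prod_ne_zero_iff.2 fun j _ => hf j)

theorem zprod_pos {f : ℤ → ℝ} (hf : ∀ j, 0 < f j) (m : ℤ) : 0 < zprod m f :=
  div_pos (Finset.prod_pos fun j _ => hf j) (Finset.prod_pos fun j _ => hf j)

theorem zprod_mul {M : Type*} [Field M] (f g : ℤ → M) (m : ℤ) :
    zprod m (fun j => f j * g j) = zprod m f * zprod m g := by
  rw [zprod, zprod, zprod, Finset.prod_mul_distrib, Finset.prod_mul_distrib, mul_div_mul_comm]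

theorem norm_zprod_sq (f : ℤ → ℂ) (m : ℤ) : ‖zprod m f‖ ^ 2 = zprod m fun j => ‖f j‖ ^ 2 := by
  rw [zprod, zprod, norm_div, norm_prod, norm_prod, div_pow, Finset.prod_pow, Finset.prod_pow]

/-- The cocycle property of the two-sided product, which yields the component of group degree 2. -/
theorem zprod_add {M : Type*} [Field M] {f : ℤ → M} (hf : ∀ j, f j ≠ 0) (m n : ℤ) :
    zprod (m + n) f = zprod m f * zprod n fun j => f (j + m) := by
  have hf' : ∀ j, f (j + m) ≠ 0 := fun j => hf _
  induction n using Int.induction_on with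
  | zero => rw [add_zero, zprod_zero, mul_one]
  | succ n ih => rw [← add_assoc, zprod_add_one hf, zprod_add_one hf', ih, mul_assoc, add_comm m]
  | pred n ih =>
    have h1 := zprod_add_one hf (m + (-n - 1))
    have h2 := zprod_add_one hf' (-n - 1)
    rw [sub_add_cancel] at h2
    rw [show m + (-(n : ℤ) - 1) + 1 = m + -n by ring, ih, h2, add_comm m (-(n : ℤ) - 1),
      ← mul_assoc] at h1
    rw [add_comm m, ← mul_right_cancel₀ (hf _) h1]

/-! ### Generic points -/

/-- The complement of the lattice `{δ(x)}`. -/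
def generic (x : Fin 3 → ℂ) : Set ℂ := {w | ∀ δ : DualLat, w ≠ ev δ x}

theorem countable_compl_generic (x : Fin 3 → ℂ) : (generic x)ᶜ.Countable := by
  refine (countable_range fun δ : DualLat => ev δ x).mono fun w hw => ?_
  simp only [generic, mem_compl_iff, mem_ofPred_eq] at hw
  push Not at hw
  obtain ⟨δ, hδ⟩ := hw
  exact ⟨δ, hδ.symm⟩

theorem generic_add {x : Fin 3 → ℂ} (w : ℂ) (μ : DualLat) :
    w + ev μ x ∈ generic x ↔ w ∈ generic x := by
  constructor
  · intro h δ hδ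
    exact h (δ + μ) (by rw [ev_add, hδ])
  · intro h δ hδ
    exact h (δ - μ) (by rw [ev_sub, ← hδ]; ring)

theorem generic_neg {x : Fin 3 → ℂ} (w : ℂ) : -w ∈ generic x ↔ w ∈ generic x := by
  constructor
  · intro h δ hδ
    exact h (-δ) (by rw [ev_neg, hδ])
  · intro h δ hδ
    exact h (-δ) (by rw [ev_neg, ← hδ, neg_neg])

theorem generic_smul {x : Fin 3 → ℂ} {t : ℂ} (ht : t ≠ 0) (w : ℂ) :
    t * w ∈ generic (t • x) ↔ w ∈ generic x := by
  simp only [generic, mem_ofPred_eq, ev_smul]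
  refine forall_congr' fun δ => ?_
  rw [Ne, mul_right_inj' ht]

theorem generic_actC (g : Matrix.SpecialLinearGroup (Fin 3) ℤ) {x : Fin 3 → ℂ} (w : ℂ) :
    w ∈ generic (actC g x) ↔ w ∈ generic x := by
  constructor
  · intro h δ hδ
    exact h (δ ᵥ* (g⁻¹).1) (by rw [ev_vecMul_inv, hδ])
  · intro h δ hδ
    exact h (δ ᵥ* g.1) (by rw [ev_vecMul, hδ])

theorem theta0_ne_zero (f : Framing) (a : Prim) (j : ℤ) {w : ℂ} {x : Fin 3 → ℂ}
    (hw : w ∈ generic x) (hx : 0 < nuv a.1 x) :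
    theta0 ((w + j * ev (f.basis a 0) x) / ev (f.basis a 2) x)
      (ev (f.basis a 1) x / ev (f.basis a 2) x) ≠ 0 := by
  have hx' : 0 < (ev (f.basis a 1) x * star (ev (f.basis a 2) x)).im := by
    rwa [im_ev_mul_conj, f.cross_eq]
  have h0 : ev (f.basis a 2) x ≠ 0 := by
    intro h; rw [h] at hx'; simp at hx'
  rw [Ne, theta0_eq_zero_iff _ (div_im_pos_iff.2 hx')]
  rintro ⟨p, q, h⟩
  refine hw (p • f.basis a 1 + q • f.basis a 2 - j • f.basis a 0) ?_
  rw [ev_sub, ev_add, ev_zsmul, ev_zsmul, ev_zsmul]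
  field_simp at h
  linear_combination h

theorem lineNorm_pos (f : Framing) (a : Prim) (j : ℤ) {w : ℂ} {x : Fin 3 → ℂ}
    (hw : w ∈ generic x) (hx : 0 < nuv a.1 x) : 0 < lineNorm f a j w x := by
  have := theta0_ne_zero f a j hw hx
  rw [lineNorm, latNorm, thetaNorm]
  have := h2_pos ((w + j * ev (f.basis a 0) x) / ev (f.basis a 2) x)
    (ev (f.basis a 1) x / ev (f.basis a 2) x)
  positivity

theorem lineNorm_add (f : Framing) (a : Prim) (j : ℤ) (w : ℂ) {x : Fin 3 → ℂ}
    (hx : 0 < nuv a.1 x) (μ : DualLat) :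
    lineNorm f a j (w + ev μ x) x = lineNorm f a (j + μ ⬝ᵥ a.1) w x := by
  have h1 := lineNorm_eq f a (δ := j • f.basis a 0) (f.cross_eq a) (w + ev μ x) hx
  have h2 := lineNorm_eq f a (δ := μ + j • f.basis a 0) (f.cross_eq a) w hx
  rw [smul_dotProduct, f.first] at h1
  rw [add_dotProduct, smul_dotProduct, f.first] at h2
  simp only [smul_eq_mul, mul_one] at h1 h2
  rw [add_comm j, h1, h2, ev_add, add_assoc]

/-! ### The norm of the gamma function of a wedge -/

/-- The hermitian norm squared of the quotient of two wedge products. -/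
def wedgeNorm (a b γ α β : DualLat) (i k : ℤ) (w : ℂ) (x : Fin 3 → ℂ) : ℝ :=
  ‖wedgeProd a b γ i k w x / wedgeProd b a (-γ) k i w x‖ ^ 2 *
    Real.exp (-(2 * Real.pi / 3) * boxSum a b γ α β (1 - i) (1 - k) w x)

namespace IsWedge

section Lattice

variable {a b γ ε ε' η η' α β : DualLat} {s : ℤ} (h : IsWedge a b γ ε ε' η η' s) {w : ℂ}
  {x : Fin 3 → ℂ} (hxa : 0 < nuv a x) (hxb : 0 < nuv b x)

include h hxa hxb

theorem wedgeProd_ne_zero_of_generic (hw : w ∈ generic x) (i k : ℤ) :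
    wedgeProd a b γ i k w x ≠ 0 :=
  h.wedgeProd_ne_zero hxa hxb fun δ _ => hw δ

theorem wedgeNorm_pos (hw : w ∈ generic x) (i k : ℤ) : 0 < wedgeNorm a b γ α β i k w x := by
  have h1 := h.wedgeProd_ne_zero_of_generic hxa hxb hw i k
  have h2 := h.symm.wedgeProd_ne_zero_of_generic hxb hxa hw k i
  exact mul_pos (pow_pos (norm_pos_iff.2 (div_ne_zero h1 h2)) 2) (Real.exp_pos _)

theorem wedgeNorm_swap (hw : w ∈ generic x) (i k : ℤ) :
    wedgeNorm b a (-γ) β α k i w x = (wedgeNorm a b γ α β i k w x)⁻¹ := by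
  have h1 := h.wedgeProd_ne_zero_of_generic hxa hxb hw i k
  have h2 := h.symm.wedgeProd_ne_zero_of_generic hxb hxa hw k i
  rw [wedgeNorm, wedgeNorm, h.boxSum_swap _ _ _ _ _ hxa, neg_neg, mul_inv, ← Real.exp_neg,
    mul_neg, ← inv_pow, ← norm_inv, inv_div]

/-- Adding μ(x) to w shifts the quadrants by -μ and the box by μ; the box starts at (1 - i, 1 - k)
so that both shifts are recorded by i and k. -/
theorem wedgeNorm_translate (i k : ℤ) (μ : DualLat) : wedgeNorm a b γ α β i k (w + ev μ x) x =
    wedgeNorm a b γ α β (i - μ ⬝ᵥ a) (k - μ ⬝ᵥ b) w x := by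
  rw [wedgeNorm, wedgeNorm, h.wedgeProd_translate hxa, h.symm.wedgeProd_translate hxb,
    h.boxSum_translate _ _ _ _ _ hxa, sub_sub_eq_add_sub, sub_sub_eq_add_sub,
    add_sub_right_comm, add_sub_right_comm]

theorem wedgeNorm_neg (hp : IsWedgePair a b α β) :
    wedgeNorm a b γ α β 1 1 (-w) x = (wedgeNorm a b γ α β 0 0 w x)⁻¹ := by
  rw [wedgeNorm, wedgeNorm, h.wedgeProd_neg hxa, h.symm.wedgeProd_neg hxb, neg_neg,
    h.boxSum_neg hp _ _ _ hxa hxb, mul_inv, ← Real.exp_neg, ← inv_pow, ← norm_inv, inv_div]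
  norm_num

end Lattice

variable {a b : Prim} {γ ε ε' η η' α β : DualLat} {s : ℤ} (h : IsWedge a.1 b.1 γ ε ε' η η' s)
  (f : Framing) (hp : IsWedgePair a.1 b.1 α β) {w : ℂ} {x : Fin 3 → ℂ} (hxa : 0 < nuv a.1 x)
  (hxb : 0 < nuv b.1 x)

include h hp hxa hxb

/-- With z = (δ(x) - w)/γ(x) and τ = ε(x)/γ(x), the numerator changes by the Pochhammer symbol at τ
- z and the denominator by the one at z. Together they form θ₀(z, τ), and the change 3 R2 of the
weight is exactly its hermitian weight. -/
theorem wedgeNorm_step_left (hw : w ∈ generic x) (i k : ℤ) : wedgeNorm a.1 b.1 γ α β i k w x =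
    wedgeNorm a.1 b.1 γ α β (i + 1) k w x * lineNorm f a (-i) w x := by
  obtain ⟨δ, hi, hk, hk'⟩ := h.exists_window i k
  have hγ := h.ev_ne_zero hxa
  have hτ := h.im_eps_div_pos hxa
  have e1 := h.wedgeProd_step_left hxa hxb w hi hk hk'
  have e2 := h.symm.wedgeProd_step_right hxb hxa w hi hk hk'
  rw [neg_neg] at e2
  -- The quadrant and the box move in opposite directions, so the row of the box is represented by
  -- the reflected form ε - δ, which lies in the window starting at 1 - k.
  have e3 := h.boxSum_step_left hp (-i) (1 - k) w hxa hxb (δ := ε - δ)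
    (by rw [sub_dotProduct, h.eps_dot, hi, zero_sub])
    (by rw [sub_dotProduct, h.eps_dot']; omega) (by rw [sub_dotProduct, h.eps_dot']; omega)
  have e4 : R2 ((w + ev (ε - δ) x) / ev γ x).im (ev ε x / ev γ x).im =
      R2 ((ev δ x - w) / ev γ x).im (ev ε x / ev γ x).im := by
    rw [← R2_add_self hτ.ne', ← Complex.neg_im, ← Complex.add_im, ev_sub]
    congr 2
    ring
  have e5 : lineNorm f a (-i) w x = thetaNorm ((ev δ x - w) / ev γ x) (ev ε x / ev γ x) := by
    have := lineNorm_eq f a (δ := -δ) h.crossA w hxa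
    rw [neg_dotProduct, hi] at this
    rw [this, latNorm, ← thetaNorm_neg _ hτ, ev_neg]
    congr 1
    ring
  rw [e4] at e3
  rw [wedgeNorm, wedgeNorm, e5, thetaNorm, h2_eq, theta0_eq _ hτ, e1, e2,
    show 1 - (i + 1) = -i by ring, show 1 - i = -i + 1 by ring, e3]
  have hq := right_ne_zero_of_mul
    (e2 ▸ h.symm.wedgeProd_ne_zero_of_generic hxb hxa hw k (i + 1))
  have hq' := norm_ne_zero_iff.2 hq
  rw [mul_add, Real.exp_add]
  simp only [norm_div, norm_mul]
  rw [show -(2 * Real.pi / 3) * (3 * R2 ((ev δ x - w) / ev γ x).im (ev ε x / ev γ x).im) =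
    -(2 * Real.pi) * R2 ((ev δ x - w) / ev γ x).im (ev ε x / ev γ x).im by ring]
  field_simp

theorem wedgeNorm_step_right (hw : w ∈ generic x) (i k : ℤ) :
    wedgeNorm a.1 b.1 γ α β i (k + 1) w x =
      wedgeNorm a.1 b.1 γ α β i k w x * lineNorm f b (-k) w x := by
  have h1 := h.symm.wedgeNorm_step_left f hp.symm hxb hxa hw k i
  rw [h.wedgeNorm_swap hxa hxb hw, h.wedgeNorm_swap hxa hxb hw] at h1
  have h2 := (h.wedgeNorm_pos hxa hxb (α := α) (β := β) hw i k).ne'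
  have h3 := (h.wedgeNorm_pos hxa hxb (α := α) (β := β) hw i (k + 1)).ne'
  field_simp at h1
  exact h1

theorem wedgeNorm_eq (hw : w ∈ generic x) (m n : ℤ) : wedgeNorm a.1 b.1 γ α β (1 - m) (1 - n) w x =
    wedgeNorm a.1 b.1 γ α β 1 1 w x * (zprod m fun j => lineNorm f a j w x) /
      zprod n fun j => lineNorm f b j w x := by
  have hA : ∀ j, lineNorm f a j w x ≠ 0 := fun j => (lineNorm_pos f a j hw hxa).ne'
  have hB : ∀ j, lineNorm f b j w x ≠ 0 := fun j => (lineNorm_pos f b j hw hxb).ne'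
  have h1 : ∀ m k : ℤ, wedgeNorm a.1 b.1 γ α β (1 - m) k w x =
      wedgeNorm a.1 b.1 γ α β 1 k w x * zprod m fun j => lineNorm f a j w x := by
    intro m k
    have hs : ∀ m : ℤ, wedgeNorm a.1 b.1 γ α β (1 - (m + 1)) k w x =
        wedgeNorm a.1 b.1 γ α β (1 - m) k w x * lineNorm f a m w x := by
      intro m
      have := h.wedgeNorm_step_left f hp hxa hxb hw (-m) k
      rwa [neg_neg, neg_add_eq_sub, ← sub_sub_cancel 1 (-m), sub_neg_eq_add, add_comm 1 m] at this
    induction m using Int.induction_on with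
    | zero => simp [zprod_zero]
    | succ m ih => rw [hs, ih, zprod_add_one hA, mul_assoc]
    | pred m ih =>
      have e := hs (-m - 1)
      have z := zprod_add_one hA (-m - 1)
      rw [sub_add_cancel] at e z
      rw [ih, z, ← mul_assoc] at e
      exact (mul_right_cancel₀ (hA _) e).symm
  have h2 : ∀ n i : ℤ, wedgeNorm a.1 b.1 γ α β i 1 w x =
      wedgeNorm a.1 b.1 γ α β i (1 - n) w x * zprod n fun j => lineNorm f b j w x := by
    intro n i
    have hs : ∀ n : ℤ, wedgeNorm a.1 b.1 γ α β i (1 - n) w x =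
        wedgeNorm a.1 b.1 γ α β i (1 - (n + 1)) w x * lineNorm f b n w x := by
      intro n
      have := h.wedgeNorm_step_right f hp hxa hxb hw i (-n)
      rwa [neg_neg, neg_add_eq_sub, ← sub_sub_cancel 1 (-n), sub_neg_eq_add, add_comm 1 n] at this
    induction n using Int.induction_on with
    | zero => simp [zprod_zero]
    | succ n ih => rw [ih, hs, zprod_add_one hB]; ring
    | pred n ih =>
      have e := hs (-n - 1)
      have z := zprod_add_one hB (-n - 1)
      rw [sub_add_cancel] at e z
      rw [ih, e, z]
      have := hB (-n - 1)
      field_simp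
  rw [h1, h2 n, mul_right_comm, mul_div_cancel_right₀ _ (zprod_ne_zero hB n)]

end IsWedge

/-! ### The wedge of two primitive vectors -/

theorem exists_vecMul_iff (γ : DualLat) (g : Matrix.SpecialLinearGroup (Fin 3) ℤ) (δ δ' : DualLat) :
    (∃ k : ℤ, δ ᵥ* (g⁻¹).1 = δ' ᵥ* (g⁻¹).1 + k • (γ ᵥ* (g⁻¹).1)) ↔
      ∃ k : ℤ, δ = δ' + k • γ := by
  refine exists_congr fun k => ?_
  rw [← Matrix.smul_vecMul, ← Matrix.add_vecMul]
  constructor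
  · intro hk
    have := congrArg (fun v => v ᵥ* g.1) hk
    simpa only [Matrix.vecMul_vecMul, ← Matrix.SpecialLinearGroup.coe_mul, inv_mul_cancel,
      Matrix.SpecialLinearGroup.coe_one, Matrix.vecMul_one] using this
  · rintro rfl; rfl

namespace IsWedge

variable {a b γ ε ε' η η' : DualLat} {s : ℤ} (h : IsWedge a b γ ε ε' η η' s)

include h

theorem dirVec_eq : dirVec a b = γ := by
  -- The number 1 = η · (ε × γ) is an integral combination of the entries of γ.
  have h1 : Finset.univ.gcd γ = 1 := by
    rw [← Finset.normalize_gcd, normalize_eq_one, isUnit_iff_dvd_one, ← h.dotA, ← h.crossA,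
      dotProduct_three, cross_zero_apply, cross_one_apply, cross_two_apply]
    have hd : ∀ i, Finset.univ.gcd γ ∣ γ i := fun i => Finset.gcd_dvd (Finset.mem_univ i)
    have e0 := hd 0
    have e1 := hd 1
    have e2 := hd 2
    refine dvd_add (dvd_add ?_ ?_) ?_ <;> refine Dvd.dvd.mul_left (dvd_sub ?_ ?_) _ <;>
      exact Dvd.dvd.mul_left (by assumption) _
  have h2 : Finset.univ.gcd (s • γ) = s := by
    have := Finset.gcd_mul_left (s := Finset.univ) (f := γ) (a := s)
    rw [h1, mul_one, Int.normalize_of_nonneg h.pos.le] at this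
    exact this
  ext i
  rw [dirVec, ← h.smul_eq, h2, Pi.smul_apply, smul_eq_mul, Int.mul_ediv_cancel_left _ h.pos.ne']

theorem map (g : Matrix.SpecialLinearGroup (Fin 3) ℤ) : IsWedge (g.1 *ᵥ a) (g.1 *ᵥ b)
    (γ ᵥ* (g⁻¹).1) (ε ᵥ* (g⁻¹).1) (ε' ᵥ* (g⁻¹).1) (η ᵥ* (g⁻¹).1) (η' ᵥ* (g⁻¹).1) s where
  crossA := by rw [cross_vecMul, inv_inv, h.crossA]
  crossB := by rw [← Matrix.neg_vecMul, cross_vecMul, inv_inv, h.crossB]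
  pos := h.pos
  smul_eq := by rw [cross_mulVec, ← h.smul_eq, Matrix.smul_vecMul]
  dotA := by rw [vecMul_inv_dotProduct_mulVec, h.dotA]
  dotB := by rw [vecMul_inv_dotProduct_mulVec, h.dotB]

theorem wedgeProd_map (g : Matrix.SpecialLinearGroup (Fin 3) ℤ) (i k : ℤ) (w : ℂ)
    {x : Fin 3 → ℂ} (hxa : 0 < nuv a x) :
    wedgeProd (g.1 *ᵥ a) (g.1 *ᵥ b) (γ ᵥ* (g⁻¹).1) i k w (actC g x) =
      wedgeProd a b γ i k w x := by
  have hγ : ev (γ ᵥ* (g⁻¹).1) (actC g x) ≠ 0 := by rw [ev_vecMul_inv]; exact h.ev_ne_zero hxa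
  obtain ⟨h1, h2, h3⟩ := modSet_transport (γ := γ ᵥ* (g⁻¹).1) (γ' := γ)
    (S := quadrant (g.1 *ᵥ a) (g.1 *ᵥ b) i k)
    (S' := quadrant a b i k) h.quadrant_add (fun δ => δ ᵥ* (g⁻¹).1)
    (fun δ hδ => by
      rw [quadrant, mem_ofPred_eq, vecMul_inv_dotProduct_mulVec, vecMul_inv_dotProduct_mulVec]
      exact hδ)
    (exists_vecMul_iff γ g)
    (fun δ hδ => ⟨δ ᵥ* g.1, by
      rw [quadrant, mem_ofPred_eq, ← Matrix.dotProduct_mulVec, ← Matrix.dotProduct_mulVec]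
      exact hδ, by
      rw [Matrix.vecMul_vecMul, ← Matrix.SpecialLinearGroup.coe_mul, mul_inv_cancel]
      simp⟩)
  rw [wedgeProd, tprod_modSet_eq (wedgeFactor_add hγ _) _ h1 h2 h3, wedgeProd]
  refine tprod_congr fun q => ?_
  rw [wedgeFactor, wedgeFactor, ev_vecMul_inv, ev_vecMul_inv]

theorem boxSum_map (g : Matrix.SpecialLinearGroup (Fin 3) ℤ) (α β : DualLat) (m n : ℤ) (w : ℂ)
    {x : Fin 3 → ℂ} (hxa : 0 < nuv a x) :
    boxSum (g.1 *ᵥ a) (g.1 *ᵥ b) (γ ᵥ* (g⁻¹).1) (α ᵥ* (g⁻¹).1) (β ᵥ* (g⁻¹).1) m n w (actC g x) =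
      boxSum a b γ α β m n w x := by
  have hx : 0 < nuv (g.1 *ᵥ a) (actC g x) := by rwa [nuv_mulVec g a x h.crossA]
  rw [(h.map g).boxSum_transport (γ' := γ) (S := box a b α β m n) hx w h.box_add
    (fun δ => δ ᵥ* (g⁻¹).1)
    (fun δ hδ => by
      rw [box, mem_ofPred_eq]
      simp only [vecMul_inv_dotProduct_mulVec]
      exact hδ)
    (exists_vecMul_iff γ g)
    (fun δ hδ => ⟨δ ᵥ* g.1, by
      rw [box, mem_ofPred_eq] at hδ ⊢
      simp only [vecMul_inv_dotProduct_mulVec] at hδ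
      rw [← Matrix.dotProduct_mulVec, ← Matrix.dotProduct_mulVec]
      exact hδ, by
      rw [Matrix.vecMul_vecMul, ← Matrix.SpecialLinearGroup.coe_mul, mul_inv_cancel]
      simp⟩), boxSum]
  refine finsum_congr fun q => ?_
  simp only [boxTerm, ev_vecMul_inv]

end IsWedge

theorem IsWedgePair.map {a b : Lat} {α β : DualLat} (h : IsWedgePair a b α β)
    (g : Matrix.SpecialLinearGroup (Fin 3) ℤ) :
    IsWedgePair (g.1 *ᵥ a) (g.1 *ᵥ b) (α ᵥ* (g⁻¹).1) (β ᵥ* (g⁻¹).1) := by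
  simp only [IsWedgePair, vecMul_inv_dotProduct_mulVec]
  exact h

/-- A primitive γ in the kernel of a has coprime coordinates p, q in the framing basis, and Bézout's
identity completes it to an oriented basis. -/
theorem exists_cross_eq (f : Framing) (a : Prim) {γ : DualLat} (h : γ ⬝ᵥ a.1 = 0)
    (hγ : ∀ d : ℤ, (∀ i, d ∣ γ i) → IsUnit d) : ∃ ε : DualLat, crossProduct ε γ = a.1 := by
  obtain ⟨p, q, hpq⟩ := exists_eq_of_dotProduct_eq_zero f a h
  have hc : IsCoprime q p := by
    rw [Int.isCoprime_iff_gcd_eq_one]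
    have h1 := hγ (Int.gcd q p) fun i => by
      rw [hpq, Pi.add_apply, Pi.smul_apply, Pi.smul_apply]
      exact dvd_add ((Int.gcd_dvd_right q p).mul_right _) ((Int.gcd_dvd_left q p).mul_right _)
    exact Nat.isUnit_iff.1 (Int.ofNat_isUnit.1 h1)
  obtain ⟨r, t, hrt⟩ := hc
  refine ⟨r • f.basis a 1 - t • f.basis a 2, ?_⟩
  rw [hpq, ← f.cross_eq a]
  have hr : r * q + t * p = 1 := hrt
  ext i
  fin_cases i <;>
  simp only [Fin.zero_eta, Fin.mk_one, Fin.reduceFinMk, cross_zero_apply, cross_one_apply,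
    cross_two_apply, Pi.add_apply, Pi.sub_apply, Pi.smul_apply, smul_eq_mul]
  · linear_combination hr * ((f.basis a) 1 1 * (f.basis a) 2 2 - (f.basis a) 1 2 * (f.basis a) 2 1)
  · linear_combination hr * ((f.basis a) 1 2 * (f.basis a) 2 0 - (f.basis a) 1 0 * (f.basis a) 2 2)
  · linear_combination hr * ((f.basis a) 1 0 * (f.basis a) 2 1 - (f.basis a) 1 1 * (f.basis a) 2 0)

/-- If a × b = 0, primitivity leaves only b = ±a, and b = -a would give the linear form of Im x × Re
x opposite signs at a and b. -/
theorem cross_ne_zero (f : Framing) {a b : Prim} (hab : a ≠ b) {x : Fin 3 → ℂ}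
    (hxa : 0 < nuv a.1 x) (hxb : 0 < nuv b.1 x) : crossProduct a.1 b.1 ≠ 0 := by
  intro h0
  have h1 := cross_cross_right (f.basis a 0) a.1 b.1
  rw [h0, map_zero, f.first, one_smul, eq_comm, sub_eq_zero] at h1
  rcases b.2 _ _ h1.symm with h2 | h2
  · rw [h2, one_smul] at h1
    exact hab (Subtype.ext h1)
  · rw [← h1, h2, nuv_zsmul] at hxb
    push_cast at hxb
    linarith

theorem exists_isWedge (f : Framing) {a b : Prim} (hab : a ≠ b) {x : Fin 3 → ℂ}
    (hxa : 0 < nuv a.1 x) (hxb : 0 < nuv b.1 x) :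
    ∃ ε ε' η η' s, IsWedge a.1 b.1 (dirVec a.1 b.1) ε ε' η η' s := by
  have h0 := cross_ne_zero f hab hxa hxb
  set s := Finset.univ.gcd (crossProduct a.1 b.1) with hs
  have hs0 : 0 < s := by
    refine lt_of_le_of_ne ?_ ?_
    · rw [hs, ← Finset.normalize_gcd]
      exact Int.nonneg_of_normalize_eq_self (normalize_idem _)
    · intro he
      apply h0
      ext i
      exact Finset.gcd_eq_zero_iff.1 (hs.symm.trans he.symm) i (Finset.mem_univ i)
  have hsm : s • dirVec a.1 b.1 = crossProduct a.1 b.1 := by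
    ext i
    exact Int.mul_ediv_cancel' (Finset.gcd_dvd (Finset.mem_univ i))
  have hprim : ∀ d : ℤ, (∀ i, d ∣ dirVec a.1 b.1 i) → IsUnit d := by
    intro d hd
    have h1 : s * d ∣ s := by
      nth_rewrite 2 [hs]
      refine Finset.dvd_gcd fun i _ => ?_
      rw [← hsm]
      exact mul_dvd_mul_left s (hd i)
    rw [isUnit_iff_dvd_one]
    exact (mul_dvd_mul_iff_left hs0.ne').1 (by rwa [mul_one])
  have hA : dirVec a.1 b.1 ⬝ᵥ a.1 = 0 := by
    have h1 : (s • dirVec a.1 b.1) ⬝ᵥ a.1 = 0 := by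
      rw [hsm, dotProduct_comm]; exact dot_self_cross _ _
    rw [smul_dotProduct] at h1
    exact (smul_eq_zero.1 h1).resolve_left hs0.ne'
  have hB : (-dirVec a.1 b.1) ⬝ᵥ b.1 = 0 := by
    have h1 : (s • dirVec a.1 b.1) ⬝ᵥ b.1 = 0 := by
      rw [hsm, dotProduct_comm]; exact dot_cross_self _ _
    rw [smul_dotProduct] at h1
    rw [neg_dotProduct, (smul_eq_zero.1 h1).resolve_left hs0.ne', neg_zero]
  obtain ⟨ε, hε⟩ := exists_cross_eq f a hA hprim
  obtain ⟨ε', hε'⟩ := exists_cross_eq f b hB fun d hd => hprim d fun i => by simpa using hd i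
  exact ⟨ε, ε', f.basis a 0, f.basis b 0, s, hε, hε', hs0, hsm, f.first a, f.first b⟩

/-! ### The norm of the gamma cochain -/

open Classical in
/-- The hermitian norm squared of `Γ_{a,b}`. -/
def pairNorm (a b : Prim) (w : ℂ) (x : Fin 3 → ℂ) : ℝ :=
  if a = b then 1 else ‖wedgeGamma a.1 b.1 w x‖ ^ 2 * Real.exp (-(2 * Real.pi / 3) *
    boxSum a.1 b.1 (dirVec a.1 b.1) (wedgeAlpha a.1 b.1) (wedgeBeta a.1 b.1) 0 0 w x)

theorem pairNorm_self (a : Prim) (w : ℂ) (x : Fin 3 → ℂ) : pairNorm a a w x = 1 := if_pos rfl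

section

variable (f : Framing) {a b : Prim} {x : Fin 3 → ℂ} (hxa : 0 < nuv a.1 x) (hxb : 0 < nuv b.1 x)

include f hxa hxb

theorem isWedgePair_of_ne (hab : a ≠ b) :
    IsWedgePair a.1 b.1 (wedgeAlpha a.1 b.1) (wedgeBeta a.1 b.1) :=
  isWedgePair_wedge _ _ (cross_ne_zero f hab hxa hxb)

omit f in
-- By `boxSum_congr` the pair (α, β) may be chosen freely. This is essential for symmetry and
-- equivariance, which do not respect one fixed choice.
theorem IsWedge.pairNorm_eq {γ ε ε' η η' α β : DualLat} {s : ℤ}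
    (h : IsWedge a.1 b.1 γ ε ε' η η' s) (hab : a ≠ b) (hp : IsWedgePair a.1 b.1 α β) (w : ℂ) :
    pairNorm a b w x = wedgeNorm a.1 b.1 γ α β 1 1 w x := by
  have hq : IsWedgePair a.1 b.1 (wedgeAlpha a.1 b.1) (wedgeBeta a.1 b.1) :=
    isWedgePair_wedge _ _ (by rw [← h.smul_eq]; exact smul_ne_zero h.pos.ne' h.dir_ne_zero)
  rw [pairNorm, if_neg hab, h.wedgeGamma_eq hxa h.dirVec_eq, h.dirVec_eq,
    h.boxSum_congr hq hp _ _ _ hxa hxb, wedgeNorm, sub_self]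

theorem pairNorm_pos {w : ℂ} (hw : w ∈ generic x) : 0 < pairNorm a b w x := by
  by_cases hab : a = b
  · rw [hab, pairNorm_self]; exact one_pos
  · obtain ⟨ε, ε', η, η', s, h⟩ := exists_isWedge f hab hxa hxb
    rw [h.pairNorm_eq hxa hxb hab (isWedgePair_of_ne f hxa hxb hab)]
    exact h.wedgeNorm_pos hxa hxb hw 1 1

theorem pairNorm_swap {w : ℂ} (hw : w ∈ generic x) : pairNorm b a w x = (pairNorm a b w x)⁻¹ := by
  by_cases hab : a = b
  · rw [hab, pairNorm_self, inv_one]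
  · obtain ⟨ε, ε', η, η', s, h⟩ := exists_isWedge f hab hxa hxb
    have hp := isWedgePair_of_ne f hxa hxb hab
    rw [h.pairNorm_eq hxa hxb hab hp, h.symm.pairNorm_eq hxb hxa (Ne.symm hab) hp.symm,
      h.wedgeNorm_swap hxa hxb hw]

theorem pairNorm_translate {w : ℂ} (hw : w ∈ generic x) (μ : DualLat) :
    pairNorm a b (w + ev μ x) x = pairNorm a b w x *
      (zprod (μ ⬝ᵥ a.1) fun j => lineNorm f a j w x) /
      zprod (μ ⬝ᵥ b.1) fun j => lineNorm f b j w x := by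
  by_cases hab : a = b
  · subst hab
    rw [pairNorm_self, pairNorm_self, one_mul, div_self]
    exact zprod_ne_zero (fun j => (lineNorm_pos f a j hw hxa).ne') _
  · obtain ⟨ε, ε', η, η', s, h⟩ := exists_isWedge f hab hxa hxb
    have hp := isWedgePair_of_ne f hxa hxb hab
    rw [h.pairNorm_eq hxa hxb hab hp, h.pairNorm_eq hxa hxb hab hp,
      h.wedgeNorm_translate hxa hxb, h.wedgeNorm_eq f hp hxa hxb hw]

/-- The reflection w ↦ -w inverts the norm up to one step for a and one for b. The error is a Čech
coboundary, which disappears in products around a triangle. -/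
theorem pairNorm_neg {w : ℂ} (hw : w ∈ generic x) : pairNorm a b w x * pairNorm a b (-w) x =
    lineNorm f b 0 w x / lineNorm f a 0 w x := by
  have hA := (lineNorm_pos f a 0 hw hxa).ne'
  have hB := (lineNorm_pos f b 0 hw hxb).ne'
  by_cases hab : a = b
  · subst hab
    rw [pairNorm_self, pairNorm_self, one_mul, div_self hA]
  · obtain ⟨ε, ε', η, η', s, h⟩ := exists_isWedge f hab hxa hxb
    have hp := isWedgePair_of_ne f hxa hxb hab
    have h1 := h.wedgeNorm_eq f hp hxa hxb hw 1 1
    have h2 := (h.wedgeNorm_pos hxa hxb hw 1 1 (α := wedgeAlpha a.1 b.1)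
      (β := wedgeBeta a.1 b.1)).ne'
    have hz : ∀ g : ℤ → ℝ, zprod 1 g = g 0 := fun g => by
      rw [zprod, show Finset.Ico (0 : ℤ) 1 = {0} from rfl, show Finset.Ico (1 : ℤ) 0 = ∅ from rfl]
      simp
    rw [sub_self, hz, hz] at h1
    rw [h.pairNorm_eq hxa hxb hab hp, h.pairNorm_eq hxa hxb hab hp, h.wedgeNorm_neg hxa hxb hp, h1]
    field_simp

theorem pairNorm_smul (g : Matrix.SpecialLinearGroup (Fin 3) ℤ) {a' b' : Prim}
    (ha : a'.1 = g.1 *ᵥ a.1) (hb : b'.1 = g.1 *ᵥ b.1) (w : ℂ) :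
    pairNorm a' b' w (actC g x) = pairNorm a b w x := by
  by_cases hab : a = b
  · subst hab
    rw [pairNorm_self, show a' = b' from Subtype.ext (ha.trans hb.symm), pairNorm_self]
  · have hab' : a' ≠ b' := by
      intro hab'
      apply hab
      have := congrArg (fun v : Prim => (g⁻¹).1 *ᵥ v.1) hab'
      simp only [ha, hb, Matrix.mulVec_mulVec, ← Matrix.SpecialLinearGroup.coe_mul,
        inv_mul_cancel, Matrix.SpecialLinearGroup.coe_one, Matrix.one_mulVec] at this
      exact Subtype.ext this
    obtain ⟨ε, ε', η, η', s, h⟩ := exists_isWedge f hab hxa hxb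
    have hp := isWedgePair_of_ne f hxa hxb hab
    have hm := h.map g
    have hpm := hp.map g
    rw [← ha, ← hb] at hm hpm
    have hxa' : 0 < nuv a'.1 (actC g x) := by rwa [ha, nuv_mulVec g _ x h.crossA]
    have hxb' : 0 < nuv b'.1 (actC g x) := by rwa [hb, nuv_mulVec g _ x h.crossB]
    rw [h.pairNorm_eq hxa hxb hab hp, hm.pairNorm_eq hxa' hxb' hab' hpm, wedgeNorm, wedgeNorm, ha,
      hb, h.wedgeProd_map g _ _ _ hxa, ← Matrix.neg_vecMul, h.symm.wedgeProd_map g _ _ _ hxb,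
      h.boxSum_map g _ _ _ _ _ hxa]

end

/-- The framing is not equivariant: the bases at a and at g a are unrelated. The independence in
`lineNorm_eq` makes this harmless. -/
theorem lineNorm_smul (f : Framing) {a a' : Prim} (g : Matrix.SpecialLinearGroup (Fin 3) ℤ)
    (ha : a'.1 = g.1 *ᵥ a.1) (j : ℤ) (w : ℂ) {x : Fin 3 → ℂ} (hx : 0 < nuv a.1 x) :
    lineNorm f a' j w (actC g x) = lineNorm f a j w x := by
  have h1 : crossProduct (f.basis a' 1 ᵥ* g.1) (f.basis a' 2 ᵥ* g.1) = a.1 := by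
    rw [cross_vecMul, f.cross_eq, ha, Matrix.mulVec_mulVec, ← Matrix.SpecialLinearGroup.coe_mul]
    simp
  have h2 := lineNorm_eq f a (δ := j • f.basis a' 0 ᵥ* g.1) h1 w hx
  rw [smul_dotProduct, ← Matrix.dotProduct_mulVec, ← ha, f.first] at h2
  rw [smul_eq_mul, mul_one] at h2
  rw [h2, lineNorm, ev_zsmul, ev_vecMul, ev_vecMul, ev_vecMul]

/-! ### The norm of the gamma cochain is a Čech cocycle -/

/-- For any vector ν, the combination (ν·c) a×b + (ν·a) b×c + (ν·b) c×a equals det(a,b,c) ν, and ν =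
Im x × Re x is orthogonal to x. -/
theorem nuv_cross_cyclic (a b c : Lat) (x : Fin 3 → ℂ) :
    (nuv c x : ℂ) * ev (crossProduct a b) x + nuv a x * ev (crossProduct b c) x -
      nuv b x * ev (crossProduct a c) x = 0 := by
  simp only [nuv, ev_eq, cross_zero_apply, cross_one_apply, cross_two_apply]
  apply Complex.ext <;> simp <;> ring

/-- This and `im_sq_eq` split powers of Im z into a harmonic part and a multiple of |z|². -/
theorem im_pow_three_eq (z : ℂ) :
    z.im ^ 3 = 3 / 4 * Complex.normSq z * z.im - 1 / 4 * (z ^ 3).im := by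
  rw [Complex.normSq_apply, pow_succ z 2, sq z]
  simp only [Complex.mul_im, Complex.mul_re]
  ring

theorem im_sq_eq (z : ℂ) : z.im ^ 2 = 1 / 2 * Complex.normSq z - 1 / 2 * (z ^ 2).re := by
  rw [Complex.normSq_apply, sq z]
  simp only [Complex.mul_re]
  ring

theorem re_neg_I_mul (z : ℂ) : (-Complex.I * z).re = z.im := by simp

theorem wedgeNorm_one_one (a b γ α β : DualLat) (w : ℂ) (x : Fin 3 → ℂ) :
    wedgeNorm a b γ α β 1 1 w x =
      ‖wedgeProd a b γ 1 1 w x‖ ^ 2 / ‖wedgeProd b a (-γ) 1 1 w x‖ ^ 2 *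
        Real.exp (-(2 * Real.pi / 3) * boxSum a b γ α β 0 0 w x) := by
  rw [wedgeNorm, norm_div, div_pow, sub_self]

namespace IsWedge

variable {a b γ ε ε' η η' α β : DualLat} {s : ℤ} (h : IsWedge a b γ ε ε' η η' s) {x : Fin 3 → ℂ}
  (hxa : 0 < nuv a x) (hxb : 0 < nuv b x)

include h hxa hxb

/-- The weight of a wedge is a harmonic polynomial up to a term that is a Čech coboundary. -/
theorem exists_boxSum_eq_re (hp : IsWedgePair a b α β) : ∃ p : ℂ → ℂ, Differentiable ℂ p ∧
    ∀ w, boxSum a b γ α β 0 0 w x = (p w).re - 3 / 4 * Complex.normSq w *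
      ((w * star (ev (crossProduct a b) x)).im / (nuv a x * nuv b x) +
        (1 / nuv a x - 1 / nuv b x)) := by
  obtain ⟨c₁, c₀, hc⟩ := h.exists_boxSum_eq hp hxa hxb
  have hγ := h.ev_ne_zero hxa
  obtain ⟨u, hu⟩ : ∃ u, u = ev γ x := ⟨_, rfl⟩
  have hs : (s : ℝ) ≠ 0 := by exact_mod_cast h.pos.ne'
  have hN : Complex.normSq u ≠ 0 := by rw [hu]; exact (Complex.normSq_pos.2 hγ).ne'
  have ha := hxa.ne'
  have hb := hxb.ne'
  rw [← h.smul_eq, ev_zsmul, ← hu]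
  rw [← hu] at hc
  -- With v = w times the conjugate of γ(x), Im(w/γ(x)) is Im v / |γ(x)|². The witness collects the
  -- harmonic parts of (Im v)³ and (Im v)² together with the terms of lower degree.
  refine ⟨fun w => ((s / (4 * Complex.normSq u * nuv a x * nuv b x) : ℝ) : ℂ) *
      (-Complex.I * (w * star u) ^ 3) +
      ((3 / (4 * Complex.normSq u) * (1 / nuv a x - 1 / nuv b x) : ℝ) : ℂ) * (w * star u) ^ 2 +
      ((c₁ / Complex.normSq u : ℝ) : ℂ) * (-Complex.I * (w * star u)) + (c₀ : ℝ), by fun_prop,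
      fun w => ?_⟩
  have e1 := im_pow_three_eq (w * star u)
  have e2 := im_sq_eq (w * star u)
  have e3 : Complex.normSq (w * star u) = Complex.normSq w * Complex.normSq u := by
    rw [Complex.normSq_mul, Complex.star_def, Complex.normSq_conj]
  have e4 : (w * star ((s : ℂ) * u)).im = s * (w * star u).im := by
    simp [Complex.mul_im]; ring
  rw [e3] at e1 e2
  rw [hc, im_div_eq, div_pow, div_pow, e1, e2, e4]
  simp only [Complex.add_re, Complex.re_ofReal_mul, re_neg_I_mul, Complex.ofReal_re]
  field_simp
  ring

theorem differentiable_wedgeProd (i k : ℤ) : Differentiable ℂ fun w => wedgeProd a b γ i k w x := by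
  intro w
  have h1 := (h.differentiableOn_wedgeProd i k).differentiableAt
    ((isOpen_wedgeDom a b).mem_nhds (show (w, x) ∈ wedgeDom a b from ⟨hxa, hxb⟩))
  exact DifferentiableAt.comp (g := fun p : ℂ × (Fin 3 → ℂ) => wedgeProd a b γ i k p.1 p.2)
    (f := fun w => (w, x)) w h1 (by fun_prop)

theorem wedgeProd_zero_ne_zero : wedgeProd a b γ 1 1 0 x ≠ 0 :=
  h.wedgeProd_ne_zero hxa hxb fun _ hδ => h.ev_ne_zero_of_mem hxa hxb hδ

end IsWedge

/-- The quotient n of the two sides is invariant under all translations by δ(x), because the theta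
norms in `pairNorm_translate` form a coboundary. Once n is seen to be the norm squared of a
meromorphic function, Liouville's theorem and w ↦ -w give n = 1. -/
theorem pairNorm_mul (f : Framing) {a b c : Prim} {x : Fin 3 → ℂ} (hxa : 0 < nuv a.1 x)
    (hxb : 0 < nuv b.1 x) (hxc : 0 < nuv c.1 x) {w : ℂ} (hw : w ∈ generic x) :
    pairNorm a b w x * pairNorm b c w x = pairNorm a c w x := by
  by_cases hab : a = b
  · rw [hab, pairNorm_self, one_mul]
  by_cases hbc : b = c
  · rw [hbc, pairNorm_self, mul_one]
  by_cases hac : a = c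
  · subst hac
    rw [pairNorm_self, pairNorm_swap f hxa hxb hw, mul_inv_cancel₀ (pairNorm_pos f hxa hxb hw).ne']
  obtain ⟨ε, ε', η, η', s, h1⟩ := exists_isWedge f hab hxa hxb
  obtain ⟨_, _, _, _, _, h2⟩ := exists_isWedge f hbc hxb hxc
  obtain ⟨_, _, _, _, _, h3⟩ := exists_isWedge f hac hxa hxc
  have p1 := isWedgePair_of_ne f hxa hxb hab
  have p2 := isWedgePair_of_ne f hxb hxc hbc
  have p3 := isWedgePair_of_ne f hxa hxc hac
  obtain ⟨q1, d1, e1⟩ := h1.exists_boxSum_eq_re hxa hxb p1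
  obtain ⟨q2, d2, e2⟩ := h2.exists_boxSum_eq_re hxb hxc p2
  obtain ⟨q3, d3, e3⟩ := h3.exists_boxSum_eq_re hxa hxc p3
  obtain ⟨F, hF⟩ : ∃ F : ℂ → ℂ, F = fun w => wedgeProd a.1 b.1 (dirVec a.1 b.1) 1 1 w x *
    wedgeProd b.1 c.1 (dirVec b.1 c.1) 1 1 w x * wedgeProd c.1 a.1 (-dirVec a.1 c.1) 1 1 w x :=
    ⟨_, rfl⟩
  obtain ⟨G, hG⟩ : ∃ G : ℂ → ℂ, G = fun w => wedgeProd b.1 a.1 (-dirVec a.1 b.1) 1 1 w x *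
    wedgeProd c.1 b.1 (-dirVec b.1 c.1) 1 1 w x * wedgeProd a.1 c.1 (dirVec a.1 c.1) 1 1 w x :=
    ⟨_, rfl⟩
  have hFd : Differentiable ℂ F := by
    rw [hF]
    exact ((h1.differentiable_wedgeProd hxa hxb 1 1).fun_mul
      (h2.differentiable_wedgeProd hxb hxc 1 1)).fun_mul
      (h3.symm.differentiable_wedgeProd hxc hxa 1 1)
  have hGd : Differentiable ℂ G := by
    rw [hG]
    exact ((h1.symm.differentiable_wedgeProd hxb hxa 1 1).fun_mul
      (h2.symm.differentiable_wedgeProd hxc hxb 1 1)).fun_mul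
      (h3.differentiable_wedgeProd hxa hxc 1 1)
  have hG0 : G 0 ≠ 0 := by
    rw [hG]
    exact mul_ne_zero (mul_ne_zero (h1.symm.wedgeProd_zero_ne_zero hxb hxa)
      (h2.symm.wedgeProd_zero_ne_zero hxc hxb)) (h3.wedgeProd_zero_ne_zero hxa hxc)
  have hGg : ∀ w ∈ generic x, G w ≠ 0 := by
    intro w hw
    rw [hG]
    exact mul_ne_zero (mul_ne_zero (h1.symm.wedgeProd_ne_zero_of_generic hxb hxa hw 1 1)
      (h2.symm.wedgeProd_ne_zero_of_generic hxc hxb hw 1 1))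
      (h3.wedgeProd_ne_zero_of_generic hxa hxc hw 1 1)
  obtain ⟨q, hq⟩ : ∃ q : ℂ → ℂ, q = fun w => ((-(2 * Real.pi / 3) : ℝ) : ℂ) *
    (q1 w + q2 w - q3 w) := ⟨_, rfl⟩
  have hqd : Differentiable ℂ q := by rw [hq]; fun_prop
  obtain ⟨n, hn⟩ : ∃ n : ℂ → ℝ, ∀ w, n w =
    pairNorm a b w x * pairNorm b c w x / pairNorm a c w x := ⟨_, fun w => rfl⟩
  -- In the alternating sum of the three weights the parts 1/ν_a - 1/ν_b cancel trivially, and the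
  -- linear parts cancel by `nuv_cross_cyclic` divided by ν_a ν_b ν_c.
  have hharm : ∀ w : ℂ, (w * star (ev (crossProduct a.1 b.1) x)).im / (nuv a.1 x * nuv b.1 x) +
      (w * star (ev (crossProduct b.1 c.1) x)).im / (nuv b.1 x * nuv c.1 x) -
      (w * star (ev (crossProduct a.1 c.1) x)).im / (nuv a.1 x * nuv c.1 x) = 0 := by
    intro w
    have h0 := congrArg (fun z => (w * star z).im) (nuv_cross_cyclic a.1 b.1 c.1 x)
    simp only [star_zero, mul_zero, Complex.zero_im, star_sub, star_add, star_mul, mul_add,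
      mul_sub, Complex.star_def, Complex.conj_ofReal, Complex.add_im, Complex.sub_im,
      ← mul_assoc, Complex.im_mul_ofReal] at h0
    have := hxa.ne'
    have := hxb.ne'
    have := hxc.ne'
    simp only [Complex.star_def]
    field_simp
    linarith
  have hnFG : ∀ w, n w = ‖F w‖ ^ 2 * Real.exp (q w).re / ‖G w‖ ^ 2 := by
    intro w
    have hre : (q w).re = -(2 * Real.pi / 3) *
        (boxSum a.1 b.1 (dirVec a.1 b.1) (wedgeAlpha a.1 b.1) (wedgeBeta a.1 b.1) 0 0 w x +
        boxSum b.1 c.1 (dirVec b.1 c.1) (wedgeAlpha b.1 c.1) (wedgeBeta b.1 c.1) 0 0 w x -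
        boxSum a.1 c.1 (dirVec a.1 c.1) (wedgeAlpha a.1 c.1) (wedgeBeta a.1 c.1) 0 0 w x) := by
      rw [hq, e1, e2, e3, Complex.re_ofReal_mul, Complex.sub_re, Complex.add_re]
      linear_combination (-(2 * Real.pi / 3)) * 3 / 4 * Complex.normSq w * hharm w
    rw [hn, hre, h1.pairNorm_eq hxa hxb hab p1, h2.pairNorm_eq hxb hxc hbc p2,
      h3.pairNorm_eq hxa hxc hac p3, wedgeNorm_one_one, wedgeNorm_one_one,
      wedgeNorm_one_one, hF, hG, mul_sub, mul_add, Real.exp_sub, Real.exp_add]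
    simp only [norm_mul, mul_pow, div_eq_mul_inv, mul_inv, inv_inv]
    ring
  have hper : ∀ w ∈ generic x, ∀ μ : DualLat, n (w + ev μ x) = n w := by
    intro w hw μ
    rw [hn, hn, pairNorm_translate f hxa hxb hw, pairNorm_translate f hxb hxc hw,
      pairNorm_translate f hxa hxc hw]
    have z1 := zprod_ne_zero (fun j => (lineNorm_pos f a j hw hxa).ne') (μ ⬝ᵥ a.1)
    have z2 := zprod_ne_zero (fun j => (lineNorm_pos f b j hw hxb).ne') (μ ⬝ᵥ b.1)
    have z3 := zprod_ne_zero (fun j => (lineNorm_pos f c j hw hxc).ne') (μ ⬝ᵥ c.1)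
    have := (pairNorm_pos f hxa hxc hw).ne'
    field_simp
  have hloc : ∀ w₁, G w₁ ≠ 0 → ∃ C, ∀ᶠ w in 𝓝 w₁, n w ≤ C := by
    intro w₁ hw₁
    have hc : ContinuousAt n w₁ := by
      have : n = fun w => ‖F w‖ ^ 2 * Real.exp (q w).re / ‖G w‖ ^ 2 := funext hnFG
      rw [this]
      refine ContinuousAt.div ?_ ?_ (by simpa using hw₁)
      · have := hFd.continuous
        have := hqd.continuous
        fun_prop
      · have := hGd.continuous
        fun_prop
    exact ⟨n w₁ + 1, hc.eventually_le_const (lt_add_one _)⟩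
  obtain ⟨C, hC⟩ := exists_const_of_lattice_periodic hFd hGd hqd (countable_compl_generic x)
    (n := n) (u₁ := ev ε x) (u₂ := ev (dirVec a.1 b.1) x)
    (fun w hw => hGg w (notMem_compl_iff.1 hw)) (fun w _ => hnFG w) (h1.im_eps_div_pos hxa).ne'
    (fun w => not_congr (generic_add w ε)) (fun w => not_congr (generic_add w (dirVec a.1 b.1)))
    (fun w hw => hper w (notMem_compl_iff.1 hw) _) (fun w hw => hper w (notMem_compl_iff.1 hw) _)
    -- G can vanish only at the points μ(x). Translation by μ(x) moves such a point to 0, where G is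
    -- nonzero and n is continuous.
    (by
      intro w₀
      by_cases hw₀ : w₀ ∈ generic x
      · obtain ⟨C, hC⟩ := hloc w₀ (hGg w₀ hw₀)
        exact ⟨C, hC.mono fun w hw _ => hw⟩
      · simp only [generic, mem_ofPred_eq] at hw₀
        push Not at hw₀
        obtain ⟨μ, rfl⟩ := hw₀
        obtain ⟨C, hC⟩ := hloc 0 hG0
        have ht : Tendsto (fun w => w - ev μ x) (𝓝 (ev μ x)) (𝓝 0) := by
          have : Continuous fun w : ℂ => w - ev μ x := by fun_prop
          simpa using this.tendsto (ev μ x)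
        refine ⟨C, (ht.eventually hC).mono fun w hw hwg => ?_⟩
        have hg : w - ev μ x ∈ generic x := by
          rw [← generic_add _ μ, sub_add_cancel]; exact notMem_compl_iff.1 hwg
        have := hper _ hg μ
        rw [sub_add_cancel] at this
        rwa [this])
  have hn1 : n w = C := hC w (notMem_compl_iff.2 hw)
  have hn2 : n (-w) = C := hC (-w) (notMem_compl_iff.2 ((generic_neg w).2 hw))
  -- The ratios in `pairNorm_neg` cancel around the triangle. Since n is constant and positive, it
  -- is 1.
  have hmul : n w * n (-w) = 1 := by
    have k1 := pairNorm_neg f hxa hxb hw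
    have k2 := pairNorm_neg f hxb hxc hw
    have k3 := pairNorm_neg f hxa hxc hw
    have l1 := (lineNorm_pos f a 0 hw hxa).ne'
    have l2 := (lineNorm_pos f b 0 hw hxb).ne'
    have l3 := (lineNorm_pos f c 0 hw hxc).ne'
    rw [hn, hn, div_mul_div_comm, mul_mul_mul_comm, k1, k2, k3]
    field_simp
  have hpos : 0 < n w := by
    rw [hn]
    exact div_pos (mul_pos (pairNorm_pos f hxa hxb hw) (pairNorm_pos f hxb hxc hw))
      (pairNorm_pos f hxa hxc hw)
  have h1' : n w = 1 := by
    rw [hn2, ← hn1] at hmul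
    nlinarith
  rwa [hn, div_eq_one_iff_eq (pairNorm_pos f hxa hxc hw).ne'] at h1'

/-! ### Functions on `X₃` -/

theorem mem_cone_of_nuv_pos {a : Lat} {x : Fin 3 → ℂ} (h : 0 < nuv a x) (w : ℂ) :
    (w, x) ∈ cone := by
  rintro ⟨c, r, hr⟩
  simp only at hr
  rw [hr, nuv] at h
  simp only [Complex.mul_im, Complex.mul_re, Complex.ofReal_re, Complex.ofReal_im] at h
  ring_nf at h
  exact lt_irrefl _ h

theorem X3.mk_eq_mk_iff {p q : cone} : X3.mk p = X3.mk q ↔ ∃ t : ℂˣ, (t : ℂ) • p.1 = q.1 :=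
  Quotient.eq (r := coneSetoid)

theorem X3.continuous_mk : Continuous X3.mk := continuous_quotient_mk'

theorem X3.isQuotientMap_mk : IsQuotientMap X3.mk := isQuotientMap_quotient_mk'

theorem smul_mem_cone {t : ℂ} (ht : t ≠ 0) {p : ℂ × (Fin 3 → ℂ)} :
    t • p ∈ cone ↔ p ∈ cone := by
  refine not_congr ⟨fun ⟨c, r, h⟩ => ⟨t⁻¹ * c, r, ?_⟩, fun ⟨c, r, h⟩ => ⟨t * c, r, ?_⟩⟩
  · have h1 := congrArg (fun v => t⁻¹ • v) h
    simp only [Prod.smul_snd, smul_smul, inv_mul_cancel₀ ht, one_smul] at h1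
    rw [h1]
    ext i
    simp [mul_assoc]
  · rw [Prod.smul_snd, h]
    ext i
    simp [mul_assoc]

theorem X3.isOpenMap_mk : IsOpenMap X3.mk := by
  intro A hA
  rw [← X3.isQuotientMap_mk.isOpen_preimage]
  have h : X3.mk ⁻¹' (X3.mk '' A) = ⋃ t : ℂˣ, {p : cone |
      (⟨(t : ℂ) • p.1, (smul_mem_cone t.ne_zero).2 p.2⟩ : cone) ∈ A} := by
    ext p
    simp only [mem_preimage, mem_image, mem_iUnion, mem_ofPred_eq]
    constructor
    · rintro ⟨q, hq, hqp⟩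
      obtain ⟨t, ht⟩ := X3.mk_eq_mk_iff.1 hqp.symm
      exact ⟨t, by simpa only [ht] using hq⟩
    · rintro ⟨t, ht⟩
      exact ⟨_, ht, (X3.mk_eq_mk_iff.2 ⟨t, rfl⟩).symm⟩
  rw [h]
  refine isOpen_iUnion fun t => hA.preimage ?_
  exact (continuous_subtype_val.const_smul (t : ℂ)).subtype_mk _

theorem pull_mk {M : Type*} [Zero M] (T : X3 → M) (p : cone) : pull T p.1 = T (X3.mk p) :=
  dif_pos p.2

theorem pull_of_mem {M : Type*} [Zero M] (T : X3 → M) {p : ℂ × (Fin 3 → ℂ)} (h : p ∈ cone) :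
    pull T p = T (X3.mk ⟨p, h⟩) := dif_pos h

theorem pull_smul {M : Type*} [Zero M] (T : X3 → M) {t : ℂ} (ht : t ≠ 0)
    (p : ℂ × (Fin 3 → ℂ)) : pull T (t • p) = pull T p := by
  by_cases h : p ∈ cone
  · rw [pull_of_mem T h, pull_of_mem T ((smul_mem_cone ht).2 h)]
    exact congrArg T (X3.mk_eq_mk_iff.2 ⟨Units.mk0 t ht, rfl⟩).symm
  · rw [pull, pull, dif_neg h, dif_neg (mt (smul_mem_cone ht).1 h)]

/-- `V'` is the set of the points of `X₃` with `x ∈ U`. -/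
structure IsDom (V' : Set X3) (U : Set (Fin 3 → ℂ)) : Prop where
  isOpen : IsOpen U
  mem_iff : ∀ p : cone, X3.mk p ∈ V' ↔ p.1.2 ∈ U
  cone_of_mem : ∀ (w : ℂ), ∀ x ∈ U, (w, x) ∈ cone

theorem IsDom.inter {V₁ V₂ : Set X3} {U₁ U₂ : Set (Fin 3 → ℂ)} (h₁ : IsDom V₁ U₁)
    (h₂ : IsDom V₂ U₂) : IsDom (V₁ ∩ V₂) (U₁ ∩ U₂) where
  isOpen := h₁.isOpen.inter h₂.isOpen
  mem_iff p := and_congr (h₁.mem_iff p) (h₂.mem_iff p)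
  cone_of_mem w x hx := h₁.cone_of_mem w x hx.1

/-- The set `U_a^+`, described by an inequality. -/
def xDom (a : Prim) : Set (Fin 3 → ℂ) := {x | 0 < nuv a.1 x}

theorem isDom_V (f : Framing) (a : Prim) : IsDom (V a) (xDom a) where
  isOpen := isOpen_lt continuous_const (continuous_nuv a.1)
  mem_iff p := by
    rw [xDom, mem_ofPred_eq, ← mem_UPlus_iff f]
    refine ⟨?_, fun h => ⟨p, h, rfl⟩⟩
    rintro ⟨q, hq, hqp⟩
    obtain ⟨t, ht⟩ := X3.mk_eq_mk_iff.1 hqp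
    rw [mem_ofPred_eq, mem_UPlus_iff f] at hq
    rw [mem_UPlus_iff f, ← ht, Prod.smul_snd, nuv_smul]
    exact mul_pos (Complex.normSq_pos.2 t.ne_zero) hq
  cone_of_mem w _ hx := mem_cone_of_nuv_pos hx w

/-- The image in `X₃` of the generic points. -/
def genX : Set X3 := X3.mk '' {p | p.1.1 ∈ generic p.1.2}

theorem mk_mem_genX {p : cone} : X3.mk p ∈ genX ↔ p.1.1 ∈ generic p.1.2 := by
  refine ⟨?_, fun h => ⟨p, h, rfl⟩⟩
  rintro ⟨q, hq, hqp⟩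
  obtain ⟨t, ht⟩ := X3.mk_eq_mk_iff.1 hqp
  rw [← ht]
  exact (generic_smul t.ne_zero _).2 hq

namespace IsDom

variable {V' : Set X3} {U : Set (Fin 3 → ℂ)} (h : IsDom V' U)

include h

theorem preim_eq : preim V' = univ ×ˢ U := by
  ext ⟨w, x⟩
  constructor
  · rintro ⟨hc, hp⟩
    exact ⟨trivial, (h.mem_iff _).1 hp⟩
  · rintro ⟨-, hx⟩
    exact ⟨h.cone_of_mem w x hx, (h.mem_iff _).2 hx⟩

theorem preimage_mk : X3.mk ⁻¹' V' = {p : cone | p.1.2 ∈ U} := by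
  ext p; exact h.mem_iff p

theorem isOpen_set : IsOpen V' := by
  rw [← X3.isQuotientMap_mk.isOpen_preimage, h.preimage_mk]
  exact h.isOpen.preimage (continuous_snd.comp continuous_subtype_val)

theorem continuousOn {M : Type*} [Zero M] [TopologicalSpace M] {T : X3 → M}
    (hT : ContinuousOn (pull T) (preim V')) : ContinuousOn T V' := by
  rw [X3.isQuotientMap_mk.continuousOn_isOpen_iff h.isOpen_set, h.preimage_mk]
  rw [h.preim_eq] at hT
  refine (hT.comp (f := fun p : cone => p.1) continuous_subtype_val.continuousOn
    fun p hp => ⟨trivial, hp⟩).congr fun p _ => (pull_mk T p).symm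

/-- On every line x = const the non-generic points are countable, so the generic ones are dense in
that line. -/
theorem closure_of_slices {W : Set X3} (hW : ∀ (p : cone), p.1.1 ∈ generic p.1.2 → p.1.2 ∈ U →
    X3.mk p ∈ W) : V' ⊆ closure W := by
  intro y hy
  obtain ⟨⟨⟨w, x⟩, hc⟩, rfl⟩ := Quotient.exists_rep y
  have hx : x ∈ U := (h.mem_iff ⟨(w, x), hc⟩).1 hy
  have hcont : Continuous fun ζ : ℂ => X3.mk ⟨(ζ, x), h.cone_of_mem ζ x hx⟩ :=
    X3.continuous_mk.comp (Continuous.subtype_mk (by fun_prop) _)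
  have hd : w ∈ closure (generic x) := by
    have := (countable_compl_generic x).dense_compl ℝ w
    rwa [compl_compl] at this
  have hm : MapsTo (fun ζ : ℂ => X3.mk ⟨(ζ, x), h.cone_of_mem ζ x hx⟩) (generic x) W :=
    fun ζ hζ => hW ⟨(ζ, x), h.cone_of_mem ζ x hx⟩ hζ hx
  have key := map_mem_closure hcont hd hm
  exact key

theorem subset_closure_genX : V' ⊆ closure (V' ∩ genX) :=
  h.closure_of_slices fun p hp hx => ⟨(h.mem_iff p).2 hx, mk_mem_genX.2 hp⟩

theorem eqOn_of_genX {M : Type*} [TopologicalSpace M] [T2Space M] {S T : X3 → M}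
    (hS : ContinuousOn S V') (hT : ContinuousOn T V') (hST : ∀ y ∈ V', y ∈ genX → S y = T y) :
    EqOn S T V' :=
  EqOn.of_subset_closure (fun y hy => hST y hy.1 hy.2) hS hT inter_subset_left
    h.subset_closure_genX

end IsDom

theorem MeroEqOn.eqOn {V' : Set X3} {R S T : X3 → ℂ} (hR : ContinuousOn R V') (hT : ContinuousOn T V')
    (hRS : MeroEqOn V' R S) (hTS : MeroEqOn V' T S) : EqOn R T V' := by
  obtain ⟨W₁, ho₁, hs₁, hc₁, he₁⟩ := hRS
  obtain ⟨W₂, ho₂, hs₂, hc₂, he₂⟩ := hTS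
  refine EqOn.of_subset_closure (s := W₁ ∩ W₂) (fun y hy => (he₁ hy.1).trans (he₂ hy.2).symm)
    hR hT (inter_subset_left.trans hs₁) ?_
  intro y hy
  rw [mem_closure_iff]
  intro O hO hyO
  obtain ⟨z, hzO, hz⟩ := mem_closure_iff.1 (hc₁ hy) O hO hyO
  obtain ⟨u, hu, hu'⟩ := mem_closure_iff.1 (hc₂ (hs₁ hz)) (O ∩ W₁) (hO.inter ho₁) ⟨hzO, hz⟩
  exact ⟨u, hu.1, hu.2, hu'⟩

/-- `S` is a quotient of holomorphic functions without zeros at the generic points. -/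
def IsMero (U : Set (Fin 3 → ℂ)) (S : X3 → ℂ) : Prop :=
  ∃ F G : ℂ × (Fin 3 → ℂ) → ℂ, DifferentiableOn ℂ F (univ ×ˢ U) ∧
    DifferentiableOn ℂ G (univ ×ˢ U) ∧ (∀ x ∈ U, ∀ w, pull S (w, x) = F (w, x) / G (w, x)) ∧
    ∀ x ∈ U, ∀ w ∈ generic x, F (w, x) ≠ 0 ∧ G (w, x) ≠ 0

namespace IsMero

variable {U : Set (Fin 3 → ℂ)} {S T : X3 → ℂ}

theorem mono {U' : Set (Fin 3 → ℂ)} (h : IsMero U S) (hU : U' ⊆ U) : IsMero U' S := by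
  obtain ⟨F, G, hF, hG, hS, h0⟩ := h
  exact ⟨F, G, hF.mono (prod_mono_right hU), hG.mono (prod_mono_right hU),
    fun x hx => hS x (hU hx), fun x hx => h0 x (hU hx)⟩

theorem pull_mul (S T : X3 → ℂ) (p : ℂ × (Fin 3 → ℂ)) :
    pull (fun y => S y * T y) p = pull S p * pull T p := by
  by_cases h : p ∈ cone
  · simp only [pull_of_mem _ h]
  · simp only [pull, dif_neg h, mul_zero]

theorem pull_inv (S : X3 → ℂ) (p : ℂ × (Fin 3 → ℂ)) :
    pull (fun y => (S y)⁻¹) p = (pull S p)⁻¹ := by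
  by_cases h : p ∈ cone
  · simp only [pull_of_mem _ h]
  · simp only [pull, dif_neg h, inv_zero]

theorem mul (hS : IsMero U S) (hT : IsMero U T) : IsMero U fun y => S y * T y := by
  obtain ⟨F, G, hF, hG, hS, h0⟩ := hS
  obtain ⟨F', G', hF', hG', hT, h0'⟩ := hT
  refine ⟨fun p => F p * F' p, fun p => G p * G' p, hF.fun_mul hF', hG.fun_mul hG',
    fun x hx w => ?_, fun x hx w hw => ?_⟩
  · rw [pull_mul, hS x hx, hT x hx, div_mul_div_comm]
  · exact ⟨mul_ne_zero (h0 x hx w hw).1 (h0' x hx w hw).1,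
      mul_ne_zero (h0 x hx w hw).2 (h0' x hx w hw).2⟩

theorem inv (hS : IsMero U S) : IsMero U fun y => (S y)⁻¹ := by
  obtain ⟨F, G, hF, hG, hS, h0⟩ := hS
  exact ⟨G, F, hG, hF, fun x hx w => by rw [pull_inv, hS x hx, inv_div],
    fun x hx w hw => (h0 x hx w hw).symm⟩

theorem ne_zero {V' : Set X3} (hS : IsMero U S) (hV : IsDom V' U) {y : X3} (hy : y ∈ V')
    (hg : y ∈ genX) : S y ≠ 0 := by
  obtain ⟨F, G, hF, hG, hS, h0⟩ := hS
  obtain ⟨p, rfl⟩ := Quotient.exists_rep y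
  have hx := (hV.mem_iff p).1 hy
  have h1 := h0 _ hx p.1.1 (mk_mem_genX.1 hg)
  have h2 := hS _ hx p.1.1
  rw [pull_mk S p] at h2
  exact h2 ▸ div_ne_zero h1.1 h1.2

theorem comp_smul {g : ISL3} {U' : Set (Fin 3 → ℂ)} (hS : IsMero U S)
    (hc : ∀ x ∈ U', (0, x) ∈ cone) (hU : ∀ x ∈ U', actC g.lin x ∈ U) :
    IsMero U' fun y => S (g • y) := by
  obtain ⟨F, G, hF, hG, hS, h0⟩ := hS
  have hd : Differentiable ℂ fun p : ℂ × (Fin 3 → ℂ) => (p.1 - ev g.tr p.2, actC g.lin p.2) := by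
    have h1 : Differentiable ℂ fun p : ℂ × (Fin 3 → ℂ) => actC g.lin p.2 := by
      unfold actC Matrix.mulVec dotProduct
      fun_prop
    exact (differentiable_fst.fun_sub ((differentiable_ev g.tr).comp differentiable_snd)).prodMk h1
  have hm : MapsTo (fun p : ℂ × (Fin 3 → ℂ) => (p.1 - ev g.tr p.2, actC g.lin p.2))
    (univ ×ˢ U') (univ ×ˢ U) := fun p hp => ⟨trivial, hU _ hp.2⟩
  refine ⟨_, _, hF.comp hd.differentiableOn hm, hG.comp hd.differentiableOn hm,
    fun x hx w => ?_, fun x hx w hw => ?_⟩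
  -- Membership in `cone` does not involve w, so the hypothesis at w = 0 suffices.
  · have hwc : (w, x) ∈ cone := hc x hx
    rw [pull_of_mem _ hwc]
    change S (X3.mk (coneAct g ⟨(w, x), hwc⟩)) = _
    rw [← pull_mk S]
    exact hS _ (hU x hx) _
  · refine h0 _ (hU x hx) _ ?_
    rw [generic_actC, sub_eq_add_neg, ← ev_neg, generic_add]
    exact hw

end IsMero

/-! ### Extension over removable singularities on `X3` -/

/-- The equality is proved for the filters, so it also covers the points without a limit, where
`limUnder` is a default value; `extend` needs it everywhere. -/
theorem limUnder_pull_smul (S : X3 → ℂ) (t : ℂˣ) (w : ℂ) (x : Fin 3 → ℂ) :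
    (limUnder (𝓝[≠] ((t : ℂ) * w)) fun ζ => pull S (ζ, (t : ℂ) • x)) =
      limUnder (𝓝[≠] w) fun ζ => pull S (ζ, x) := by
  have h1 : 𝓝[≠] ((t : ℂ) * w) = map ((t : ℂ) * ·) (𝓝[≠] w) :=
    ((Homeomorph.mulLeft₀ (t : ℂ) t.ne_zero).map_punctured_nhds_eq w).symm
  rw [limUnder, limUnder, h1, Filter.map_map]
  congr 2
  ext ζ
  exact pull_smul S t.ne_zero (ζ, x)

/-- The extension of a meromorphic function by its limits along the lines `x = const`. -/
def extend (S : X3 → ℂ) : X3 → ℂ :=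
  X3.descend (fun w x => limUnder (𝓝[≠] w) fun ζ => pull S (ζ, x)) (limUnder_pull_smul S)

/-- A weight k with |S|² k = 1 at generic points bounds S locally, so the singularities of F/G are
removable. By density the identity persists for the extension, which therefore has no zeros and has
norm squared 1/k. -/
theorem extend_spec {V' : Set X3} {U : Set (Fin 3 → ℂ)} (h : IsDom V' U) {S : X3 → ℂ}
    (hS : IsMero U S) {k : X3 → ℝ} (hk : ContinuousOn k V') (hk0 : ∀ y ∈ V', 0 < k y)
    (hn : ∀ y ∈ V', y ∈ genX → ‖S y‖ ^ 2 * k y = 1) :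
    IsHolUnitOn V' (extend S) ∧ ContinuousOn (extend S) V' ∧
      (∀ y ∈ V', k y = (‖extend S y‖ ^ 2)⁻¹) ∧ MeroEqOn V' (extend S) S ∧
      ∀ y ∈ V', y ∈ genX → extend S y = S y := by
  have hne := fun y => hS.ne_zero h (y := y)
  obtain ⟨F, G, hF, hG, hS, h0⟩ := hS
  have hsl : ∀ {H : ℂ × (Fin 3 → ℂ) → ℂ}, DifferentiableOn ℂ H (univ ×ˢ U) → ∀ x ∈ U,
      Differentiable ℂ fun w => H (w, x) := by
    intro H hH x hx w
    have h1 : DifferentiableAt ℂ H (w, x) :=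
      hH.differentiableAt ((isOpen_univ.prod h.isOpen).mem_nhds ⟨trivial, hx⟩)
    exact h1.comp (f := fun w : ℂ => (w, x)) w (by fun_prop)
  have hpe : ∀ x ∈ U, ∀ w, pull (extend S) (w, x) =
      remQuot (fun ζ => F (ζ, x)) (fun ζ => G (ζ, x)) w := by
    intro x hx w
    rw [pull_of_mem _ (h.cone_of_mem w x hx), remQuot]
    change limUnder (𝓝[≠] w) (fun ζ => pull S (ζ, x)) = _
    congr 1
    exact funext fun ζ => hS x hx ζ
  have hc : ∀ x ∈ U, {w | G (w, x) = 0}.Countable := fun x hx =>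
    (countable_compl_generic x).mono fun w hw hg => (h0 x hx w hg).2 hw
  have hb : ∀ x ∈ U, ∀ w, ∃ C, ∀ᶠ ζ in 𝓝 w, ‖F (ζ, x)‖ ≤ C * ‖G (ζ, x)‖ := by
    intro x hx w
    have hkc : Continuous fun ζ : ℂ => k (X3.mk ⟨(ζ, x), h.cone_of_mem ζ x hx⟩) :=
      hk.comp_continuous (X3.continuous_mk.comp (Continuous.subtype_mk (by fun_prop) _))
        fun ζ => (h.mem_iff _).2 hx
    -- Near w the weight stays above half its value m, hence |F/G|² ≤ 1/m at generic points and |F|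
    -- ≤ √(1/m) |G| by continuity.
    obtain ⟨m, hm⟩ : ∃ m, m = k (X3.mk ⟨(w, x), h.cone_of_mem w x hx⟩) / 2 := ⟨_, rfl⟩
    have hkw := hk0 _ ((h.mem_iff ⟨(w, x), h.cone_of_mem w x hx⟩).2 hx)
    have hm0 : 0 < m := by rw [hm]; exact half_pos hkw
    have hO := isOpen_lt continuous_const hkc (f := fun _ => m)
    refine ⟨√(1 / m), ?_⟩
    filter_upwards [hO.mem_nhds (show m < k _ by rw [hm]; exact half_lt_self hkw)] with ζ hζ
    refine norm_sq_le_of_dense (hsl hF x hx).continuous (hsl hG x hx).continuous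
      (countable_compl_generic x) hO (fun ξ hξ hξg => ?_) ζ hζ
    have hg := notMem_compl_iff.1 hξg
    have h1 := hn _ ((h.mem_iff ⟨(ξ, x), h.cone_of_mem ξ x hx⟩).2 hx) (mk_mem_genX.2 hg)
    rw [← pull_mk S, hS x hx, norm_div, div_pow] at h1
    have hG0 : 0 < ‖G (ξ, x)‖ := norm_pos_iff.2 (h0 x hx ξ hg).2
    have hξ' : m ≤ k (X3.mk ⟨(ξ, x), h.cone_of_mem ξ x hx⟩) := le_of_lt hξ
    refine le_of_sq_le_sq ?_ (by positivity)
    rw [mul_pow, Real.sq_sqrt (by positivity), one_div, inv_mul_eq_div, le_div_iff₀ hm0]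
    rw [div_mul_eq_mul_div, div_eq_one_iff_eq (by positivity)] at h1
    rw [← h1]
    gcongr
  have hd : DifferentiableOn ℂ (pull (extend S)) (preim V') := by
    rw [h.preim_eq]
    exact (differentiableOn_remQuot_prod h.isOpen hF hG hc hb).congr
      fun p hp => hpe p.2 hp.2 p.1
  have hcont : ContinuousOn (extend S) V' := h.continuousOn hd.continuousOn
  have heq : ∀ p : cone, p.1.2 ∈ U → G p.1 ≠ 0 → extend S (X3.mk p) = S (X3.mk p) := by
    intro p hp hG0
    rw [← pull_mk (extend S), ← pull_mk S]
    change pull (extend S) (p.1.1, p.1.2) = pull S (p.1.1, p.1.2)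
    rw [hpe _ hp, remQuot_eq (hsl hF _ hp) (hsl hG _ hp) hG0, hS _ hp]
  have hgen : ∀ y ∈ V', y ∈ genX → extend S y = S y := by
    intro y hy hg
    obtain ⟨p, rfl⟩ := Quotient.exists_rep y
    have hx := (h.mem_iff p).1 hy
    exact heq p hx (h0 _ hx _ (mk_mem_genX.1 hg)).2
  have hnorm : EqOn (fun y => ‖extend S y‖ ^ 2 * k y) (fun _ => 1) V' :=
    h.eqOn_of_genX ((hcont.norm.pow 2).mul hk) continuousOn_const fun y hy hg => by
      rw [hgen y hy hg, hn y hy hg]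
  refine ⟨⟨fun y hy h0 => ?_, hd⟩, hcont, fun y hy => ?_, ?_, hgen⟩
  · have := hnorm hy
    simp [h0] at this
  · exact eq_inv_of_mul_eq_one_right (hnorm hy)
  -- The generic points do not form an open set; the set where G ≠ 0 is open and contains them.
  · refine ⟨X3.mk '' {p | p.1.2 ∈ U ∧ G p.1 ≠ 0}, X3.isOpenMap_mk _ ?_, ?_, ?_, ?_⟩
    · have hGc : IsOpen ((univ ×ˢ U) ∩ G ⁻¹' {0}ᶜ) :=
        hG.continuousOn.isOpen_inter_preimage (isOpen_univ.prod h.isOpen) isOpen_compl_singleton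
      convert hGc.preimage (continuous_subtype_val (p := fun p => p ∈ cone)) using 1
      ext p
      simp
    · rintro _ ⟨p, hp, rfl⟩
      exact (h.mem_iff p).2 hp.1
    · exact h.closure_of_slices fun p hp hx => ⟨p, ⟨hx, (h0 _ hx _ hp).2⟩, rfl⟩
    · rintro _ ⟨p, hp, rfl⟩
      exact heq p hp.1 hp.2

instance : ContinuousConstSMul ISL3 X3 where
  continuous_const_smul g := by
    refine Continuous.quotient_lift (X3.continuous_mk.comp (?_ : Continuous (coneAct g))) _
    refine Continuous.subtype_mk ?_ _
    have h1 : Continuous (ev g.tr) := (differentiable_ev g.tr).continuous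
    have h2 : Continuous (actC g.lin) := by unfold actC; fun_prop
    exact ((continuous_fst.sub (h1.comp continuous_snd)).prodMk
      (h2.comp continuous_snd)).comp continuous_subtype_val

theorem smul_mem_genX (g : ISL3) {y : X3} : g • y ∈ genX ↔ y ∈ genX := by
  obtain ⟨p, rfl⟩ := Quotient.exists_rep y
  change X3.mk (coneAct g p) ∈ genX ↔ X3.mk p ∈ genX
  rw [mk_mem_genX, mk_mem_genX]
  change p.1.1 - ev g.tr p.1.2 ∈ generic (actC g.lin p.1.2) ↔ _
  rw [generic_actC, sub_eq_add_neg, ← ev_neg, generic_add]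

/-! ### The gamma cochain and its hermitian weights on `X₃` -/

theorem Framing.im_pos (f : Framing) (a : Prim) {x : Fin 3 → ℂ} (hx : x ∈ xDom a) :
    0 < (ev (f.basis a 1) x / ev (f.basis a 2) x).im := by
  rw [div_im_pos_iff, im_ev_mul_conj, f.cross_eq]
  exact hx

theorem Framing.ev_ne_zero (f : Framing) (a : Prim) {x : Fin 3 → ℂ} (hx : x ∈ xDom a) :
    ev (f.basis a 2) x ≠ 0 := by
  intro h
  have := f.im_pos a hx
  rw [h] at this
  simp at this

theorem gammaCochain_c01_self (f : Framing) (a : Prim) : (gammaCochain f).c01 a a = fun _ => 1 :=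
  if_pos rfl

theorem gammaCochain_c01 (f : Framing) {a b : Prim} (hab : a ≠ b) (p : cone) :
    (gammaCochain f).c01 a b (X3.mk p) = wedgeGamma a.1 b.1 p.1.1 p.1.2 := by
  rw [gammaCochain]
  simp only [if_neg hab]
  rfl

theorem hermCochain_c01_self (f : Framing) (a : Prim) : (hermCochain f).c01 a a = fun _ => 1 :=
  if_pos rfl

theorem hermCochain_c01 (f : Framing) {a b : Prim} (hab : a ≠ b) :
    (hermCochain f).c01 a b = wedgeHerm a.1 b.1 (wedgeAlpha a.1 b.1) (wedgeBeta a.1 b.1) :=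
  if_neg hab

theorem isMero_one (U : Set (Fin 3 → ℂ)) (hU : ∀ (w : ℂ), ∀ x ∈ U, (w, x) ∈ cone) :
    IsMero U fun _ => 1 :=
  ⟨fun _ => 1, fun _ => 1, differentiableOn_const _, differentiableOn_const _,
    fun x hx w => by rw [pull_of_mem _ (hU w x hx), div_one],
    fun _ _ _ _ => ⟨one_ne_zero, one_ne_zero⟩⟩

theorem isMero_c01 (f : Framing) (a b : Prim) :
    IsMero (xDom a ∩ xDom b) ((gammaCochain f).c01 a b) := by
  have hdom := (isDom_V f a).inter (isDom_V f b)
  by_cases hab : a = b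
  · subst hab
    rw [gammaCochain_c01_self]
    exact isMero_one _ hdom.cone_of_mem
  -- A wedge is constructed from a common point. An empty intersection, as for b = -a, has nothing
  -- to prove.
  rcases (xDom a ∩ xDom b).eq_empty_or_nonempty with h0 | ⟨x₀, hx₀⟩
  · rw [h0]
    exact ⟨fun _ => 0, fun _ => 0, differentiableOn_const _, differentiableOn_const _,
      fun x hx => hx.elim, fun x hx => hx.elim⟩
  obtain ⟨ε, ε', η, η', s, h⟩ := exists_isWedge f hab hx₀.1 hx₀.2
  refine ⟨_, _, (h.differentiableOn_wedgeProd 1 1).mono fun p hp => hp.2,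
    (h.symm.differentiableOn_wedgeProd 1 1).mono fun p hp => hp.2.symm, fun x hx w => ?_,
    fun x hx w hw => ⟨h.wedgeProd_ne_zero_of_generic hx.1 hx.2 hw 1 1,
      h.symm.wedgeProd_ne_zero_of_generic hx.2 hx.1 hw 1 1⟩⟩
  rw [pull_of_mem _ (hdom.cone_of_mem w x hx), gammaCochain_c01 f hab]
  exact h.wedgeGamma_eq hx.1 rfl w

theorem differentiableOn_div {N D : ℂ × (Fin 3 → ℂ) → ℂ} {U : Set (ℂ × (Fin 3 → ℂ))}
    (hN : Differentiable ℂ N) (hD : Differentiable ℂ D) (h0 : ∀ p ∈ U, D p ≠ 0) :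
    DifferentiableOn ℂ (fun p => N p / D p) U := by
  simp only [div_eq_mul_inv]
  exact fun p hp => ((hN p).fun_mul
    (DifferentiableAt.fun_inv (hD p) (h0 p hp))).differentiableWithinAt

theorem isMero_c10 (f : Framing) (a : Prim) (g : ISL3) :
    IsMero (xDom a) ((gammaCochain f).c10 a g) := by
  have hd : ∀ j : ℤ, DifferentiableOn ℂ (fun p : ℂ × (Fin 3 → ℂ) =>
      theta0 ((p.1 + (j : ℂ) * ev (f.basis a 0) p.2) / ev (f.basis a 2) p.2)
        (ev (f.basis a 1) p.2 / ev (f.basis a 2) p.2)) (univ ×ˢ xDom a) := by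
    intro j
    have hev : ∀ δ, Differentiable ℂ fun p : ℂ × (Fin 3 → ℂ) => ev δ p.2 := fun δ =>
      (differentiable_ev δ).comp differentiable_snd
    have h1 := differentiableOn_div (U := univ ×ˢ xDom a)
      (differentiable_fst.fun_add ((hev (f.basis a 0)).const_mul (j : ℂ))) (hev (f.basis a 2))
      fun p hp => f.ev_ne_zero a hp.2
    have h2 := differentiableOn_div (U := univ ×ˢ xDom a) (hev (f.basis a 1)) (hev (f.basis a 2))
      fun p hp => f.ev_ne_zero a hp.2
    have hm : ∀ p ∈ univ ×ˢ xDom a, (((p.1 + (j : ℂ) * ev (f.basis a 0) p.2) /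
        ev (f.basis a 2) p.2, ev (f.basis a 1) p.2 / ev (f.basis a 2) p.2) : ℂ × ℂ) ∈
        {q : ℂ × ℂ | 0 < q.2.im} := fun p hp => f.im_pos a hp.2
    have key := DifferentiableOn.comp differentiableOn_theta0 (h1.prodMk h2) hm
    exact key
  obtain ⟨m, hm⟩ : ∃ m, m = (g.tr ᵥ* (g.lin⁻¹).1) ⬝ᵥ a.1 := ⟨_, rfl⟩
  have hp : ∀ u : Finset ℤ, DifferentiableOn ℂ (fun p : ℂ × (Fin 3 → ℂ) => ∏ j ∈ u,
      theta0 ((p.1 + (j : ℂ) * ev (f.basis a 0) p.2) / ev (f.basis a 2) p.2)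
        (ev (f.basis a 1) p.2 / ev (f.basis a 2) p.2)) (univ ×ˢ xDom a) := by
    intro u
    induction u using Finset.induction_on with
    | empty => exact (differentiableOn_const 1).congr fun p _ => Finset.prod_empty
    | insert j u hj ih =>
      exact ((hd j).fun_mul ih).congr fun p _ => Finset.prod_insert hj
  refine ⟨_, _, hp (Finset.Ico 0 m), hp (Finset.Ico m 0), fun x hx w => ?_,
    fun x hx w hw => ⟨Finset.prod_ne_zero_iff.2 fun j _ => theta0_ne_zero f a j hw hx,
      Finset.prod_ne_zero_iff.2 fun j _ => theta0_ne_zero f a j hw hx⟩⟩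
  rw [pull_of_mem _ ((isDom_V f a).cone_of_mem w x hx), hm]
  rfl

theorem norm_c01 (f : Framing) {a b : Prim} {p : cone} (ha : p.1.2 ∈ xDom a) (hb : p.1.2 ∈ xDom b) :
    ‖(gammaCochain f).c01 a b (X3.mk p)‖ ^ 2 * (hermCochain f).c01 a b (X3.mk p) =
      pairNorm a b p.1.1 p.1.2 := by
  by_cases hab : a = b
  · subst hab
    rw [gammaCochain_c01_self, hermCochain_c01_self, pairNorm_self]
    simp
  · obtain ⟨ε, ε', η, η', s, h⟩ := exists_isWedge f hab ha hb
    rw [gammaCochain_c01 f hab, hermCochain_c01 f hab, pairNorm, if_neg hab,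
      wedgeHerm_mk_eq h rfl (isWedgePair_of_ne f ha hb hab)]

theorem norm_c10 (f : Framing) (a : Prim) (g : ISL3) (p : cone) :
    ‖(gammaCochain f).c10 a g (X3.mk p)‖ ^ 2 * (hermCochain f).c10 a g (X3.mk p) =
      zprod ((g.tr ᵥ* (g.lin⁻¹).1) ⬝ᵥ a.1) fun j => lineNorm f a j p.1.1 p.1.2 := by
  change ‖zprod _ _‖ ^ 2 * zprod _ _ = _
  rw [norm_zprod_sq, ← zprod_mul]
  rfl

theorem contDiff_ev (δ : DualLat) : ContDiff ℝ ∞ fun p : ℂ × (Fin 3 → ℂ) => ev δ p.2 := by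
  unfold ev; fun_prop

theorem contDiffOn_im_div {N D : ℂ × (Fin 3 → ℂ) → ℂ} {U : Set (ℂ × (Fin 3 → ℂ))}
    (hN : ContDiff ℝ ∞ N) (hD : ContDiff ℝ ∞ D) (h0 : ∀ p ∈ U, D p ≠ 0) :
    ContDiffOn ℝ ∞ (fun p => (N p / D p).im) U := by
  simp only [div_eq_mul_inv]
  exact Complex.imCLM.contDiff.comp_contDiffOn (hN.contDiffOn.mul (hD.contDiffOn.inv h0))

theorem contDiffOn_R3 {ζ t s : ℂ × (Fin 3 → ℂ) → ℝ} {U : Set (ℂ × (Fin 3 → ℂ))}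
    (hζ : ContDiffOn ℝ ∞ ζ U) (ht : ContDiffOn ℝ ∞ t U) (hs : ContDiffOn ℝ ∞ s U)
    (ht0 : ∀ p ∈ U, t p ≠ 0) (hs0 : ∀ p ∈ U, s p ≠ 0) :
    ContDiffOn ℝ ∞ (fun p => R3 (ζ p) (t p) (s p)) U := by
  have hti := ht.inv ht0
  have hsi := hs.inv hs0
  have e : (fun p => R3 (ζ p) (t p) (s p)) = fun p => ζ p ^ 3 * (t⁻¹ p * s⁻¹ p) -
      3 / 2 * (t⁻¹ p + s⁻¹ p) * ζ p ^ 2 +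
      (1 / 2 * t p * s⁻¹ p + 1 / 2 * s p * t⁻¹ p + 3 / 2) * ζ p - 1 / 4 * (t p + s p) := by
    ext p
    simp only [R3, Pi.inv_apply]
    field_simp
  rw [e]
  fun_prop

theorem isPosSmoothOn_c01 (f : Framing) (a b : Prim) :
    IsPosSmoothOn (V a ∩ V b) ((hermCochain f).c01 a b) := by
  have hdom := (isDom_V f a).inter (isDom_V f b)
  by_cases hab : a = b
  · subst hab
    rw [hermCochain_c01_self]
    refine ⟨fun _ _ => one_pos, ?_⟩
    rw [hdom.preim_eq]
    exact (contDiffOn_const (c := (1 : ℝ))).congr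
      fun p hp => pull_of_mem _ (hdom.cone_of_mem p.1 p.2 hp.2)
  rcases (xDom a ∩ xDom b).eq_empty_or_nonempty with h0 | ⟨x₀, hx₀⟩
  · constructor
    · intro y hy
      obtain ⟨p, rfl⟩ := Quotient.exists_rep y
      have := (hdom.mem_iff p).1 hy
      rw [h0] at this
      exact this.elim
    · rw [hdom.preim_eq, h0, prod_empty]
      exact fun p hp => hp.elim
  obtain ⟨ε, ε', η, η', s, h⟩ := exists_isWedge f hab hx₀.1 hx₀.2
  have hp := isWedgePair_of_ne f hx₀.1 hx₀.2 hab
  rw [hermCochain_c01 f hab]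
  constructor
  · intro y hy
    obtain ⟨p, rfl⟩ := Quotient.exists_rep y
    exact (wedgeHerm_mk_eq h rfl hp p).symm ▸ Real.exp_pos _
  · rw [hdom.preim_eq]
    have := (h.finite_modSet_box hp 0 0).fintype
    have hb : ContDiffOn ℝ ∞ (fun p : ℂ × (Fin 3 → ℂ) =>
        boxSum a.1 b.1 (dirVec a.1 b.1) (wedgeAlpha a.1 b.1) (wedgeBeta a.1 b.1) 0 0 p.1 p.2)
        (univ ×ˢ (xDom a ∩ xDom b)) := by
      simp only [boxSum, finsum_eq_sum_of_fintype]
      refine ContDiffOn.sum fun q _ => contDiffOn_R3 ?_ ?_ ?_ ?_ ?_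
      · exact contDiffOn_im_div (contDiff_fst.add (contDiff_ev _)) (contDiff_ev _)
          fun p hp => h.ev_ne_zero hp.2.1
      · exact contDiffOn_im_div (contDiff_ev _) (contDiff_ev _) fun p hp => h.ev_ne_zero hp.2.1
      · exact contDiffOn_im_div (contDiff_ev _) (contDiff_ev _) fun p hp => h.ev_ne_zero hp.2.1
      · exact fun p hx => (h.im_pair_ne_zero hp hx.2.1 hx.2.2).1
      · exact fun p hx => (h.im_pair_ne_zero hp hx.2.1 hx.2.2).2
    refine ((contDiffOn_const (c := -(2 * Real.pi / 3))).mul hb).exp.congr fun p hx => ?_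
    rw [pull_of_mem _ (hdom.cone_of_mem p.1 p.2 hx.2), wedgeHerm_mk_eq h rfl hp]

theorem isPosSmoothOn_c10 (f : Framing) (a : Prim) (g : ISL3) :
    IsPosSmoothOn (V a) ((hermCochain f).c10 a g) := by
  have hdom := isDom_V f a
  constructor
  · intro y _
    obtain ⟨p, rfl⟩ := Quotient.exists_rep y
    exact zprod_pos (fun j => h2_pos _ _) _
  · rw [hdom.preim_eq]
    have hs : ∀ j : ℤ, ContDiffOn ℝ ∞ (fun p : ℂ × (Fin 3 → ℂ) =>
        h2 ((p.1 + (j : ℂ) * ev (f.basis a 0) p.2) / ev (f.basis a 2) p.2)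
          (ev (f.basis a 1) p.2 / ev (f.basis a 2) p.2)) (univ ×ˢ xDom a) := by
      intro j
      have hz : ContDiffOn ℝ ∞ (fun p : ℂ × (Fin 3 → ℂ) =>
          ((p.1 + (j : ℂ) * ev (f.basis a 0) p.2) / ev (f.basis a 2) p.2).im) (univ ×ˢ xDom a) :=
        contDiffOn_im_div (contDiff_fst.add (contDiff_const.mul (contDiff_ev _))) (contDiff_ev _)
          fun p hp => f.ev_ne_zero a hp.2
      have ht : ContDiffOn ℝ ∞ (fun p : ℂ × (Fin 3 → ℂ) =>
          (ev (f.basis a 1) p.2 / ev (f.basis a 2) p.2).im) (univ ×ˢ xDom a) :=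
        contDiffOn_im_div (contDiff_ev _) (contDiff_ev _) fun p hp => f.ev_ne_zero a hp.2
      simp only [h2_eq, R2]
      refine (contDiffOn_const.mul ?_).exp
      exact (((hz.pow 2).div ht fun p hp => (f.im_pos a hp.2).ne').sub hz).add (ht.div_const 6)
    refine ContDiffOn.congr (f := fun p : ℂ × (Fin 3 → ℂ) =>
      zprod ((g.tr ᵥ* (g.lin⁻¹).1) ⬝ᵥ a.1) fun j =>
        h2 ((p.1 + (j : ℂ) * ev (f.basis a 0) p.2) / ev (f.basis a 2) p.2)
          (ev (f.basis a 1) p.2 / ev (f.basis a 2) p.2)) ?_ fun p hp => ?_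
    · simp only [zprod]
      exact (contDiffOn_prod fun j _ => hs j).div (contDiffOn_prod fun j _ => hs j)
        fun p _ => Finset.prod_ne_zero_iff.2 fun j _ => (h2_pos _ _).ne'
    · rw [pull_of_mem _ (hdom.cone_of_mem p.1 p.2 hp.2)]
      rfl

/-! ### The gamma gerbe -/

theorem smul_mem_xDom (f : Framing) (a : Prim) (g : ISL3) {x : Fin 3 → ℂ} :
    actC g.lin x ∈ xDom (g • a) ↔ x ∈ xDom a := by
  rw [xDom, xDom, mem_ofPred_eq, mem_ofPred_eq]
  change 0 < nuv (g.lin.1 *ᵥ a.1) _ ↔ _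
  rw [nuv_mulVec g.lin a.1 x (f.cross_eq a)]

theorem smul_mem_V (f : Framing) (a : Prim) (g : ISL3) {y : X3} : g • y ∈ V (g • a) ↔ y ∈ V a := by
  obtain ⟨p, rfl⟩ := Quotient.exists_rep y
  change X3.mk (coneAct g p) ∈ _ ↔ X3.mk p ∈ _
  rw [(isDom_V f _).mem_iff, (isDom_V f _).mem_iff]
  exact smul_mem_xDom f a g

theorem norm_c01_smul (f : Framing) {a b : Prim} (g : ISL3) {p : cone} (ha : p.1.2 ∈ xDom a)
    (hb : p.1.2 ∈ xDom b) :
    ‖(gammaCochain f).c01 (g⁻¹ • a) (g⁻¹ • b) (g⁻¹ • X3.mk p)‖ ^ 2 *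
      (hermCochain f).c01 (g⁻¹ • a) (g⁻¹ • b) (g⁻¹ • X3.mk p) =
      pairNorm a b (p.1.1 + ev (g.tr ᵥ* (g.lin⁻¹).1) p.1.2) p.1.2 := by
  have h1 := norm_c01 f (p := coneAct g⁻¹ p) ((smul_mem_xDom f a g⁻¹).2 ha)
    ((smul_mem_xDom f b g⁻¹).2 hb)
  refine h1.trans ?_
  change pairNorm _ _ (p.1.1 - ev (-(g.tr ᵥ* (g.lin⁻¹).1)) p.1.2) (actC (g.lin⁻¹) p.1.2) = _
  rw [pairNorm_smul f ha hb g.lin⁻¹ rfl rfl, ev_neg, sub_neg_eq_add]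

theorem norm_c10_smul (f : Framing) {a : Prim} (g h : ISL3) {p : cone} (ha : p.1.2 ∈ xDom a) :
    ‖(gammaCochain f).c10 (g⁻¹ • a) h (g⁻¹ • X3.mk p)‖ ^ 2 *
      (hermCochain f).c10 (g⁻¹ • a) h (g⁻¹ • X3.mk p) =
      zprod (((h.tr ᵥ* (h.lin⁻¹).1) ᵥ* (g.lin⁻¹).1) ⬝ᵥ a.1) fun j =>
        lineNorm f a (j + (g.tr ᵥ* (g.lin⁻¹).1) ⬝ᵥ a.1) p.1.1 p.1.2 := by
  refine (norm_c10 f (g⁻¹ • a) h (coneAct g⁻¹ p)).trans ?_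
  change zprod _ (fun j => lineNorm f (g⁻¹ • a) j
    (p.1.1 - ev (-(g.tr ᵥ* (g.lin⁻¹).1)) p.1.2) (actC (g.lin⁻¹) p.1.2)) = _
  congr 1
  · exact Matrix.dotProduct_mulVec (h.tr ᵥ* (h.lin⁻¹).1) (g.lin⁻¹).1 a.1
  ext j
  rw [lineNorm_smul f g.lin⁻¹ rfl _ _ ha, ev_neg, sub_neg_eq_add, lineNorm_add f a j _ ha]

theorem norm_D_c02 (f : Framing) (a b c : Prim) {y : X3} (hy : y ∈ V a ∩ V b ∩ V c)
    (hg : y ∈ genX) :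
    ‖(D (gammaCochain f)).c02 a b c y‖ ^ 2 * (D (hermCochain f)).c02 a b c y = 1 := by
  obtain ⟨p, rfl⟩ := Quotient.exists_rep y
  obtain ⟨⟨ha, hb⟩, hc⟩ := ((((isDom_V f a).inter (isDom_V f b)).inter (isDom_V f c)).mem_iff p).1 hy
  have hw := mk_mem_genX.1 hg
  have h1 := pairNorm_mul f ha hb hc hw
  have h2 := (pairNorm_pos f ha hc hw).ne'
  change ‖(D (gammaCochain f)).c02 a b c (X3.mk p)‖ ^ 2 *
    (D (hermCochain f)).c02 a b c (X3.mk p) = 1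
  have e : ‖(D (gammaCochain f)).c02 a b c (X3.mk p)‖ ^ 2 *
      (D (hermCochain f)).c02 a b c (X3.mk p) =
      pairNorm b c p.1.1 p.1.2 * (pairNorm a c p.1.1 p.1.2)⁻¹ * pairNorm a b p.1.1 p.1.2 := by
    rw [← norm_c01 f hb hc, ← norm_c01 f ha hc, ← norm_c01 f ha hb]
    simp only [D, norm_mul, norm_inv, mul_pow, inv_pow, mul_inv]
    ring
  rw [e, ← h1]
  have h3 := (pairNorm_pos f ha hb hw).ne'
  have h4 := (pairNorm_pos f hb hc hw).ne'
  field_simp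

/-- The action by g⁻¹ amounts, by SL₃-invariance, to the translation w ↦ w + (μ ∘ g⁻¹)(x), and
`pairNorm_translate` produces exactly the norms of the Δ factors. -/
theorem norm_D_c11 (f : Framing) (a b : Prim) (g : ISL3) {y : X3} (hy : y ∈ V a ∩ V b)
    (hg : y ∈ genX) :
    ‖(D (gammaCochain f)).c11 a b g y‖ ^ 2 * (D (hermCochain f)).c11 a b g y = 1 := by
  obtain ⟨p, rfl⟩ := Quotient.exists_rep y
  obtain ⟨ha, hb⟩ := (((isDom_V f a).inter (isDom_V f b)).mem_iff p).1 hy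
  have hw := mk_mem_genX.1 hg
  change ‖(D (gammaCochain f)).c11 a b g (X3.mk p)‖ ^ 2 *
    (D (hermCochain f)).c11 a b g (X3.mk p) = 1
  have e : ‖(D (gammaCochain f)).c11 a b g (X3.mk p)‖ ^ 2 *
      (D (hermCochain f)).c11 a b g (X3.mk p) =
      (pairNorm a b (p.1.1 + ev (g.tr ᵥ* (g.lin⁻¹).1) p.1.2) p.1.2)⁻¹ * pairNorm a b p.1.1 p.1.2 *
      ((zprod ((g.tr ᵥ* (g.lin⁻¹).1) ⬝ᵥ b.1) fun j => lineNorm f b j p.1.1 p.1.2) *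
      (zprod ((g.tr ᵥ* (g.lin⁻¹).1) ⬝ᵥ a.1) fun j => lineNorm f a j p.1.1 p.1.2)⁻¹)⁻¹ := by
    rw [← norm_c01 f ha hb, ← norm_c01_smul f g ha hb, ← norm_c10, ← norm_c10]
    simp only [D, norm_mul, norm_inv, mul_pow, inv_pow, mul_inv, inv_inv]
    ring
  have h1 := (pairNorm_pos f ha hb hw).ne'
  have h2 := zprod_ne_zero (fun j => (lineNorm_pos f a j hw ha).ne') ((g.tr ᵥ* (g.lin⁻¹).1) ⬝ᵥ a.1)
  have h3 := zprod_ne_zero (fun j => (lineNorm_pos f b j hw hb).ne') ((g.tr ᵥ* (g.lin⁻¹).1) ⬝ᵥ b.1)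
  rw [e, pairNorm_translate f ha hb hw]
  field_simp

theorem norm_D_c20 (f : Framing) (a : Prim) (g h : ISL3) {y : X3} (hy : y ∈ V a) (hg : y ∈ genX) :
    ‖(D (gammaCochain f)).c20 a g h y‖ ^ 2 * (D (hermCochain f)).c20 a g h y = 1 := by
  obtain ⟨p, rfl⟩ := Quotient.exists_rep y
  have ha := ((isDom_V f a).mem_iff p).1 hy
  have hw := mk_mem_genX.1 hg
  change ‖(D (gammaCochain f)).c20 a g h (X3.mk p)‖ ^ 2 *
    (D (hermCochain f)).c20 a g h (X3.mk p) = 1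
  -- The forms μ ∘ g⁻¹ add up under multiplication, the second one transported by g⁻¹, so that
  -- `zprod_add` applies.
  have hm : ((g * h).tr ᵥ* ((g * h).lin⁻¹).1) ⬝ᵥ a.1 = (g.tr ᵥ* (g.lin⁻¹).1) ⬝ᵥ a.1 +
      ((h.tr ᵥ* (h.lin⁻¹).1) ᵥ* (g.lin⁻¹).1) ⬝ᵥ a.1 := by
    rw [ISL3.mul_tr, ISL3.mul_lin, mul_inv_rev, Matrix.SpecialLinearGroup.coe_mul,
      ← Matrix.vecMul_vecMul, Matrix.add_vecMul, Matrix.vecMul_vecMul g.tr,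
      ← Matrix.SpecialLinearGroup.coe_mul, mul_inv_cancel, Matrix.SpecialLinearGroup.coe_one,
      Matrix.vecMul_one, Matrix.add_vecMul, add_dotProduct, add_comm]
  have e : ‖(D (gammaCochain f)).c20 a g h (X3.mk p)‖ ^ 2 *
      (D (hermCochain f)).c20 a g h (X3.mk p) =
      (zprod (((h.tr ᵥ* (h.lin⁻¹).1) ᵥ* (g.lin⁻¹).1) ⬝ᵥ a.1) fun j =>
        lineNorm f a (j + (g.tr ᵥ* (g.lin⁻¹).1) ⬝ᵥ a.1) p.1.1 p.1.2) *
      (zprod (((g * h).tr ᵥ* ((g * h).lin⁻¹).1) ⬝ᵥ a.1) fun j => lineNorm f a j p.1.1 p.1.2)⁻¹ *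
      (zprod ((g.tr ᵥ* (g.lin⁻¹).1) ⬝ᵥ a.1) fun j => lineNorm f a j p.1.1 p.1.2) := by
    rw [← norm_c10_smul f g h ha, ← norm_c10, ← norm_c10]
    simp only [D, norm_mul, norm_inv, mul_pow, inv_pow, mul_inv]
    ring
  have hne : ∀ j, lineNorm f a j p.1.1 p.1.2 ≠ 0 := fun j => (lineNorm_pos f a j hw ha).ne'
  have h1 := zprod_ne_zero hne ((g.tr ᵥ* (g.lin⁻¹).1) ⬝ᵥ a.1)
  have h2 := zprod_ne_zero (fun j => hne (j + (g.tr ᵥ* (g.lin⁻¹).1) ⬝ᵥ a.1))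
    (((h.tr ᵥ* (h.lin⁻¹).1) ᵥ* (g.lin⁻¹).1) ⬝ᵥ a.1)
  rw [e, hm, zprod_add hne]
  field_simp

theorem hermCochain_continuousOn_c01 (f : Framing) (a b : Prim) :
    ContinuousOn ((hermCochain f).c01 a b) (V a ∩ V b) :=
  ((isDom_V f a).inter (isDom_V f b)).continuousOn (isPosSmoothOn_c01 f a b).2.continuousOn

theorem hermCochain_continuousOn_c10 (f : Framing) (a : Prim) (g : ISL3) :
    ContinuousOn ((hermCochain f).c10 a g) (V a) :=
  (isDom_V f a).continuousOn (isPosSmoothOn_c10 f a g).2.continuousOn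

theorem ContinuousOn.comp_inv_smul {M : Type*} [TopologicalSpace M] {T : X3 → M} {A B : Set X3}
    (hT : ContinuousOn T A) {g : ISL3} (h : ∀ y ∈ B, g⁻¹ • y ∈ A) :
    ContinuousOn (fun y => T (g⁻¹ • y)) B :=
  hT.comp (continuous_const_smul g⁻¹).continuousOn h

theorem inv_smul_mem_V (f : Framing) {a : Prim} (g : ISL3) {y : X3} (hy : y ∈ V a) :
    g⁻¹ • y ∈ V (g⁻¹ • a) := (smul_mem_V f a g⁻¹).2 hy

/-- The cocycle of the gamma gerbe. -/
def gerbeCocycle (f : Framing) : Cochain2 ℂ where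
  c02 a b c := extend ((D (gammaCochain f)).c02 a b c)
  c11 a b g := extend ((D (gammaCochain f)).c11 a b g)
  c20 a g h := extend ((D (gammaCochain f)).c20 a g h)

theorem gerbeCocycle_c02 (f : Framing) (a b c : Prim) :
    IsHolUnitOn (V a ∩ V b ∩ V c) ((gerbeCocycle f).c02 a b c) ∧
    ContinuousOn ((gerbeCocycle f).c02 a b c) (V a ∩ V b ∩ V c) ∧
    (∀ y ∈ V a ∩ V b ∩ V c, (D (hermCochain f)).c02 a b c y =
      (‖(gerbeCocycle f).c02 a b c y‖ ^ 2)⁻¹) ∧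
    MeroEqOn (V a ∩ V b ∩ V c) ((gerbeCocycle f).c02 a b c) ((D (gammaCochain f)).c02 a b c) ∧
    ∀ y ∈ V a ∩ V b ∩ V c, y ∈ genX →
      (gerbeCocycle f).c02 a b c y = (D (gammaCochain f)).c02 a b c y := by
  have hbc := fun y (hy : y ∈ V a ∩ V b ∩ V c) => (⟨hy.1.2, hy.2⟩ : y ∈ V b ∩ V c)
  have hac := fun y (hy : y ∈ V a ∩ V b ∩ V c) => (⟨hy.1.1, hy.2⟩ : y ∈ V a ∩ V c)
  have hab := fun y (hy : y ∈ V a ∩ V b ∩ V c) => hy.1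
  refine extend_spec (((isDom_V f a).inter (isDom_V f b)).inter (isDom_V f c)) ?_
    (k := (D (hermCochain f)).c02 a b c) ?_ ?_ fun y hy hg => norm_D_c02 f a b c hy hg
  · exact (((isMero_c01 f b c).mono fun x hx => ⟨hx.1.2, hx.2⟩).mul
      ((isMero_c01 f a c).mono fun x hx => ⟨hx.1.1, hx.2⟩).inv).mul
      ((isMero_c01 f a b).mono fun x hx => hx.1)
  · exact (((hermCochain_continuousOn_c01 f b c).mono hbc).mul
      (((hermCochain_continuousOn_c01 f a c).mono hac).inv₀
        fun y hy => ((isPosSmoothOn_c01 f a c).1 y (hac y hy)).ne')).mul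
      ((hermCochain_continuousOn_c01 f a b).mono hab)
  · exact fun y hy => mul_pos (mul_pos ((isPosSmoothOn_c01 f b c).1 y (hbc y hy))
      (inv_pos.2 ((isPosSmoothOn_c01 f a c).1 y (hac y hy))))
      ((isPosSmoothOn_c01 f a b).1 y (hab y hy))

theorem gerbeCocycle_c11 (f : Framing) (a b : Prim) (g : ISL3) :
    IsHolUnitOn (V a ∩ V b) ((gerbeCocycle f).c11 a b g) ∧
    ContinuousOn ((gerbeCocycle f).c11 a b g) (V a ∩ V b) ∧
    (∀ y ∈ V a ∩ V b, (D (hermCochain f)).c11 a b g y =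
      (‖(gerbeCocycle f).c11 a b g y‖ ^ 2)⁻¹) ∧
    MeroEqOn (V a ∩ V b) ((gerbeCocycle f).c11 a b g) ((D (gammaCochain f)).c11 a b g) ∧
    ∀ y ∈ V a ∩ V b, y ∈ genX →
      (gerbeCocycle f).c11 a b g y = (D (gammaCochain f)).c11 a b g y := by
  have hg := fun y (hy : y ∈ V a ∩ V b) =>
    (⟨inv_smul_mem_V f g hy.1, inv_smul_mem_V f g hy.2⟩ : g⁻¹ • y ∈ V (g⁻¹ • a) ∩ V (g⁻¹ • b))
  have hdom := (isDom_V f a).inter (isDom_V f b)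
  refine extend_spec hdom ?_
    (k := (D (hermCochain f)).c11 a b g) ?_ ?_ fun y hy hy' => norm_D_c11 f a b g hy hy'
  · exact (((isMero_c01 f (g⁻¹ • a) (g⁻¹ • b)).comp_smul (U' := xDom a ∩ xDom b)
      (fun x hx => hdom.cone_of_mem 0 x hx) fun x hx =>
        ⟨(smul_mem_xDom f a g⁻¹).2 hx.1, (smul_mem_xDom f b g⁻¹).2 hx.2⟩).inv.mul
      (isMero_c01 f a b)).mul
      (((isMero_c10 f b g).mono inter_subset_right).mul
        ((isMero_c10 f a g).mono inter_subset_left).inv).inv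
  · refine (((ContinuousOn.comp_inv_smul (hermCochain_continuousOn_c01 f _ _) hg).inv₀
      fun y hy => ((isPosSmoothOn_c01 f _ _).1 _ (hg y hy)).ne').mul
      (hermCochain_continuousOn_c01 f a b)).mul
      ((((hermCochain_continuousOn_c10 f b g).mono inter_subset_right).mul
        (((hermCochain_continuousOn_c10 f a g).mono inter_subset_left).inv₀ fun y hy => ?_)).inv₀
          fun y hy => ?_)
    · exact ((isPosSmoothOn_c10 f a g).1 y hy.1).ne'
    · exact mul_ne_zero ((isPosSmoothOn_c10 f b g).1 y hy.2).ne'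
        (inv_ne_zero ((isPosSmoothOn_c10 f a g).1 y hy.1).ne')
  · exact fun y hy => mul_pos (mul_pos (inv_pos.2 ((isPosSmoothOn_c01 f _ _).1 _ (hg y hy)))
      ((isPosSmoothOn_c01 f a b).1 y hy))
      (inv_pos.2 (mul_pos ((isPosSmoothOn_c10 f b g).1 y hy.2)
        (inv_pos.2 ((isPosSmoothOn_c10 f a g).1 y hy.1))))

theorem gerbeCocycle_c20 (f : Framing) (a : Prim) (g h : ISL3) :
    IsHolUnitOn (V a) ((gerbeCocycle f).c20 a g h) ∧
    ContinuousOn ((gerbeCocycle f).c20 a g h) (V a) ∧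
    (∀ y ∈ V a, (D (hermCochain f)).c20 a g h y =
      (‖(gerbeCocycle f).c20 a g h y‖ ^ 2)⁻¹) ∧
    MeroEqOn (V a) ((gerbeCocycle f).c20 a g h) ((D (gammaCochain f)).c20 a g h) ∧
    ∀ y ∈ V a, y ∈ genX → (gerbeCocycle f).c20 a g h y = (D (gammaCochain f)).c20 a g h y := by
  have hdom := isDom_V f a
  refine extend_spec hdom ?_
    (k := (D (hermCochain f)).c20 a g h) ?_ ?_ fun y hy hy' => norm_D_c20 f a g h hy hy'
  · exact (((isMero_c10 f (g⁻¹ • a) h).comp_smul (U' := xDom a)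
      (fun x hx => hdom.cone_of_mem 0 x hx) fun x hx => (smul_mem_xDom f a g⁻¹).2 hx).mul
      (isMero_c10 f a (g * h)).inv).mul (isMero_c10 f a g)
  · exact ((ContinuousOn.comp_inv_smul (hermCochain_continuousOn_c10 f _ h)
      fun y hy => inv_smul_mem_V f g hy).mul ((hermCochain_continuousOn_c10 f a (g * h)).inv₀
        fun y hy => ((isPosSmoothOn_c10 f a _).1 y hy).ne')).mul (hermCochain_continuousOn_c10 f a g)
  · exact fun y hy => mul_pos (mul_pos ((isPosSmoothOn_c10 f _ h).1 _ (inv_smul_mem_V f g hy))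
      (inv_pos.2 ((isPosSmoothOn_c10 f a _).1 y hy))) ((isPosSmoothOn_c10 f a g).1 y hy)

theorem gammaCochain_c01_swap (f : Framing) {a b : Prim} {y : X3} (hy : y ∈ V a ∩ V b) :
    (gammaCochain f).c01 b a y = ((gammaCochain f).c01 a b y)⁻¹ := by
  by_cases hab : a = b
  · subst hab
    rw [gammaCochain_c01_self, inv_one]
  obtain ⟨p, rfl⟩ := Quotient.exists_rep y
  obtain ⟨ha, hb⟩ := (((isDom_V f a).inter (isDom_V f b)).mem_iff p).1 hy
  obtain ⟨ε, ε', η, η', s, h⟩ := exists_isWedge f hab ha hb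
  change (gammaCochain f).c01 b a (X3.mk p) = ((gammaCochain f).c01 a b (X3.mk p))⁻¹
  rw [gammaCochain_c01 f hab, gammaCochain_c01 f (Ne.symm hab), h.wedgeGamma_eq ha rfl,
    h.symm.wedgeGamma_eq hb h.symm.dirVec_eq, neg_neg, inv_div]

theorem hermCochain_c01_swap (f : Framing) {a b : Prim} {y : X3} (hy : y ∈ V a ∩ V b) :
    (hermCochain f).c01 a b y * (hermCochain f).c01 b a y = 1 := by
  by_cases hab : a = b
  · subst hab
    rw [hermCochain_c01_self, one_mul]
  obtain ⟨p, rfl⟩ := Quotient.exists_rep y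
  obtain ⟨ha, hb⟩ := (((isDom_V f a).inter (isDom_V f b)).mem_iff p).1 hy
  obtain ⟨ε, ε', η, η', s, h⟩ := exists_isWedge f hab ha hb
  have hp := isWedgePair_of_ne f ha hb hab
  have hq := isWedgePair_of_ne f hb ha (Ne.symm hab)
  change (hermCochain f).c01 a b (X3.mk p) * (hermCochain f).c01 b a (X3.mk p) = 1
  rw [hermCochain_c01 f hab, hermCochain_c01 f (Ne.symm hab), wedgeHerm_mk_eq h rfl hp,
    wedgeHerm_mk_eq h.symm h.symm.dirVec_eq hq, h.symm.boxSum_congr hq hp.symm _ _ _ hb ha,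
    h.boxSum_swap _ _ _ _ _ ha, ← Real.exp_add]
  simp

theorem gammaCochain_c01_ne_zero (f : Framing) {a b : Prim} {y : X3} (ha : y ∈ V a) (hb : y ∈ V b)
    (hg : y ∈ genX) : (gammaCochain f).c01 a b y ≠ 0 :=
  (isMero_c01 f a b).ne_zero ((isDom_V f a).inter (isDom_V f b)) ⟨ha, hb⟩ hg

theorem gammaCochain_c10_ne_zero (f : Framing) {a : Prim} (g : ISL3) {y : X3} (ha : y ∈ V a)
    (hg : y ∈ genX) : (gammaCochain f).c10 a g y ≠ 0 :=
  (isMero_c10 f a g).ne_zero (isDom_V f a) ha hg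

/-- At generic points the extended functions are the components of Ds, with nonzero entries, and D²
= 1 is a cancellation. Both sides are continuous and generic points are dense. -/
theorem isCocycle2_gerbeCocycle (f : Framing) : IsCocycle2 (gerbeCocycle f) := by
  obtain ⟨φ, hφ⟩ : ∃ φ, φ = gerbeCocycle f := ⟨_, rfl⟩
  obtain ⟨s, hs⟩ : ∃ s, s = gammaCochain f := ⟨_, rfl⟩
  have k02 := gerbeCocycle_c02 f
  have k11 := gerbeCocycle_c11 f
  have k20 := gerbeCocycle_c20 f
  have n01 : ∀ {a b : Prim} {y : X3}, y ∈ V a → y ∈ V b → y ∈ genX → s.c01 a b y ≠ 0 :=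
    hs ▸ gammaCochain_c01_ne_zero f
  have n10 : ∀ {a : Prim} (g : ISL3) {y : X3}, y ∈ V a → y ∈ genX → s.c10 a g y ≠ 0 :=
    hs ▸ gammaCochain_c10_ne_zero f
  rw [← hφ, ← hs] at *
  have gs : ∀ (g : ISL3) {y : X3}, y ∈ genX → g⁻¹ • y ∈ genX := fun g y hy => (smul_mem_genX _).2 hy
  have vs : ∀ (g : ISL3) {a : Prim} {y : X3}, y ∈ V a → g⁻¹ • y ∈ V (g⁻¹ • a) :=
    fun g a y hy => inv_smul_mem_V f g hy
  refine ⟨fun a b c d => ?_, fun a b c g => ?_, fun a b g h => ?_, fun a g h k => ?_⟩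
  · have hdom := (((isDom_V f a).inter (isDom_V f b)).inter (isDom_V f c)).inter (isDom_V f d)
    have m1 : V a ∩ V b ∩ V c ∩ V d ⊆ V b ∩ V c ∩ V d := fun y hy => ⟨⟨hy.1.1.2, hy.1.2⟩, hy.2⟩
    have m2 : V a ∩ V b ∩ V c ∩ V d ⊆ V a ∩ V c ∩ V d := fun y hy => ⟨⟨hy.1.1.1, hy.1.2⟩, hy.2⟩
    have m3 : V a ∩ V b ∩ V c ∩ V d ⊆ V a ∩ V b ∩ V d := fun y hy => ⟨hy.1.1, hy.2⟩
    have m4 : V a ∩ V b ∩ V c ∩ V d ⊆ V a ∩ V b ∩ V c := fun y hy => hy.1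
    refine hdom.eqOn_of_genX (T := fun _ => 1)
      (((((k02 b c d).2.1.mono m1).mul (((k02 a c d).2.1.mono m2).inv₀
        fun y hy => (k02 a c d).1.1 y (m2 hy))).mul ((k02 a b d).2.1.mono m3)).mul
        (((k02 a b c).2.1.mono m4).inv₀ fun y hy => (k02 a b c).1.1 y (m4 hy)))
      continuousOn_const fun y hy hg => ?_
    simp only [(k02 b c d).2.2.2.2 y (m1 hy) hg, (k02 a c d).2.2.2.2 y (m2 hy) hg,
      (k02 a b d).2.2.2.2 y (m3 hy) hg, (k02 a b c).2.2.2.2 y (m4 hy) hg, D]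
    obtain ⟨⟨⟨ha, hb⟩, hc⟩, hd⟩ := hy
    have := n01 ha hb hg
    have := n01 ha hc hg
    have := n01 ha hd hg
    have := n01 hb hc hg
    have := n01 hb hd hg
    have := n01 hc hd hg
    field_simp
  · have hdom := ((isDom_V f a).inter (isDom_V f b)).inter (isDom_V f c)
    have m0 : ∀ y ∈ V a ∩ V b ∩ V c, g⁻¹ • y ∈ V (g⁻¹ • a) ∩ V (g⁻¹ • b) ∩ V (g⁻¹ • c) :=
      fun y hy => ⟨⟨vs g hy.1.1, vs g hy.1.2⟩, vs g hy.2⟩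
    have m1 : V a ∩ V b ∩ V c ⊆ V b ∩ V c := fun y hy => ⟨hy.1.2, hy.2⟩
    have m2 : V a ∩ V b ∩ V c ⊆ V a ∩ V c := fun y hy => ⟨hy.1.1, hy.2⟩
    have m3 : V a ∩ V b ∩ V c ⊆ V a ∩ V b := fun y hy => hy.1
    refine hdom.eqOn_of_genX (T := fun _ => 1)
      ((((ContinuousOn.comp_inv_smul (k02 _ _ _).2.1 m0).inv₀
        fun y hy => (k02 _ _ _).1.1 _ (m0 y hy)).mul (k02 a b c).2.1).mul
        (((((k11 b c g).2.1.mono m1).mul (((k11 a c g).2.1.mono m2).inv₀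
          fun y hy => (k11 a c g).1.1 y (m2 hy))).mul ((k11 a b g).2.1.mono m3)).inv₀
          fun y hy => mul_ne_zero (mul_ne_zero ((k11 b c g).1.1 y (m1 hy))
            (inv_ne_zero ((k11 a c g).1.1 y (m2 hy)))) ((k11 a b g).1.1 y (m3 hy))))
      continuousOn_const fun y hy hg => ?_
    simp only [(k02 _ _ _).2.2.2.2 _ (m0 y hy) (gs g hg), (k02 a b c).2.2.2.2 y hy hg,
      (k11 b c g).2.2.2.2 y (m1 hy) hg, (k11 a c g).2.2.2.2 y (m2 hy) hg,
      (k11 a b g).2.2.2.2 y (m3 hy) hg, D]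
    obtain ⟨⟨ha, hb⟩, hc⟩ := hy
    have := n01 ha hb hg
    have := n01 ha hc hg
    have := n01 hb hc hg
    have := n01 (vs g ha) (vs g hb) (gs g hg)
    have := n01 (vs g ha) (vs g hc) (gs g hg)
    have := n01 (vs g hb) (vs g hc) (gs g hg)
    have := n10 g ha hg
    have := n10 g hb hg
    have := n10 g hc hg
    field_simp
  · have hdom := (isDom_V f a).inter (isDom_V f b)
    have m0 : ∀ y ∈ V a ∩ V b, g⁻¹ • y ∈ V (g⁻¹ • a) ∩ V (g⁻¹ • b) :=
      fun y hy => ⟨vs g hy.1, vs g hy.2⟩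
    refine hdom.eqOn_of_genX (T := fun _ => 1)
      ((((ContinuousOn.comp_inv_smul (k11 _ _ h).2.1 m0).mul ((k11 a b (g * h)).2.1.inv₀
        fun y hy => (k11 a b (g * h)).1.1 y hy)).mul (k11 a b g).2.1).mul
        (((k20 b g h).2.1.mono inter_subset_right).mul
          (((k20 a g h).2.1.mono inter_subset_left).inv₀
          fun y hy => (k20 a g h).1.1 y hy.1)))
      continuousOn_const fun y hy hg => ?_
    simp only [(k11 _ _ h).2.2.2.2 _ (m0 y hy) (gs g hg), (k11 a b (g * h)).2.2.2.2 y hy hg,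
      (k11 a b g).2.2.2.2 y hy hg, (k20 b g h).2.2.2.2 y hy.2 hg,
      (k20 a g h).2.2.2.2 y hy.1 hg, D, mul_inv_rev, mul_smul]
    obtain ⟨ha, hb⟩ := hy
    have := n01 ha hb hg
    have := n01 (vs g ha) (vs g hb) (gs g hg)
    have := n01 (vs h (vs g ha)) (vs h (vs g hb)) (gs h (gs g hg))
    have := n10 g ha hg
    have := n10 g hb hg
    have := n10 (g * h) ha hg
    have := n10 (g * h) hb hg
    have := n10 h (vs g ha) (gs g hg)
    have := n10 h (vs g hb) (gs g hg)
    field_simp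
  · have hdom := isDom_V f a
    refine hdom.eqOn_of_genX (T := fun _ => 1)
      (((((ContinuousOn.comp_inv_smul (k20 _ h k).2.1 fun y hy => vs g hy).inv₀
        fun y hy => (k20 _ h k).1.1 _ (vs g hy)).mul (k20 a (g * h) k).2.1).mul
        ((k20 a g (h * k)).2.1.inv₀ fun y hy => (k20 a g (h * k)).1.1 y hy)).mul
        (k20 a g h).2.1)
      continuousOn_const fun y hy hg => ?_
    simp only [(k20 _ h k).2.2.2.2 _ (vs g hy) (gs g hg), (k20 a (g * h) k).2.2.2.2 y hy hg,
      (k20 a g (h * k)).2.2.2.2 y hy hg, (k20 a g h).2.2.2.2 y hy hg, D, mul_inv_rev, mul_smul,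
      mul_assoc g h k]
    have := n10 g hy hg
    have := n10 (g * h) hy hg
    have := n10 (g * (h * k)) hy hg
    have := n10 h (vs g hy) (gs g hg)
    have := n10 (h * k) (vs g hy) (gs g hg)
    have := n10 k (vs h (vs g hy)) (gs h (gs g hg))
    field_simp

theorem isGammaGerbe_gerbeCocycle (f : Framing) : IsGammaGerbe f (gerbeCocycle f) := by
  refine ⟨⟨fun a b c => (gerbeCocycle_c02 f a b c).1, fun a b g => (gerbeCocycle_c11 f a b g).1,
    fun a g h => (gerbeCocycle_c20 f a g h).1, isCocycle2_gerbeCocycle f, fun a b c => ?_,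
    fun a b c => ?_⟩, fun a b c => (gerbeCocycle_c02 f a b c).2.2.2.1,
    fun a b g => (gerbeCocycle_c11 f a b g).2.2.2.1, fun a g h => (gerbeCocycle_c20 f a g h).2.2.2.1⟩
  · have m : V a ∩ V b ∩ V c ⊆ V b ∩ V a ∩ V c := fun y hy => ⟨⟨hy.1.2, hy.1.1⟩, hy.2⟩
    have k := gerbeCocycle_c02 f a b c
    have k' := gerbeCocycle_c02 f b a c
    refine (((isDom_V f a).inter (isDom_V f b)).inter (isDom_V f c)).eqOn_of_genX
      (k'.2.1.mono m) (k.2.1.inv₀ k.1.1) fun y hy hg => ?_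
    rw [k.2.2.2.2 y hy hg, k'.2.2.2.2 y (m hy) hg]
    simp only [D, gammaCochain_c01_swap f hy.1, mul_inv, inv_inv]
    ring
  · have m : V a ∩ V b ∩ V c ⊆ V a ∩ V c ∩ V b := fun y hy => ⟨⟨hy.1.1, hy.2⟩, hy.1.2⟩
    have k := gerbeCocycle_c02 f a b c
    have k' := gerbeCocycle_c02 f a c b
    refine (((isDom_V f a).inter (isDom_V f b)).inter (isDom_V f c)).eqOn_of_genX
      (k'.2.1.mono m) (k.2.1.inv₀ k.1.1) fun y hy hg => ?_
    rw [k.2.2.2.2 y hy hg, k'.2.2.2.2 y (m hy) hg]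
    simp only [D, gammaCochain_c01_swap f (⟨hy.1.2, hy.2⟩ : y ∈ V b ∩ V c), mul_inv, inv_inv]
    ring

/-- Any cocycle of the gamma gerbe coincides with `gerbeCocycle`, as both are continuous and agree
on a dense open set; for the latter the norm identity comes from `extend_spec`. -/
theorem isEquivariantHermitianStructure_hermCochain (f : Framing) {φ : Cochain2 ℂ}
    (hφ : IsGammaGerbe f φ) : IsEquivariantHermitianStructure φ (hermCochain f) := by
  refine ⟨isPosSmoothOn_c01 f, isPosSmoothOn_c10 f, fun a b y hy => hermCochain_c01_swap f hy,
    fun a b c y hy => ?_, fun a b g y hy => ?_, fun a g h y hy => ?_⟩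
  · have k := gerbeCocycle_c02 f a b c
    have hdom := ((isDom_V f a).inter (isDom_V f b)).inter (isDom_V f c)
    rw [k.2.2.1 y hy, MeroEqOn.eqOn (hdom.continuousOn (hφ.gerbe.hol02 a b c).2.continuousOn) k.2.1
      (hφ.eq02 a b c) k.2.2.2.1 hy]
  · have k := gerbeCocycle_c11 f a b g
    have hdom := (isDom_V f a).inter (isDom_V f b)
    rw [k.2.2.1 y hy, MeroEqOn.eqOn (hdom.continuousOn (hφ.gerbe.hol11 a b g).2.continuousOn) k.2.1
      (hφ.eq11 a b g) k.2.2.2.1 hy]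
  · have k := gerbeCocycle_c20 f a g h
    rw [k.2.2.1 y hy, MeroEqOn.eqOn ((isDom_V f a).continuousOn
      (hφ.gerbe.hol20 a g h).2.continuousOn) k.2.1 (hφ.eq20 a g h) k.2.2.2.1 hy]

theorem hermCochain_c01_eq_wedgeHerm (f : Framing) {a b : Prim} (hab : a ≠ b) {α β : DualLat}
    (hp : IsWedgePair a.1 b.1 α β) {y : X3} (hy : y ∈ V a ∩ V b) :
    (hermCochain f).c01 a b y = wedgeHerm a.1 b.1 α β y := by
  obtain ⟨p, rfl⟩ := Quotient.exists_rep y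
  obtain ⟨ha, hb⟩ := (((isDom_V f a).inter (isDom_V f b)).mem_iff p).1 hy
  obtain ⟨ε, ε', η, η', s, h⟩ := exists_isWedge f hab ha hb
  have hq := isWedgePair_of_ne f ha hb hab
  change (hermCochain f).c01 a b (X3.mk p) = wedgeHerm a.1 b.1 α β (X3.mk p)
  rw [hermCochain_c01 f hab, wedgeHerm_mk_eq h rfl hp, wedgeHerm_mk_eq h rfl hq,
    h.boxSum_congr hq hp _ _ _ ha hb]

end GammaGerbe

end

theorem mainTheorem8 (f : GammaGerbe.Framing) :
    (∃ φ : GammaGerbe.Cochain2 ℂ, GammaGerbe.IsGammaGerbe f φ) ∧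
    (∀ φ : GammaGerbe.Cochain2 ℂ, GammaGerbe.IsGammaGerbe f φ →
      GammaGerbe.IsEquivariantHermitianStructure φ (GammaGerbe.hermCochain f)) ∧
    (∀ a b : GammaGerbe.Prim, a ≠ b → ∀ α β : GammaGerbe.DualLat,
      GammaGerbe.IsWedgePair a.1 b.1 α β → ∀ y ∈ GammaGerbe.V a ∩ GammaGerbe.V b,
        (GammaGerbe.hermCochain f).c01 a b y = GammaGerbe.wedgeHerm a.1 b.1 α β y) := by
  exact ⟨⟨_, GammaGerbe.isGammaGerbe_gerbeCocycle f⟩,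
    fun _ hφ => GammaGerbe.isEquivariantHermitianStructure_hermCochain f hφ,
    fun _ _ hab _ _ hp _ hy => GammaGerbe.hermCochain_c01_eq_wedgeHerm f hab hp hy⟩
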